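/- **Setting.** Let $V,W,U$ be finite-dimensional real vector spaces (with any norms), $p\ge 1$, $N:=\lfloor p\rfloor$, $T>0$, and let $\omega$ be a control: a continuous nonnegative function on $\{0\le s\le t\le T\}$ with $\omega(t,t)=0$ and $\omega(s,u)+\omega(u,t)\le\omega(s,t)$ for $s\le u\le t$. Write $a_{st}\approx_m b_{st}$ if $|a_{st}-b_{st}|\le C\,\omega(s,t)^{m/p}$ for all $0\le s\le t\le T$ and some constant $C$, and $\approx$ for $\approx_{N+1}$. For a path $Y$ put $Y_{st}:=Y_t-Y_s$; $\mathcal C^p_\omega([0,T],E)$ is the set of continuous paths in $E$ with $Y_{st}\approx_1 0$. * A *rough path* $\mathbf X\in\mathscr C^p_\omega([0,T],V)$ is a continuous map from $\{0\le s\le t\le T\}$ to $\bigoplus_{n=0}^{N}V^{\otimes n}$ with $\mathbf X^0=1$, $\mathbf X^n_{st}\approx_n 0$ for $1\le n\le N$, $\mathbf X_{st}=(\mathbf X_{su}\otimes\mathbf X_{ut})^{\le N}$ for $s\le u\le t$, and $\mathbf X_{st}\boxtimes\mathbf X_{st}=\Delta\mathbf X_{st}$ in all bidegrees $(i,j)$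 with $i+j\le N$, where $\Delta(v_1\otimes\cdots\otimes v_n)=\sum_{S\subseteq\{1,\dots,n\}}v_S\boxtimes v_{S^c}$ is the shuffle coproduct ($v_S$: the tensor product of the $v_i$, $i\in S$, in increasing order). * A *$U$-valued $\mathbf X$-controlled path* $\overline H\in\mathscr D_{\mathbf X}(U)$ is an element $(\overline H_0,\dots,\overline H_{N-1})$ of $\mathcal C^p_\omega([0,T],\mathcal L(\bigoplus_{n=0}^{N-1}V^{\otimes n},U))$ such that $\langle\overline H_{n;t},a\rangle\approx_{N-n}\sum_{k=0}^{N-1-n}\langle\overline H_{n+k;s},\mathbf X^k_{st}\otimes a\rangle$ for $0\le n\le N-2$ and $a\in V^{\otimes n}$. Its trace is $H:=\overline H_0$. * For $\overline H\in\mathscr D_{\mathbf X}(\mathcal L(V,W))$, identify $\mathcal L(V^{\otimes (n-1)},\mathcal L(V,W))=\mathcal L(V^{\otimes n},W)$, the last slot being the target copy of $V$. The *rough integral* $I=\int_0^{\cdot}\overline H\,d\mathbf X$ is the unique $I\in\mathcal C^p_\omega([0,T],W)$ with $I_0=0$ and $I_{st}\approx\sum_{n=1}^{N}\langle\overline H_{n-1;s},\mathbf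 X^n_{st}\rangle$. The controlled path $\overline{\int}\,\overline H\,d\mathbf X$ has trace $I$ and level $n$ equal to $\overline H_{n-1}$, $1\le n\le N-1$. * An *ordered shuffle* of $n$ letters into $m$ blocks is a partition of $\{1,\dots,n\}$ into $m$ nonempty blocks $B_1,\dots,B_m$ with $\max B_1<\dots<\max B_m$. For linear maps $h_k$ on $V^{\otimes k}$ and such a shuffle let $h_B(v_1\otimes\cdots\otimes v_n):=h_{|B_1|}(v_{B_1})\otimes\cdots\otimes h_{|B_m|}(v_{B_m})$, where $v_B$ is the tensor product of the $v_i$, $i\in B$, in increasing order. For $\overline H\in\mathscr D_{\mathbf X}(U)$ let $A_{st}^0=1$, $A^1_{st}=H_{st}$ and $A^m_{st}=\sum_{n\le N}\sum_{B}\langle(\overline H_s)_B,\mathbf X^n_{st}\rangle$ for $2\le m\le N$, the inner sum being over the ordered shuffles of $n$ letters into $m$ blocks. The *lift* is $\uparrow_{\mathbf X}\overline H:=\lim\bigotimes_{[u,v]\in\pi}A_{uv}$ (in degrees $\le N$), the limit being over the partitions $\pi$ of $[s,t]$ with mesh tending to $0$. Put $\boldsymbol{\int}\overline H\,d\mathbf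 X:=\,\uparrow_{\mathbf X}\overline{\int}\,\overline H\,d\mathbf X$. * For $\overline H\in\mathscr D_{\mathbf X}(U)$ and $\overline K$ controlled by $\uparrow_{\mathbf X}\overline H$, set $(\overline K*\overline H)_0:=K$ and $(\overline K*\overline H)_n:=\sum_{m=1}^n\sum_B\overline K_m\circ\overline H_B$, the inner sum being over the ordered shuffles of $n$ letters into $m$ blocks. * For $\mathbf X$-controlled paths $\overline K,\overline H$ with values in $\mathcal L(U_2,U_3)$ and $\mathcal L(U_1,U_2)$, set $(\overline K\cdot\overline H)_n(v_1\otimes\cdots\otimes v_n):=\sum_{S\subseteq\{1,\dots,n\}}\overline K_{|S|}(v_S)\circ\overline H_{n-|S|}(v_{S^c})$. **Theorem (associativity of the rough integral).** Let $\mathbf X\in\mathscr C^p_\omega([0,T],V)$ and $\overline H\in\mathscr D_{\mathbf X}(\mathcal L(V,W))$. Let $I:=\int\overline H\,d\mathbf X$, $\overline I:=\overline{\int}\,\overline H\,d\mathbf X$ and $\mathbf I:=\boldsymbol{\int}\overline H\,d\mathbf X$. Then $I$ exists, $\overline I\in\mathscr D_{\mathbf X}(W)$, and the limit defining $\mathbf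 I$ exists and lies in $\mathscr C^p_\omega([0,T],W)$. Let $\overline K\in\mathscr D_{\mathbf I}(\mathcal L(W,U))$. Then all integrals, limits, products, controlled paths and rough paths below are likewise well defined, in $\mathscr D_{\mathbf X}(U)$ one has $$\Big(\overline{\int}\,\overline K\,d\mathbf I\Big)*\overline I=\overline{\int}\,(\overline K*\overline I)\cdot\overline H\,d\mathbf X ,$$ and in $\mathscr C^p_\omega([0,T],U)$ one has $$\boldsymbol{\int}\overline K\,d\mathbf I=\boldsymbol{\int}(\overline K*\overline I)\cdot\overline H\,d\mathbf X .$$ -/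

import Mathlib

open scoped TensorProduct

noncomputable section

namespace GeomRough

/-! ### Controls, regularity, and the relation of agreement up to a given order -/

/-- A control on `[0, T]`: a continuous, nonnegative, superadditive function on the simplex
`{(s, t) | 0 ≤ s ≤ t ≤ T}` that vanishes on the diagonal. -/
structure IsControl (T : ℝ) (ω : ℝ → ℝ → ℝ) : Prop where
  continuousOn : ContinuousOn (fun q : ℝ × ℝ => ω q.1 q.2) {q | 0 ≤ q.1 ∧ q.1 ≤ q.2 ∧ q.2 ≤ T}
  nonneg : ∀ s t, 0 ≤ s → s ≤ t → t ≤ T → 0 ≤ ω s t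
  diag : ∀ t, 0 ≤ t → t ≤ T → ω t t = 0
  superadd : ∀ s u t, 0 ≤ s → s ≤ u → u ≤ t → t ≤ T → ω s u + ω u t ≤ ω s t

/-- `f s t = O(ω(s,t)^(m/p))`, uniformly in `0 ≤ s ≤ t ≤ T`. -/
def IsOrder {E : Type*} [Norm E] (p T : ℝ) (ω : ℝ → ℝ → ℝ) (m : ℕ) (f : ℝ → ℝ → E) : Prop :=
  ∃ C : ℝ, ∀ s t, 0 ≤ s → s ≤ t → t ≤ T → ‖f s t‖ ≤ C * ω s t ^ ((m : ℝ) / p)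

/-- Continuous paths on `[0, T]` whose increments are bounded by a multiple of `ω^(1/p)`. -/
def IsRegularPath {E : Type*} [NormedAddCommGroup E] (p T : ℝ) (ω : ℝ → ℝ → ℝ) (Y : ℝ → E) :
    Prop :=
  ContinuousOn Y (Set.Icc 0 T) ∧ IsOrder p T ω 1 (fun s t => Y t - Y s)

/-! ### Tensors and multilinear maps

`T(V)` is handled degree by degree: a tensor is a family `n ↦ aⁿ ∈ V^{⊗n}`. Elements of the
truncated space `T^N(V)` are such families of which only the degrees `n ≤ N` are looked at.
Linear maps `V^{⊗n} → U` are the same as (continuous, as `V` is finite-dimensional) multilinear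
maps `V [×n]→L[ℝ] U`, so an element of `L(T(V), U)` is a `FormalMultilinearSeries ℝ V U`. -/

section Algebra

variable {V U E F G : Type*}
  [NormedAddCommGroup V] [NormedSpace ℝ V] [NormedAddCommGroup U] [NormedSpace ℝ U]
  [NormedAddCommGroup E] [NormedSpace ℝ E] [NormedAddCommGroup F] [NormedSpace ℝ F]
  [NormedAddCommGroup G] [NormedSpace ℝ G]

/-- Families of tensors `(aⁿ)`, one in each degree. -/
abbrev Tensors (V : Type*) [NormedAddCommGroup V] [NormedSpace ℝ V] : Type _ :=
  (n : ℕ) → ⨂[ℝ]^n V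

/-- The tensor product `V^{⊗i} × V^{⊗j} → V^{⊗(i+j)}`. -/
def tmul {i j : ℕ} (a : ⨂[ℝ]^i V) (b : ⨂[ℝ]^j V) : ⨂[ℝ]^(i + j) V :=
  GradedMonoid.GMul.mul (A := fun n => ⨂[ℝ]^n V) a b

/-- The unit `1 ∈ V^{⊗0}`. -/
def tunit : ⨂[ℝ]^0 V := GradedMonoid.GOne.one (A := fun n => ⨂[ℝ]^n V)

/-- The unit of the tensor algebra. -/
def Tensors.one : Tensors V
  | 0 => tunit
  | _ + 1 => 0

/-- The product of the tensor algebra, `(a ⊗ b)ⁿ = ∑_{i+j=n} aⁱ ⊗ bʲ`. -/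
def Tensors.mul (a b : Tensors V) : Tensors V := fun n =>
  ∑ ij : Finset.HasAntidiagonal.antidiagonal n,
    TensorPower.cast ℝ V (Finset.HasAntidiagonal.mem_antidiagonal.1 ij.2) (tmul (a ij.1.1) (b ij.1.2))

/-- The evaluation `⟨f, a⟩` of a linear map on `V^{⊗n}` at a tensor. -/
def pair {n : ℕ} (f : V [×n]→L[ℝ] U) (a : ⨂[ℝ]^n V) : U :=
  PiTensorProduct.lift f.toMultilinearMap a

/-- For `s ⊆ {1, …, n}` with `k` elements and with complement of size `l`, the multilinear map
`v ↦ B (f (v restricted to s)) (g (v restricted to the complement))`, where the restrictions list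
the variables in increasing order. The sets `s` correspond to the `(k, l)`-shuffles. -/
def shuffleTerm {n k l : ℕ} {s : Finset (Fin n)} (hk : s.card = k) (hl : sᶜ.card = l)
    (B : E →L[ℝ] F →L[ℝ] G) (f : V [×k]→L[ℝ] E) (g : V [×l]→L[ℝ] F) : V [×n]→L[ℝ] G :=
  (ContinuousMultilinearMap.curryFinFinset ℝ V G hk hl).symm
    ((((ContinuousLinearMap.compContinuousMultilinearMapL ℝ (fun _ : Fin l => V) F G).flip g).comp
      B).compContinuousMultilinearMap f)

theorem shuffleTerm_apply {n k l : ℕ} {s : Finset (Fin n)} (hk : s.card = k) (hl : sᶜ.card = l)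
    (B : E →L[ℝ] F →L[ℝ] G) (f : V [×k]→L[ℝ] E) (g : V [×l]→L[ℝ] F) (v : Fin n → V) :
    shuffleTerm hk hl B f g v =
      B (f fun i => v (s.orderEmbOfFin hk i)) (g fun i => v (sᶜ.orderEmbOfFin hl i)) := rfl

theorem card_compl_of_card {i j : ℕ} {s : Finset (Fin (i + j))} (h : s.card = i) :
    sᶜ.card = j := by
  rw [Finset.card_compl, Fintype.card_fin, h]; omega

/-- The ordered finite partition `c` of `{1, …, n}` into nonempty blocks (listed by increasing
last element, i.e. an ordered shuffle) turns a linear map `h` on `T(V)` into the multilinear map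
`(v₁, …, vₙ) ↦ h(v on block 1) ⊗ ⋯ ⊗ h(v on block m)`, where `m` is the number of blocks. -/
def blockTensor {n : ℕ} (c : OrderedFinpartition n) (h : FormalMultilinearSeries ℝ V U) :
    MultilinearMap ℝ (fun _ : Fin n => V) (⨂[ℝ]^c.length U) :=
  MultilinearMap.mk'
    (fun v => PiTensorProduct.tprod ℝ
      (c.applyOrderedFinpartition (fun m => h (c.partSize m)) v))
    (fun v i x y => by
      simp only [OrderedFinpartition.applyOrderedFinpartition_update_right,
        ContinuousMultilinearMap.map_update_add, MultilinearMap.map_update_add])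
    (fun v i a x => by
      simp only [OrderedFinpartition.applyOrderedFinpartition_update_right,
        ContinuousMultilinearMap.map_update_smul, MultilinearMap.map_update_smul])

end Algebra

section Analysis

variable {V W U S : Type*}
  [NormedAddCommGroup V] [NormedSpace ℝ V] [NormedAddCommGroup W] [NormedSpace ℝ W]
  [NormedAddCommGroup U] [NormedSpace ℝ U] [NormedAddCommGroup S] [NormedSpace ℝ S]

/-! ### Rough paths and controlled paths -/

/-- `X` is a `p`-weakly geometric rough path on `[0, T]` with values in `V`, controlled by `ω`.
Only the degrees `n ≤ ⌊p⌋` and the times `0 ≤ s ≤ t ≤ T` matter. The integration by parts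
condition is the identity `X ⊠ X = Δ X` for the shuffle coproduct `Δ`, in every bidegree `(i, j)`
with `i + j ≤ ⌊p⌋`, tested against all pairs of linear functionals. -/
structure IsRoughPath (p T : ℝ) (ω : ℝ → ℝ → ℝ) (X : ℝ → ℝ → Tensors V) : Prop where
  continuousOn : ∀ n ≤ ⌊p⌋₊,
    ContinuousOn (fun q : ℝ × ℝ => X q.1 q.2 n) {q | 0 ≤ q.1 ∧ q.1 ≤ q.2 ∧ q.2 ≤ T}
  degree_zero : ∀ s t, 0 ≤ s → s ≤ t → t ≤ T → X s t 0 = tunit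
  regularity : ∀ n, 1 ≤ n → n ≤ ⌊p⌋₊ → IsOrder p T ω n (fun s t => X s t n)
  multiplicative : ∀ s u t, 0 ≤ s → s ≤ u → u ≤ t → t ≤ T →
    ∀ n ≤ ⌊p⌋₊, (X s u).mul (X u t) n = X s t n
  integration_by_parts : ∀ s t, 0 ≤ s → s ≤ t → t ≤ T → ∀ i j, i + j ≤ ⌊p⌋₊ →
    ∀ (f : V [×i]→L[ℝ] ℝ) (g : V [×j]→L[ℝ] ℝ),
      pair f (X s t i) * pair g (X s t j) =
        ∑ a : {a : Finset (Fin (i + j)) // a.card = i},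
          pair (shuffleTerm a.2 (card_compl_of_card a.2) (ContinuousLinearMap.mul ℝ ℝ) f g)
            (X s t (i + j))

/-- `H` is a `U`-valued `X`-controlled path. Only the levels `n ≤ ⌊p⌋ - 1` of `H` are part of the
controlled path; higher levels of `H` are ignored throughout. -/
structure IsControlled (p T : ℝ) (ω : ℝ → ℝ → ℝ) (X : ℝ → ℝ → Tensors V)
    (H : ℝ → FormalMultilinearSeries ℝ V U) : Prop where
  regular : ∀ n < ⌊p⌋₊, IsRegularPath p T ω (fun t => H t n)
  expansion : ∀ n, n + 2 ≤ ⌊p⌋₊ → ∀ a : ⨂[ℝ]^n V,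
    IsOrder p T ω (⌊p⌋₊ - n) (fun s t =>
      pair (H t n) a - ∑ k ∈ Finset.range (⌊p⌋₊ - n), pair (H s (k + n)) (tmul (X s t k) a))

/-- Equality of controlled paths: equality of all levels `n ≤ ⌊p⌋ - 1` on `[0, T]`. -/
def EqControlled (p T : ℝ) (H K : ℝ → FormalMultilinearSeries ℝ V U) : Prop :=
  ∀ t, 0 ≤ t → t ≤ T → ∀ n < ⌊p⌋₊, H t n = K t n

/-- Equality of rough paths: equality of all degrees `n ≤ ⌊p⌋` on the simplex. -/
def EqRough (p T : ℝ) (X Y : ℝ → ℝ → Tensors V) : Prop :=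
  ∀ s t, 0 ≤ s → s ≤ t → t ≤ T → ∀ n ≤ ⌊p⌋₊, X s t n = Y s t n

/-! ### The rough integral -/

/-- `Ξ_{st} = ⟨H_s, X_{st}^{≥ 1}⟩ = ∑_{n=1}^{⌊p⌋} ⟨H_{n-1;s}, Xⁿ_{st}⟩`, under the identification
`L(V^{⊗(n-1)}, L(V, W)) = L(V^{⊗n}, W)` in which the target copy of `V` is the last slot. -/
def germ (p : ℝ) (X : ℝ → ℝ → Tensors V) (H : ℝ → FormalMultilinearSeries ℝ V (V →L[ℝ] W))
    (s t : ℝ) : W :=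
  ∑ n ∈ Finset.range ⌊p⌋₊,
    pair (ContinuousMultilinearMap.uncurryRight (H s n)) (X s t (n + 1))

/-- `I` is the path `∫₀^· H dX`. -/
structure IsRoughIntegral (p T : ℝ) (ω : ℝ → ℝ → ℝ) (X : ℝ → ℝ → Tensors V)
    (H : ℝ → FormalMultilinearSeries ℝ V (V →L[ℝ] W)) (I : ℝ → W) : Prop where
  zero : I 0 = 0
  regular : IsRegularPath p T ω I
  approx : IsOrder p T ω (⌊p⌋₊ + 1) (fun s t => I t - I s - germ p X H s t)

/-- The rough integral `∫₀^· H dX` (an arbitrary path if there is none). -/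
def roughIntegral (p T : ℝ) (ω : ℝ → ℝ → ℝ) (X : ℝ → ℝ → Tensors V)
    (H : ℝ → FormalMultilinearSeries ℝ V (V →L[ℝ] W)) : ℝ → W :=
  Classical.epsilon (IsRoughIntegral p T ω X H)

/-- The rough integral as a controlled path: its trace is `∫₀^· H dX` and its level `n ≥ 1` is
`H_{n-1}`, seen as a linear map on `V^{⊗n}`. -/
def controlledIntegral (p T : ℝ) (ω : ℝ → ℝ → ℝ) (X : ℝ → ℝ → Tensors V)
    (H : ℝ → FormalMultilinearSeries ℝ V (V →L[ℝ] W)) : ℝ → FormalMultilinearSeries ℝ V W :=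
  fun t => (H t).unshift (roughIntegral p T ω X H t)

/-! ### The lift of a controlled path -/

/-- The almost rough path over a controlled path `H`: degree `0` is `1`, degree `1` is `H_{st}`,
and degree `m ≥ 2` is the sum, over all `n ≤ ⌊p⌋` and all ordered shuffles of `n` letters into `m`
nonempty blocks of sizes `n₁, …, nₘ`, of `H_{n₁;s} ⊗ ⋯ ⊗ H_{nₘ;s}` applied to `Xⁿ_{st}`. -/
def almostLift (p : ℝ) (X : ℝ → ℝ → Tensors V) (H : ℝ → FormalMultilinearSeries ℝ V U)
    (s t : ℝ) : Tensors U
  | 0 => tunit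
  | 1 => PiTensorProduct.tprod ℝ (fun _ => H t 0 0 - H s 0 0)
  | m + 2 => ∑ n ∈ Finset.range (⌊p⌋₊ + 1),
      ∑ c : {c : OrderedFinpartition n // c.length = m + 2},
        TensorPower.cast ℝ U c.2 (PiTensorProduct.lift (blockTensor c.1 (H s)) (X s t n))

/-- The product `A_{τ₀τ₁} ⊗ ⋯ ⊗ A_{τ_{k-1}τ_k}`. -/
def partitionProd (A : ℝ → ℝ → Tensors U) (τ : ℕ → ℝ) : ℕ → Tensors U
  | 0 => Tensors.one
  | k + 1 => (partitionProd A τ k).mul (A (τ k) (τ (k + 1)))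

/-- `Y` is the lift of `H` to a rough path: for all `s ≤ t`, the products of the almost rough path
along partitions of `[s, t]` converge to `Y_{st}` as the mesh tends to zero. -/
def IsLift (p T : ℝ) (X : ℝ → ℝ → Tensors V) (H : ℝ → FormalMultilinearSeries ℝ V U)
    (Y : ℝ → ℝ → Tensors U) : Prop :=
  ∀ s t, 0 ≤ s → s ≤ t → t ≤ T → ∀ n ≤ ⌊p⌋₊, ∀ ε > 0, ∃ δ > 0,
    ∀ (k : ℕ) (τ : ℕ → ℝ), Monotone τ → τ 0 = s → τ k = t → (∀ i < k, τ (i + 1) - τ i < δ) →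
      ‖partitionProd (almostLift p X H) τ k n - Y s t n‖ < ε

/-- The lift of a controlled path to a rough path (arbitrary if the limit does not exist). -/
def roughLift (p T : ℝ) (X : ℝ → ℝ → Tensors V) (H : ℝ → FormalMultilinearSeries ℝ V U) :
    ℝ → ℝ → Tensors U :=
  Classical.epsilon (IsLift p T X H)

/-- The rough integral as a rough path: the lift of the rough integral as a controlled path. -/
def integralLift (p T : ℝ) (ω : ℝ → ℝ → ℝ) (X : ℝ → ℝ → Tensors V)
    (H : ℝ → FormalMultilinearSeries ℝ V (V →L[ℝ] W)) : ℝ → ℝ → Tensors W :=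
  roughLift p T X (controlledIntegral p T ω X H)

/-! ### Operations on controlled paths -/

/-- Change of controlling rough path, `K * H`. Its level `n` is
`∑ K_m ∘ (H_{n₁} ⊠ ⋯ ⊠ H_{nₘ})` over the ordered shuffles of `n` letters into `m` nonempty blocks
of sizes `n₁, …, nₘ` (`m = 1, …, n`), and its level `0` is `K₀`. -/
def changeControl (K : ℝ → FormalMultilinearSeries ℝ U S) (H : ℝ → FormalMultilinearSeries ℝ V U) :
    ℝ → FormalMultilinearSeries ℝ V S :=
  fun t => (K t).taylorComp (H t)

/-- The product `K · H` given by the Leibniz rule: composition of linear maps, spread over the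
variables by the shuffle coproduct. -/
def leibniz (K : ℝ → FormalMultilinearSeries ℝ V (U →L[ℝ] S))
    (H : ℝ → FormalMultilinearSeries ℝ V (W →L[ℝ] U)) :
    ℝ → FormalMultilinearSeries ℝ V (W →L[ℝ] S) :=
  fun t n => ∑ a : Finset (Fin n),
    shuffleTerm (s := a) rfl rfl (ContinuousLinearMap.compL ℝ W U S) (K t a.card) (H t aᶜ.card)

end Analysis

end GeomRough

end

open GeomRough

/-!
In bases of `V`, `W` and `U`, tensors and linear maps on the tensor algebra become functions on
words. Words are listed backwards, so that the derivative `der i f`, the function `w ↦ f (i :: w)`,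
appends the letter `i` at the end. Shuffle products, concatenation products and ordered shuffles
are then defined by recursion on the last letter. The key observation is that the change of control
is a composition, `WordSeries.compose`, that obeys a chain rule for these derivatives,
`WordSeries.der_compose`, and is associative, `WordSeries.compose_compose`.

A controlled path is a path of functions `f_t` on words that agree, up to the prescribed orders,
with the translations of `f_s` by `X_st` (`WordSeries.leftTranslate`). Because `X_st` is a character
of the shuffle algebra in degrees up to `⌊p⌋`, translation by it is compatible with shuffle products
and with composition, up to terms of high order (`IsCharacter.leftTranslate_shuffle_sub`,
`IsCharacter.leftTranslate_compose_sub`). These two statements are algebra, over a commutative ring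
with a filtration, and are proved by induction on the order: a function is of order `m + 1` if its
value at the empty word is and if its derivatives are of order `m`. Applied to the ring of functions
of two or three times, filtered by the powers of `ω(s,t)^(1/p)`, they show that products and changes
of control are controlled paths, that the germ of the rough integral is almost additive, and that
the almost rough path over a controlled path is almost multiplicative and almost a character.

The additive sewing lemma `exists_path_of_almost_additive` then gives the rough integral, and its
multiplicative version `exists_leftDiv_of_almost_multiplicative`, obtained from the additive one
degree by degree, gives a functional close to the almost rough path. That functional is an exact
character, `IsMultiplicative.isCharacter`, since in the first degree where a defect could occur the
defect is additive and of order `⌊p⌋ + 1 > p`, hence zero (`eq_zero_of_additive`). A telescoping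
argument, `exists_mesh_wordProd`, shows that the products over partitions converge to it. So the
functional is the lift, and it is a rough path.

For the associativity of the controlled paths, the integrands are the derivatives of the integrals.
By the chain rule both sides have the same derivatives, which settles the positive levels
(`compose_pathCoords_cons`). The difference of the two traces vanishes at time zero and is of order
`⌊p⌋ + 1 > p`, hence zero (`compose_pathCoords`). The two rough paths agree up to order `⌊p⌋ + 1`
with the pushforwards of `X` by the two sides of the first identity, by associativity of the
composition (`isOrder_pushforward_sub_pushforward`). Since both are multiplicative, they are equal,
`IsMultiplicative.eq_of_isOrder`.
-/


namespace WordSeries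

variable {ι κ R : Type*}

/-! ### Functions on words: shuffle products, concatenation products, block sums -/

/-- The derivative of a function on words by the letter `i`, which is appended to the *end* of the
word. Words are listed backwards, the last letter first. -/
def der (i : ι) (f : List ι → R) : List ι → R := fun w => f (i :: w)

@[simp] theorem der_apply (i : ι) (f : List ι → R) (w : List ι) : der i f w = f (i :: w) := rfl

section Basic

variable [CommRing R]

@[simp] theorem der_add (i : ι) (f g : List ι → R) : der i (f + g) = der i f + der i g := rfl

@[simp] theorem der_sub (i : ι) (f g : List ι → R) : der i (f - g) = der i f - der i g := rfl

@[simp] theorem der_zero (i : ι) : der i (0 : List ι → R) = 0 := rfl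

/-- The shuffle product: `(f ⧢ g)(w)` is the sum of `f(w_S) g(w_{Sᶜ})` over the sets `S` of
positions in the word `w`. It is determined by its value at the empty word and by the Leibniz rule
for the derivatives. -/
def shuffle : (List ι → R) → (List ι → R) → List ι → R
  | f, g, [] => f [] * g []
  | f, g, i :: w => shuffle (der i f) g w + shuffle f (der i g) w

@[simp] theorem shuffle_nil (f g : List ι → R) : shuffle f g [] = f [] * g [] := rfl

theorem shuffle_cons (f g : List ι → R) (i : ι) (w : List ι) :
    shuffle f g (i :: w) = shuffle (der i f) g w + shuffle f (der i g) w := rfl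

theorem der_shuffle (f g : List ι → R) (i : ι) :
    der i (shuffle f g) = shuffle (der i f) g + shuffle f (der i g) := rfl

theorem shuffle_comm (f g : List ι → R) : shuffle f g = shuffle g f := by
  funext w
  induction w generalizing f g with
  | nil => exact mul_comm _ _
  | cons i w ih => rw [shuffle_cons, shuffle_cons, ih, ih f, add_comm]

theorem shuffle_add_left (f f' g : List ι → R) :
    shuffle (f + f') g = shuffle f g + shuffle f' g := by
  funext w
  induction w generalizing f f' g with
  | nil => simp [add_mul]
  | cons i w ih =>
    simp only [shuffle_cons, der_add, ih, Pi.add_apply]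
    ring

theorem shuffle_smul_left (c : R) (f g : List ι → R) :
    shuffle (c • f) g = c • shuffle f g := by
  funext w
  induction w generalizing f g with
  | nil => simp [mul_assoc]
  | cons i w ih =>
    have h : der i (c • f) = c • der i f := rfl
    simp only [shuffle_cons, h, ih, Pi.smul_apply, smul_add]

@[simp] theorem shuffle_zero_left (g : List ι → R) : shuffle 0 g = 0 := by
  simpa using shuffle_smul_left (0 : R) 0 g

@[simp] theorem shuffle_zero_right (g : List ι → R) : shuffle g 0 = 0 := by
  rw [shuffle_comm, shuffle_zero_left]

theorem shuffle_sub_left (f f' g : List ι → R) :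
    shuffle (f - f') g = shuffle f g - shuffle f' g := by
  have h := shuffle_add_left (f - f') f' g
  rw [sub_add_cancel] at h
  rw [h, add_sub_cancel_right]

theorem shuffle_add_right (f g g' : List ι → R) :
    shuffle f (g + g') = shuffle f g + shuffle f g' := by
  rw [shuffle_comm, shuffle_add_left, shuffle_comm g, shuffle_comm g']

theorem shuffle_sub_right (f g g' : List ι → R) :
    shuffle f (g - g') = shuffle f g - shuffle f g' := by
  rw [shuffle_comm, shuffle_sub_left, shuffle_comm g, shuffle_comm g']

theorem shuffle_sum_left {α : Type*} (s : Finset α) (f : α → List ι → R) (g : List ι → R) :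
    shuffle (∑ a ∈ s, f a) g = ∑ a ∈ s, shuffle (f a) g := by
  classical
  induction s using Finset.induction_on with
  | empty => simp
  | insert a s ha ih => rw [Finset.sum_insert ha, Finset.sum_insert ha, shuffle_add_left, ih]

theorem shuffle_sum_right {α : Type*} (s : Finset α) (f : α → List ι → R) (g : List ι → R) :
    shuffle g (∑ a ∈ s, f a) = ∑ a ∈ s, shuffle g (f a) := by
  rw [shuffle_comm, shuffle_sum_left]
  exact Finset.sum_congr rfl fun a _ => shuffle_comm _ _

theorem shuffle_assoc (f g h : List ι → R) :
    shuffle (shuffle f g) h = shuffle f (shuffle g h) := by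
  funext w
  induction w generalizing f g h with
  | nil => simp [mul_assoc]
  | cons i w ih =>
    simp only [shuffle_cons, der_shuffle, shuffle_add_left, shuffle_add_right, Pi.add_apply, ih]
    ring

theorem shuffle_right_comm (f g h : List ι → R) :
    shuffle (shuffle f g) h = shuffle (shuffle f h) g := by
  rw [shuffle_assoc, shuffle_comm g, shuffle_assoc]

/-- The value of a shuffle product at `w` involves only words of at most the length of `w`. -/
theorem shuffle_congr {f f' g g' : List ι → R} {w : List ι}
    (hf : ∀ v, v.length ≤ w.length → f v = f' v) (hg : ∀ v, v.length ≤ w.length → g v = g' v) :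
    shuffle f g w = shuffle f' g' w := by
  induction w generalizing f f' g g' with
  | nil => simp [hf [] le_rfl, hg [] le_rfl]
  | cons i w ih =>
    rw [shuffle_cons, shuffle_cons]
    congr 1
    · exact ih (fun v hv => hf _ (by simpa using hv)) (fun v hv => hg _ (hv.trans (by simp)))
    · exact ih (fun v hv => hf _ (hv.trans (by simp))) (fun v hv => hg _ (by simpa using hv))

/-- The unit of the shuffle product and of the concatenation product: the indicator of the empty
word. -/
def unit : List ι → R
  | [] => 1
  | _ :: _ => 0

@[simp] theorem unit_nil : (unit : List ι → R) [] = 1 := rfl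

@[simp] theorem unit_cons (i : ι) (w : List ι) : (unit : List ι → R) (i :: w) = 0 := rfl

@[simp] theorem der_unit (i : ι) : der i (unit : List ι → R) = 0 := rfl

@[simp] theorem unit_shuffle (f : List ι → R) : shuffle unit f = f := by
  funext w
  induction w generalizing f with
  | nil => simp
  | cons i w ih => simp [shuffle_cons, ih]

/-- The half-shuffle product: the part of the shuffle product in which the last letter of the word
goes to the right factor. -/
def halfShuffle (f g : List ι → R) : List ι → R
  | [] => 0
  | i :: w => shuffle f (der i g) w

@[simp] theorem halfShuffle_nil (f g : List ι → R) : halfShuffle f g [] = 0 := rfl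

@[simp] theorem halfShuffle_cons (f g : List ι → R) (i : ι) (w : List ι) :
    halfShuffle f g (i :: w) = shuffle f (der i g) w := rfl

/-- For a list `[gₘ, …, g₁]`, the sum over all ordered shuffles of a word into `m` nonempty blocks
`B₁, …, Bₘ` of the products `g₁(w_{B₁}) ⋯ gₘ(w_{Bₘ})`. The block `Bₘ` contains the last letter,
whence the recursion by the half-shuffle product. -/
def blockSum : List (List ι → R) → List ι → R
  | [] => unit
  | g :: gs => halfShuffle (blockSum gs) g

@[simp] theorem blockSum_nil : blockSum ([] : List (List ι → R)) = unit := rfl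

@[simp] theorem blockSum_cons (g : List ι → R) (gs : List (List ι → R)) :
    blockSum (g :: gs) = halfShuffle (blockSum gs) g := rfl

/-- The product of the tensor algebra, in coordinates: `(x ⊗ y)(w)` is the sum of `x(u) y(v)` over
the factorizations of `w` into an initial word `u` and a final word `v`. -/
def conv : (List ι → R) → (List ι → R) → List ι → R
  | x, y, [] => x [] * y []
  | x, y, i :: w => x (i :: w) * y [] + conv x (der i y) w

@[simp] theorem conv_nil (x y : List ι → R) : conv x y [] = x [] * y [] := rfl

theorem conv_cons (x y : List ι → R) (i : ι) (w : List ι) :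
    conv x y (i :: w) = x (i :: w) * y [] + conv x (der i y) w := rfl

theorem der_conv (x y : List ι → R) (i : ι) :
    der i (conv x y) = y [] • der i x + conv x (der i y) := by
  funext w
  simp [conv_cons, mul_comm]

theorem conv_add_left (x x' y : List ι → R) : conv (x + x') y = conv x y + conv x' y := by
  funext w
  induction w generalizing y with
  | nil => simp [add_mul]
  | cons i w ih => simp only [conv_cons, ih, Pi.add_apply]; ring

theorem conv_add_right (x y y' : List ι → R) : conv x (y + y') = conv x y + conv x y' := by
  funext w
  induction w generalizing y y' with
  | nil => simp [mul_add]
  | cons i w ih => simp only [conv_cons, ih, Pi.add_apply, der_add]; ring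

theorem conv_smul_left (c : R) (x y : List ι → R) : conv (c • x) y = c • conv x y := by
  funext w
  induction w generalizing y with
  | nil => simp [mul_assoc]
  | cons i w ih => simp only [conv_cons, ih, Pi.smul_apply, smul_eq_mul]; ring

theorem conv_smul_right (c : R) (x y : List ι → R) : conv x (c • y) = c • conv x y := by
  funext w
  induction w generalizing y with
  | nil => simp [mul_left_comm]
  | cons i w ih =>
    have h : der i (c • y) = c • der i y := rfl
    simp only [conv_cons, h, ih, Pi.smul_apply, smul_eq_mul]; ring

@[simp] theorem conv_zero_left (y : List ι → R) : conv 0 y = 0 := by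
  simpa using conv_smul_left (0 : R) 0 y

@[simp] theorem conv_zero_right (y : List ι → R) : conv y 0 = 0 := by
  simpa using conv_smul_right (0 : R) y 0

theorem conv_sub_left (x x' y : List ι → R) : conv (x - x') y = conv x y - conv x' y := by
  have h := conv_add_left (x - x') x' y
  rw [sub_add_cancel] at h
  rw [h, add_sub_cancel_right]

theorem conv_sub_right (x y y' : List ι → R) : conv x (y - y') = conv x y - conv x y' := by
  have h := conv_add_right x (y - y') y'
  rw [sub_add_cancel] at h
  rw [h, add_sub_cancel_right]

theorem conv_sum_left {α : Type*} (s : Finset α) (x : α → List ι → R) (y : List ι → R) :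
    conv (∑ a ∈ s, x a) y = ∑ a ∈ s, conv (x a) y := by
  classical
  induction s using Finset.induction_on with
  | empty => simp
  | insert a s ha ih => rw [Finset.sum_insert ha, Finset.sum_insert ha, conv_add_left, ih]

theorem conv_assoc (x y z : List ι → R) : conv (conv x y) z = conv x (conv y z) := by
  funext w
  induction w generalizing z with
  | nil => simp [mul_assoc]
  | cons i w ih =>
    rw [conv_cons, conv_cons, conv_cons, ih, der_conv, conv_add_right, conv_smul_right]
    simp only [Pi.add_apply, Pi.smul_apply, smul_eq_mul, conv_nil]
    ring

@[simp] theorem conv_unit (x : List ι → R) : conv x unit = x := by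
  funext w
  cases w <;> simp [conv_cons]

/-- The value of a concatenation product at `w` involves only words of at most the length
of `w`. -/
theorem conv_congr {x x' y y' : List ι → R} {w : List ι}
    (hx : ∀ v, v.length ≤ w.length → x v = x' v) (hy : ∀ v, v.length ≤ w.length → y v = y' v) :
    conv x y w = conv x' y' w := by
  induction w generalizing y y' with
  | nil => simp [hx [] le_rfl, hy [] le_rfl]
  | cons i w ih =>
    rw [conv_cons, conv_cons, hx _ le_rfl, hy [] (by simp)]
    congr 1
    exact ih (fun v hv => hx _ (hv.trans (by simp))) (fun v hv => hy _ (by simpa using hv))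

/-- If both factors are `1` at the empty word, the two extreme factorizations of `w` contribute
`x(w) + y(w)`, and the remaining ones involve only words shorter than `w`. -/
theorem conv_cons_congr {x x' y y' : List ι → R} {i : ι} {w : List ι}
    (hx : ∀ v, v.length ≤ w.length → x v = x' v) (hy : ∀ v, v.length ≤ w.length → y v = y' v)
    (hx0 : x [] = 1) (hy0 : y [] = 1) :
    conv x y (i :: w) - x (i :: w) - y (i :: w) =
      conv x' y' (i :: w) - x' (i :: w) - y' (i :: w) := by
  have key : ∀ (u : List ι) (a b : List ι → R), u.length ≤ w.length →
      (∀ v, v.length < u.length → a v = b v) → conv x a u - a u = conv x' b u - b u := by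
    intro u
    induction u with
    | nil => intro a b _ _; simp [hx0, ← hx [] (by simp)]
    | cons j u ih =>
      intro a b hu h
      have := ih (der j a) (der j b) ((by simp : u.length ≤ (j :: u).length).trans hu)
        (fun v hv => h _ (by simpa using hv))
      simp only [der_apply] at this
      rw [conv_cons, conv_cons, h [] (by simp), hx _ hu]
      linear_combination this
  have h := key w (der i y) (der i y') le_rfl (fun v hv => hy _ (by simpa using hv))
  have hy0' : y' [] = 1 := by rw [← hy [] (by simp), hy0]
  simp only [der_apply] at h
  rw [conv_cons, conv_cons, hy0, hy0']
  linear_combination h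

/-- The left quotient `x⁻¹ ⊗ z` in the tensor algebra, for `x` with constant term `1`. -/
def leftDiv : (List ι → R) → (List ι → R) → List ι → R
  | _, z, [] => z []
  | x, z, i :: w => leftDiv x (der i z - z [] • der i x) w

@[simp] theorem leftDiv_nil (x z : List ι → R) : leftDiv x z [] = z [] := rfl

theorem leftDiv_cons (x z : List ι → R) (i : ι) (w : List ι) :
    leftDiv x z (i :: w) = leftDiv x (der i z - z [] • der i x) w := rfl

theorem conv_leftDiv {x : List ι → R} (hx : x [] = 1) (z : List ι → R) :
    conv x (leftDiv x z) = z := by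
  funext w
  induction w generalizing z with
  | nil => simp [hx]
  | cons i w ih =>
    have h : der i (leftDiv x z) = leftDiv x (der i z - z [] • der i x) := rfl
    rw [conv_cons, h, ih]
    simp [mul_comm]

theorem conv_left_cancel {x y y' : List ι → R} (hx : x [] = 1) (h : conv x y = conv x y') :
    y = y' := by
  funext w
  induction w generalizing y y' with
  | nil => simpa [hx] using congrFun h []
  | cons i w ih =>
    have h0 : y [] = y' [] := by simpa [hx] using congrFun h []
    refine ih (y := der i y) (y' := der i y') ?_
    funext v
    have := congrFun h (i :: v)
    simpa [conv_cons, h0] using this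

theorem leftDiv_conv {x y z : List ι → R} (hx : x [] = 1) (hy : y [] = 1) :
    conv (leftDiv x y) (leftDiv y z) = leftDiv x z := by
  apply conv_left_cancel hx
  rw [← conv_assoc, conv_leftDiv hx, conv_leftDiv hy, conv_leftDiv hx]

/-- The function `f`, set to zero on the words of length at least `m`. -/
def truncate (m : ℕ) (f : List ι → R) : List ι → R := fun w => if w.length < m then f w else 0

theorem der_truncate (m : ℕ) (f : List ι → R) (i : ι) :
    der i (truncate (m + 1) f) = truncate m (der i f) := by
  funext w
  simp [truncate]

/-- The part of degree `n` of a function on words. -/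
def component (n : ℕ) (f : List ι → R) : List ι → R := fun w => if w.length = n then f w else 0

end Basic

/-! ### Pairings, translations and pushforwards -/

section Pairing

variable [CommRing R] [Fintype ι]

/-- The pairing `∑ f(w) g(w)` over the words of length `n`. -/
def gradedPairing : ℕ → (List ι → R) → (List ι → R) → R
  | 0, f, g => f [] * g []
  | n + 1, f, g => ∑ i, gradedPairing n (der i f) (der i g)

@[simp] theorem gradedPairing_zero (f g : List ι → R) : gradedPairing 0 f g = f [] * g [] := rfl

theorem gradedPairing_succ (n : ℕ) (f g : List ι → R) :
    gradedPairing (n + 1) f g = ∑ i, gradedPairing n (der i f) (der i g) := rfl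

theorem gradedPairing_congr {n : ℕ} {f f' g g' : List ι → R}
    (hf : ∀ w, w.length = n → f w = f' w) (hg : ∀ w, w.length = n → g w = g' w) :
    gradedPairing n f g = gradedPairing n f' g' := by
  induction n generalizing f f' g g' with
  | zero => simp [hf [] rfl, hg [] rfl]
  | succ n ih =>
    exact Finset.sum_congr rfl fun i _ => ih (fun w hw => hf _ (by simpa using hw))
      (fun w hw => hg _ (by simpa using hw))

theorem gradedPairing_comm (n : ℕ) (f g : List ι → R) :
    gradedPairing n f g = gradedPairing n g f := by
  induction n generalizing f g with
  | zero => exact mul_comm _ _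
  | succ n ih => exact Finset.sum_congr rfl fun i _ => ih _ _

theorem gradedPairing_add_right (n : ℕ) (f g g' : List ι → R) :
    gradedPairing n f (g + g') = gradedPairing n f g + gradedPairing n f g' := by
  induction n generalizing f g g' with
  | zero => simp [mul_add]
  | succ n ih => simp [gradedPairing_succ, ih, Finset.sum_add_distrib]

theorem gradedPairing_smul_right (n : ℕ) (c : R) (f g : List ι → R) :
    gradedPairing n f (c • g) = c * gradedPairing n f g := by
  induction n generalizing f g with
  | zero => simp [mul_left_comm]
  | succ n ih =>
    have h : ∀ i, der i (c • g) = c • der i g := fun i => rfl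
    simp [gradedPairing_succ, h, ih, Finset.mul_sum]

theorem gradedPairing_eq_zero {n : ℕ} {f g : List ι → R} (hg : ∀ w, w.length = n → g w = 0) :
    gradedPairing n f g = 0 := by
  rw [gradedPairing_congr (g' := (0 : R) • g) (fun _ _ => rfl) (fun w hw => by simp [hg w hw]),
    gradedPairing_smul_right, zero_mul]

/-- The pairing `∑ f(w) g(w)` over the words of length at most `N`. -/
def pairing (N : ℕ) (f g : List ι → R) : R := ∑ n ∈ Finset.range (N + 1), gradedPairing n f g

theorem pairing_zero (f g : List ι → R) : pairing 0 f g = f [] * g [] := by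
  simp [pairing]

theorem pairing_succ (N : ℕ) (f g : List ι → R) :
    pairing (N + 1) f g = f [] * g [] + ∑ i, pairing N (der i f) (der i g) := by
  rw [pairing, Finset.sum_range_succ']
  simp only [gradedPairing_succ, pairing, gradedPairing_zero]
  rw [Finset.sum_comm, add_comm]

theorem pairing_congr {N : ℕ} {f f' g g' : List ι → R}
    (hf : ∀ w, w.length ≤ N → f w = f' w) (hg : ∀ w, w.length ≤ N → g w = g' w) :
    pairing N f g = pairing N f' g' := by
  refine Finset.sum_congr rfl fun n hn => ?_
  have : n ≤ N := by simpa [Nat.lt_succ_iff] using hn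
  exact gradedPairing_congr (fun w hw => hf w (hw.trans_le this))
    (fun w hw => hg w (hw.trans_le this))

theorem pairing_comm (N : ℕ) (f g : List ι → R) : pairing N f g = pairing N g f :=
  Finset.sum_congr rfl fun n _ => gradedPairing_comm n f g

theorem pairing_add_right (N : ℕ) (f g g' : List ι → R) :
    pairing N f (g + g') = pairing N f g + pairing N f g' := by
  simp [pairing, gradedPairing_add_right, Finset.sum_add_distrib]

theorem pairing_smul_right (N : ℕ) (c : R) (f g : List ι → R) :
    pairing N f (c • g) = c * pairing N f g := by
  simp [pairing, gradedPairing_smul_right, Finset.mul_sum]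

@[simp] theorem pairing_zero_right (N : ℕ) (f : List ι → R) : pairing N f 0 = 0 := by
  simpa using pairing_smul_right N (0 : R) f 0

@[simp] theorem pairing_zero_left (N : ℕ) (f : List ι → R) : pairing N 0 f = 0 := by
  rw [pairing_comm, pairing_zero_right]

theorem pairing_sub_right (N : ℕ) (f g g' : List ι → R) :
    pairing N f (g - g') = pairing N f g - pairing N f g' := by
  have h := pairing_add_right N f (g - g') g'
  rw [sub_add_cancel] at h
  rw [h, add_sub_cancel_right]

theorem pairing_sub_left (N : ℕ) (f f' g : List ι → R) :
    pairing N (f - f') g = pairing N f g - pairing N f' g := by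
  rw [pairing_comm, pairing_sub_right, pairing_comm N g, pairing_comm N g]

theorem pairing_smul_left (N : ℕ) (c : R) (f g : List ι → R) :
    pairing N (c • f) g = c * pairing N f g := by
  rw [pairing_comm, pairing_smul_right, pairing_comm]

theorem pairing_add_left (N : ℕ) (f f' g : List ι → R) :
    pairing N (f + f') g = pairing N f g + pairing N f' g := by
  rw [pairing_comm, pairing_add_right, pairing_comm N g, pairing_comm N g]

theorem pairing_sum_right {α : Type*} (N : ℕ) (s : Finset α) (f : List ι → R)
    (g : α → List ι → R) :
    pairing N f (∑ a ∈ s, g a) = ∑ a ∈ s, pairing N f (g a) := by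
  classical
  induction s using Finset.induction_on with
  | empty => simp
  | insert a s ha ih => rw [Finset.sum_insert ha, Finset.sum_insert ha, pairing_add_right, ih]

theorem pairing_unit_right (N : ℕ) (f : List ι → R) : pairing N f unit = f [] := by
  cases N with
  | zero => simp [pairing_zero]
  | succ N => simp [pairing_succ]

/-- Words on which the right argument vanishes may be added to the range of the pairing. -/
theorem pairing_eq_of_le {N M : ℕ} (h : N ≤ M) {f g : List ι → R}
    (hg : ∀ w, N < w.length → g w = 0) : pairing M f g = pairing N f g := by
  rw [pairing, pairing]
  symm
  apply Finset.sum_subset (by simpa using h)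
  intro n _ hn
  apply gradedPairing_eq_zero
  intro w hw
  apply hg
  simp only [Finset.mem_range, not_lt] at hn
  omega

theorem gradedPairing_shuffle_comm (n : ℕ) (G : List ι → R) (F : List ι → List κ → R)
    (B : List κ → R) (v : List κ) :
    gradedPairing n G (fun w => shuffle (F w) B v) =
      shuffle (fun v' => gradedPairing n G (fun w => F w v')) B v := by
  induction n generalizing G F with
  | zero =>
    have := congrFun (shuffle_smul_left (G []) (F []) B) v
    exact this.symm
  | succ n ih =>
    have h : ∀ i, der i (fun w => shuffle (F w) B v) = fun w => shuffle (F (i :: w)) B v :=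
      fun i => rfl
    simp only [gradedPairing_succ, h, ih]
    have := congrFun (shuffle_sum_left Finset.univ
      (fun (i : ι) v' => gradedPairing n (der i G) (fun w => F (i :: w) v')) B) v
    rw [Finset.sum_apply] at this
    rw [← this]
    congr 1
    funext v'
    simp only [Finset.sum_apply]
    rfl

/-- The shuffle product with a fixed function is linear, hence commutes with pairings. -/
theorem pairing_shuffle_comm (N : ℕ) (G : List ι → R) (F : List ι → List κ → R)
    (B : List κ → R) (v : List κ) :
    pairing N G (fun w => shuffle (F w) B v) =
      shuffle (fun v' => pairing N G (fun w => F w v')) B v := by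
  simp only [pairing, gradedPairing_shuffle_comm]
  have := congrFun (shuffle_sum_left (Finset.range (N + 1))
    (fun n v' => gradedPairing n G (fun w => F w v')) B) v
  rw [Finset.sum_apply] at this
  rw [← this]
  congr 1
  funext v'
  simp only [Finset.sum_apply]

/-- `(θ_x f)(w) = ∑ x(u) f(u w)`, the sum being over the words `u` of length at most `N`, put in
front of `w`. A controlled path `f` satisfies `f_t ≈ θ_{X_{st}} f_s`. -/
def leftTranslate (N : ℕ) (x f : List ι → R) : List ι → R :=
  fun w => pairing N x (fun u => f (w ++ u))

@[simp] theorem leftTranslate_nil (N : ℕ) (x f : List ι → R) :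
    leftTranslate N x f [] = pairing N x f := rfl

theorem der_leftTranslate (N : ℕ) (x f : List ι → R) (i : ι) :
    der i (leftTranslate N x f) = leftTranslate N x (der i f) := rfl

theorem leftTranslate_add (N : ℕ) (x f g : List ι → R) :
    leftTranslate N x (f + g) = leftTranslate N x f + leftTranslate N x g := by
  funext w
  exact pairing_add_right N x _ _

theorem leftTranslate_sub_left (N : ℕ) (x y f : List ι → R) :
    leftTranslate N (x - y) f = leftTranslate N x f - leftTranslate N y f := by
  funext w
  exact pairing_sub_left N x y _

theorem leftTranslate_sum {α : Type*} (N : ℕ) (s : Finset α) (x : List ι → R)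
    (g : α → List ι → R) :
    leftTranslate N x (∑ a ∈ s, g a) = ∑ a ∈ s, leftTranslate N x (g a) := by
  funext w
  rw [Finset.sum_apply]
  simp only [leftTranslate, ← pairing_sum_right]
  congr 1
  funext u
  simp only [Finset.sum_apply]

/-- The pairing of a concatenation product, with the degrees truncated jointly. -/
theorem pairing_conv (N : ℕ) (x y f : List ι → R) :
    pairing N (conv x y) f =
      pairing N y (fun w => pairing (N - w.length) x (fun u => f (w ++ u))) := by
  induction N generalizing x y f with
  | zero => simp [pairing_zero]; ring
  | succ N ih =>
    rw [pairing_succ, pairing_succ N y]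
    simp only [der_conv, pairing_add_left, pairing_smul_left, ih, conv_nil, List.length_nil,
      Nat.sub_zero, List.nil_append, pairing_succ N x f, Finset.sum_add_distrib,
      ← Finset.mul_sum]
    have h : ∀ i, (der i fun w => pairing (N + 1 - w.length) x fun u => f (w ++ u)) =
        fun w => pairing (N - w.length) x fun u => der i f (w ++ u) := by
      intro i
      funext w
      simp [der]
    simp only [h]
    ring

/-- The word-indexed coordinates of `h_* x`: the value at `w = j₁ ⋯ jₘ` is the pairing of `x` with
the sum over the ordered shuffles into blocks of `h_{j₁} ⊗ ⋯ ⊗ h_{jₘ}`. -/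
def pushforward (N : ℕ) (h : κ → List ι → R) (x : List ι → R) : List κ → R :=
  fun w => pairing N x (blockSum (w.map h))

@[simp] theorem pushforward_nil (N : ℕ) (h : κ → List ι → R) (x : List ι → R) :
    pushforward N h x [] = x [] := pairing_unit_right N x

end Pairing

/-- The shuffle product is graded. -/
theorem shuffle_eq_zero_of_length [CommRing R] {f g : List ι → R} {a b : ℕ}
    (hf : ∀ w, w.length < a → f w = 0) (hg : ∀ w, w.length < b → g w = 0) :
    ∀ w, w.length < a + b → shuffle f g w = 0 := by
  intro w
  induction w generalizing f g a b with
  | nil =>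
    intro h
    rcases Nat.eq_zero_or_pos a with rfl | ha
    · simp [hg [] (by simpa using h)]
    · simp [hf [] (by simpa using ha)]
  | cons i w ih =>
    intro h
    simp only [List.length_cons] at h
    have h1 : shuffle (der i f) g w = 0 := ih (a := a - 1) (b := b)
      (fun v hv => hf _ (by simp only [List.length_cons]; omega)) hg (by omega)
    have h2 : shuffle f (der i g) w = 0 := ih (a := a) (b := b - 1) hf
      (fun v hv => hg _ (by simp only [List.length_cons]; omega)) (by omega)
    rw [shuffle_cons, h1, h2, add_zero]

/-- A word has no ordered shuffles into more nonempty blocks than it has letters. -/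
theorem blockSum_eq_zero [CommRing R] (gs : List (List ι → R)) :
    ∀ w, w.length < gs.length → blockSum gs w = 0 := by
  induction gs with
  | nil => simp
  | cons g gs ih =>
    intro w hw
    cases w with
    | nil => rfl
    | cons i w =>
      exact shuffle_eq_zero_of_length (a := gs.length) (b := 0) ih (by simp) w
        (by simpa using hw)

/-! ### The composition -/

section Composition

variable [CommRing R] [Fintype κ]

/-- The composition `G * h` of a function `G` on words in the alphabet `κ` with a `κ`-indexed
family `h` of functions on words: the sum over all words `j₁ ⋯ jₘ` of `G(j₁ ⋯ jₘ)` times the sum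
over the ordered shuffles into `m` blocks of `h_{j₁} ⊗ ⋯ ⊗ h_{jₘ}`. Only `m ≤ |v|` contribute to
the value at `v`. -/
def compose (G : List κ → R) (h : κ → List ι → R) : List ι → R :=
  fun v => pairing v.length G (fun w => blockSum (w.map h) v)

@[simp] theorem compose_nil (G : List κ → R) (h : κ → List ι → R) : compose G h [] = G [] := by
  simp [compose, pairing_zero]

theorem compose_eq_pairing (G : List κ → R) (h : κ → List ι → R) {v : List ι} {M : ℕ}
    (hM : v.length ≤ M) : compose G h v = pairing M G (fun w => blockSum (w.map h) v) :=
  (pairing_eq_of_le hM fun w hw => blockSum_eq_zero _ _ (by simpa using hw)).symm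

theorem compose_cons (G : List κ → R) (h : κ → List ι → R) (i : ι) (v : List ι) :
    compose G h (i :: v) = ∑ j, shuffle (compose (der j G) h) (der i (h j)) v := by
  rw [compose, List.length_cons, pairing_succ]
  simp only [List.map_nil, blockSum_nil, unit_cons, mul_zero, zero_add]
  refine Finset.sum_congr rfl fun j _ => ?_
  have h1 : der j (fun w => blockSum (w.map h) (i :: v)) =
      fun w => shuffle (blockSum (w.map h)) (der i (h j)) v := rfl
  rw [h1, pairing_shuffle_comm]
  exact shuffle_congr (fun v' hv' => (compose_eq_pairing _ _ hv').symm) (fun _ _ => rfl)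

/-- The chain rule for the composition. -/
theorem der_compose (G : List κ → R) (h : κ → List ι → R) (i : ι) :
    der i (compose G h) = ∑ j, shuffle (compose (der j G) h) (der i (h j)) := by
  funext v
  rw [Finset.sum_apply]
  exact compose_cons G h i v

theorem compose_add (F G : List κ → R) (h : κ → List ι → R) :
    compose (F + G) h = compose F h + compose G h := by
  funext v
  exact pairing_add_left _ _ _ _

theorem compose_sub (F G : List κ → R) (h : κ → List ι → R) :
    compose (F - G) h = compose F h - compose G h := by
  funext v
  exact pairing_sub_left _ _ _ _

theorem compose_sum {α : Type*} (s : Finset α) (F : α → List κ → R) (h : κ → List ι → R) :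
    compose (∑ a ∈ s, F a) h = ∑ a ∈ s, compose (F a) h := by
  funext v
  rw [compose, pairing_comm, pairing_sum_right, Finset.sum_apply]
  exact Finset.sum_congr rfl fun a _ => pairing_comm _ _ _

/-- The adjoint of the composition with `h` is the pushforward by `h`. -/
theorem pairing_compose [Fintype ι] (N : ℕ) (x : List ι → R) (G : List κ → R)
    (h : κ → List ι → R) :
    pairing N x (compose G h) = pairing N (pushforward N h x) G := by
  have swap : ∀ (n : ℕ) (y : List κ → R) (F : List κ → List ι → R) (M : ℕ),
      gradedPairing n y (fun w => pairing M x (F w)) =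
        pairing M x (fun v => gradedPairing n y (fun w => F w v)) := by
    intro n
    induction n with
    | zero =>
      intro y F M
      exact (pairing_smul_right M (y []) x (F [])).symm
    | succ n ih =>
      intro y F M
      have h1 : ∀ i, der i (fun w => pairing M x (F w)) = fun w => pairing M x (F (i :: w)) :=
        fun i => rfl
      simp only [gradedPairing_succ, h1, ih]
      rw [← pairing_sum_right]
      congr 1
      funext v
      rw [Finset.sum_apply]
      rfl
  have hp : pushforward N h x = fun w => pairing N x (blockSum (w.map h)) := rfl
  rw [pairing_comm N _ G, hp]
  conv_rhs => rw [pairing]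
  simp only [swap]
  rw [← pairing_sum_right]
  refine pairing_congr (fun _ _ => rfl) fun v hv => ?_
  rw [compose_eq_pairing G h hv, Finset.sum_apply]
  rfl

/-- The indicator of a word. -/
def single [DecidableEq κ] (w : List κ) : List κ → R := fun v => if v = w then 1 else 0

theorem pairing_single [DecidableEq κ] {N : ℕ} (x : List κ → R) {w : List κ} (hw : w.length ≤ N) :
    pairing N x (single w) = x w := by
  induction N generalizing x w with
  | zero =>
    obtain rfl : w = [] := by simpa using hw
    simp [pairing_zero, single]
  | succ N ih =>
    rw [pairing_succ]
    cases w with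
    | nil =>
      have : ∀ i, der i (single ([] : List κ)) = (0 : List κ → R) := by
        intro i; funext v; simp [single]
      simp [this, single]
    | cons j w =>
      have h1 : ∀ i, der i (single (j :: w) : List κ → R) = if i = j then single w else 0 := by
        intro i
        funext v
        by_cases hij : i = j <;> simp [single, hij]
      simp only [h1]
      rw [Finset.sum_eq_single j]
      · rw [if_pos rfl, ih _ (by simpa using hw)]
        simp [single]
      · intro i _ hij
        simp [hij]
      · simp

theorem compose_single [DecidableEq κ] (w : List κ) (h : κ → List ι → R) :
    compose (single w) h = blockSum (w.map h) := by
  funext v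
  rcases le_or_gt w.length v.length with hw | hw
  · rw [compose, pairing_comm, pairing_single _ hw]
  · rw [blockSum_eq_zero _ _ (by simpa using hw), compose,
      pairing_congr (f' := 0) (g' := fun w => blockSum (w.map h) v) (fun u hu => ?_)
        (fun _ _ => rfl), pairing_zero_left]
    refine if_neg ?_
    rintro rfl
    omega

end Composition

/-! ### Change of coefficients -/

section Map

variable {S : Type*} [CommRing R] [CommRing S] (φ : R →+* S)

theorem map_shuffle (f g : List ι → R) (w : List ι) :
    φ (shuffle f g w) = shuffle (fun v => φ (f v)) (fun v => φ (g v)) w := by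
  induction w generalizing f g with
  | nil => simp
  | cons i w ih => rw [shuffle_cons, shuffle_cons, map_add, ih, ih]; rfl

theorem map_conv (x y : List ι → R) (w : List ι) :
    φ (conv x y w) = conv (fun v => φ (x v)) (fun v => φ (y v)) w := by
  induction w generalizing y with
  | nil => simp
  | cons i w ih => rw [conv_cons, conv_cons, map_add, map_mul, ih]; rfl

theorem map_blockSum (gs : List (List ι → R)) (w : List ι) :
    φ (blockSum gs w) = blockSum (gs.map fun g v => φ (g v)) w := by
  induction gs generalizing w with
  | nil => cases w <;> simp
  | cons g gs ih =>
    cases w with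
    | nil => simp
    | cons i w =>
      rw [List.map_cons, blockSum_cons, blockSum_cons, halfShuffle_cons, halfShuffle_cons,
        map_shuffle]
      simp only [ih]
      rfl

theorem map_gradedPairing [Fintype ι] (n : ℕ) (f g : List ι → R) :
    φ (gradedPairing n f g) = gradedPairing n (fun v => φ (f v)) (fun v => φ (g v)) := by
  induction n generalizing f g with
  | zero => simp
  | succ n ih =>
    rw [gradedPairing_succ, gradedPairing_succ, map_sum]
    exact Finset.sum_congr rfl fun i _ => ih _ _

theorem map_pairing [Fintype ι] (N : ℕ) (f g : List ι → R) :
    φ (pairing N f g) = pairing N (fun v => φ (f v)) (fun v => φ (g v)) := by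
  simp [pairing, map_gradedPairing]

theorem map_leftTranslate [Fintype ι] (N : ℕ) (x f : List ι → R) (w : List ι) :
    φ (leftTranslate N x f w) = leftTranslate N (fun v => φ (x v)) (fun v => φ (f v)) w :=
  map_pairing φ N _ _

theorem map_pushforward [Fintype ι] (N : ℕ) (h : κ → List ι → R) (x : List ι → R) (w : List κ) :
    φ (pushforward N h x w) = pushforward N (fun j v => φ (h j v)) (fun v => φ (x v)) w := by
  rw [pushforward, pushforward, map_pairing]
  simp only [map_blockSum, List.map_map]
  rfl

theorem map_compose [Fintype κ] (G : List κ → R) (h : κ → List ι → R) (v : List ι) :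
    φ (compose G h v) = compose (fun w => φ (G w)) (fun j w => φ (h j w)) v := by
  rw [compose, compose, map_pairing]
  simp only [map_blockSum, List.map_map]
  rfl

end Map

end WordSeries

namespace WordSeries

/-! ### Orders of functions on words -/

/-- A decreasing filtration `F 0 ⊇ F 1 ⊇ ⋯` of a commutative ring by additive subgroups, compatible
with the product. The example to keep in mind: the ring of functions of the times `s ≤ t`, with
`F m` the functions that are `O(ω(s,t)^(m/p))`. -/
structure MulFiltration (R : Type*) [CommRing R] where
  /-- The elements of order at least `m`. -/
  F : ℕ → AddSubgroup R
  anti : ∀ {m n : ℕ}, m ≤ n → F n ≤ F m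
  mul : ∀ {m n : ℕ} {a b : R}, a ∈ F m → b ∈ F n → a * b ∈ F (m + n)
  one : 1 ∈ F 0

variable {ι κ ν R : Type*} [CommRing R]

/-- `f` has order `m`: its value at `w` is of order `m - |w|`, for all words `w`. -/
def HasOrder (𝓕 : MulFiltration R) (m : ℕ) (f : List ι → R) : Prop :=
  ∀ w, f w ∈ 𝓕.F (m - w.length)

/-- `x` decays like a rough path: its value at `w` is of order `|w|`, for all words `w` of length
at most `N`. -/
def Decays (𝓕 : MulFiltration R) (N : ℕ) (x : List ι → R) : Prop :=
  ∀ w, w.length ≤ N → x w ∈ 𝓕.F w.length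

namespace HasOrder

variable {𝓕 : MulFiltration R} {m n : ℕ} {f g : List ι → R}

theorem mono (hf : HasOrder 𝓕 n f) (h : m ≤ n) : HasOrder 𝓕 m f :=
  fun w => 𝓕.anti (Nat.sub_le_sub_right h _) (hf w)

protected theorem add (hf : HasOrder 𝓕 m f) (hg : HasOrder 𝓕 m g) : HasOrder 𝓕 m (f + g) :=
  fun w => (𝓕.F _).add_mem (hf w) (hg w)

protected theorem sub (hf : HasOrder 𝓕 m f) (hg : HasOrder 𝓕 m g) : HasOrder 𝓕 m (f - g) :=
  fun w => (𝓕.F _).sub_mem (hf w) (hg w)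

protected theorem sum {α : Type*} {s : Finset α} {f : α → List ι → R}
    (hf : ∀ a ∈ s, HasOrder 𝓕 m (f a)) : HasOrder 𝓕 m (∑ a ∈ s, f a) := fun w => by
  rw [Finset.sum_apply]
  exact (𝓕.F _).sum_mem fun a ha => hf a ha w

protected theorem der (hf : HasOrder 𝓕 m f) (i : ι) : HasOrder 𝓕 (m - 1) (der i f) := fun w => by
  have := hf (i :: w)
  rwa [List.length_cons, add_comm, ← Nat.sub_sub] at this

protected theorem der_zero (hf : HasOrder 𝓕 0 f) (i : ι) : HasOrder 𝓕 0 (der i f) := hf.der i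

theorem of_nil_of_der (h0 : f [] ∈ 𝓕.F (m + 1)) (h : ∀ i, HasOrder 𝓕 m (WordSeries.der i f)) :
    HasOrder 𝓕 (m + 1) f := by
  intro w
  cases w with
  | nil => exact h0
  | cons i w =>
    rw [List.length_cons, Nat.add_sub_add_right]
    exact h i w

theorem unit : HasOrder 𝓕 0 (unit : List ι → R) := fun w => by
  rw [Nat.zero_sub]
  cases w
  · exact 𝓕.one
  · exact (𝓕.F _).zero_mem

theorem single [DecidableEq ι] (w : List ι) : HasOrder 𝓕 0 (single w : List ι → R) := fun v => by
  rw [Nat.zero_sub, WordSeries.single]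
  split_ifs
  · exact 𝓕.one
  · exact (𝓕.F _).zero_mem

protected theorem shuffle (hf : HasOrder 𝓕 m f) (hg : HasOrder 𝓕 n g) :
    HasOrder 𝓕 (m + n) (shuffle f g) := by
  intro w
  induction w generalizing f g m n with
  | nil => exact 𝓕.mul (hf []) (hg [])
  | cons i w ih =>
    rw [shuffle_cons, List.length_cons]
    exact (𝓕.F _).add_mem (𝓕.anti (by omega) (ih (hf.der i) hg))
      (𝓕.anti (by omega) (ih hf (hg.der i)))

theorem shuffle_zero_right (hf : HasOrder 𝓕 m f) (hg : HasOrder 𝓕 0 g) :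
    HasOrder 𝓕 m (WordSeries.shuffle f g) := hf.shuffle hg

theorem shuffle_zero_left (hf : HasOrder 𝓕 0 f) (hg : HasOrder 𝓕 m g) :
    HasOrder 𝓕 m (WordSeries.shuffle f g) := by simpa using hf.shuffle hg

protected theorem blockSum {gs : List (List ι → R)} (h : ∀ g ∈ gs, HasOrder 𝓕 0 g) :
    HasOrder 𝓕 gs.length (blockSum gs) := by
  induction gs with
  | nil => exact HasOrder.unit
  | cons g gs ih =>
    refine of_nil_of_der (𝓕.F _).zero_mem fun i => ?_
    exact (ih fun g' hg' => h g' (List.mem_cons_of_mem _ hg')).shuffle_zero_right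
      ((h g List.mem_cons_self).der_zero i)

theorem blockSum_map {α : Type*} {h : α → List ι → R} (hh : ∀ j, HasOrder 𝓕 0 (h j))
    (w : List α) : HasOrder 𝓕 w.length (WordSeries.blockSum (w.map h)) := by
  have := HasOrder.blockSum (𝓕 := 𝓕) (gs := w.map h) (by simpa using fun a _ => hh a)
  simpa using this

variable [Fintype ι]

theorem _root_.WordSeries.gradedPairing_mem {n m : ℕ} {x f : List ι → R}
    (h : ∀ w, w.length = n → x w * f w ∈ 𝓕.F m) : gradedPairing n x f ∈ 𝓕.F m := by
  induction n generalizing x f with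
  | zero => exact h [] rfl
  | succ n ih =>
    exact (𝓕.F _).sum_mem fun i _ => ih fun w hw => h (i :: w) (by simpa using hw)

theorem _root_.WordSeries.pairing_mem {N m : ℕ} {x f : List ι → R}
    (h : ∀ w, w.length ≤ N → x w * f w ∈ 𝓕.F m) : pairing N x f ∈ 𝓕.F m :=
  (𝓕.F _).sum_mem fun n hn => gradedPairing_mem fun w hw =>
    h w (hw.trans_le (by simpa [Nat.lt_succ_iff] using hn))

theorem pairing_mem {N : ℕ} {x : List ι → R} (hx : Decays 𝓕 N x) (hf : HasOrder 𝓕 m f) :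
    pairing N x f ∈ 𝓕.F m :=
  WordSeries.pairing_mem fun w hw => 𝓕.anti (by omega) (𝓕.mul (hx w hw) (hf w))

protected theorem leftTranslate {N : ℕ} {x : List ι → R} (hx : Decays 𝓕 N x)
    (hf : HasOrder 𝓕 m f) : HasOrder 𝓕 m (leftTranslate N x f) := fun w =>
  pairing_mem hx fun u => by
    have := hf (w ++ u)
    rwa [List.length_append, ← Nat.sub_sub] at this

theorem leftTranslate_of_small {N : ℕ} {x : List ι → R} (hx : ∀ w, w.length ≤ N → x w ∈ 𝓕.F m)
    (hf : HasOrder 𝓕 0 f) : HasOrder 𝓕 m (WordSeries.leftTranslate N x f) := fun w =>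
  WordSeries.pairing_mem fun u hu => 𝓕.anti (by omega) (𝓕.mul (hx u hu) (hf (w ++ u)))

end HasOrder

theorem HasOrder.compose {𝓕 : MulFiltration R} {m : ℕ} [Fintype κ] {G : List κ → R}
    {h : κ → List ι → R}
    (hG : HasOrder 𝓕 m G) (hh : ∀ j, HasOrder 𝓕 0 (h j)) : HasOrder 𝓕 m (WordSeries.compose G h) :=
  fun v => WordSeries.pairing_mem fun w _ =>
    𝓕.anti (by omega) (𝓕.mul (hG w) (HasOrder.blockSum_map hh w v))

section Perturbation

variable {𝓕 : MulFiltration R} [Fintype κ]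

/-- If the derivatives of the inner functions are changed by terms of order `M`, then so are the
derivatives of the composition. -/
theorem compose_sub_right {G : List κ → R} {h h' : κ → List ι → R} {M : ℕ}
    (hG : HasOrder 𝓕 0 G) (hh : ∀ j, HasOrder 𝓕 0 (h j)) (hh' : ∀ j, HasOrder 𝓕 0 (h' j))
    (hd : ∀ j i, HasOrder 𝓕 (M - 1) (der i (h j) - der i (h' j))) :
    HasOrder 𝓕 M (compose G h - compose G h') := by
  induction M generalizing G with
  | zero => exact (hG.compose hh).sub (hG.compose hh')
  | succ M ih =>
    refine HasOrder.of_nil_of_der (by simp) fun i => ?_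
    rw [der_sub, der_compose, der_compose, ← Finset.sum_sub_distrib]
    refine HasOrder.sum fun j _ => ?_
    have e : shuffle (compose (der j G) h) (der i (h j)) -
        shuffle (compose (der j G) h') (der i (h' j)) =
        shuffle (compose (der j G) h - compose (der j G) h') (der i (h j)) +
          shuffle (compose (der j G) h') (der i (h j) - der i (h' j)) := by
      rw [shuffle_sub_left, shuffle_sub_right]; abel
    rw [e]
    refine HasOrder.add ?_ ?_
    · exact (ih (hG.der_zero j) fun j i => (hd j i).mono (by omega)).shuffle_zero_right
        ((hh j).der_zero i)
    · exact ((hG.der_zero j).compose hh').shuffle_zero_left (hd j i)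

end Perturbation

/-! ### Algebraic identities for the composition -/

section Exact

/-- The filtration with `F 0 = R` and `F (m + 1) = 0`: a function of order `m` is one that
vanishes at the words of length less than `m`. -/
def trivialFiltration (R : Type*) [CommRing R] : MulFiltration R where
  F m := if m = 0 then ⊤ else ⊥
  anti := by
    intro m n h
    by_cases hn : n = 0
    · obtain rfl : m = 0 := by omega
      simp [hn]
    · simp [hn]
  mul := by
    intro m n a b ha hb
    by_cases hm : m = 0
    · by_cases hn : n = 0
      · simp [hm, hn]
      · simp [hn] at hb; simp [hb]
    · simp [hm] at ha; simp [ha]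
  one := by simp

theorem hasOrder_trivial_iff {m : ℕ} {f : List ι → R} :
    HasOrder (trivialFiltration R) m f ↔ ∀ w, w.length < m → f w = 0 := by
  refine forall_congr' fun w => ?_
  by_cases h : w.length < m
  · have : m - w.length ≠ 0 := by omega
    simp [trivialFiltration, this, h]
  · have : m - w.length = 0 := by omega
    simp [trivialFiltration, this, h]

theorem hasOrder_trivial_zero {f : List ι → R} : HasOrder (trivialFiltration R) 0 f :=
  hasOrder_trivial_iff.2 fun _ h => absurd h (Nat.not_lt_zero _)

theorem eq_of_hasOrder_trivial {f g : List ι → R}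
    (h : ∀ m, HasOrder (trivialFiltration R) m (f - g)) : f = g := by
  funext w
  exact sub_eq_zero.1 (hasOrder_trivial_iff.1 (h (w.length + 1)) w (Nat.lt_succ_self _))

variable [Fintype κ]

/-- The composition with `h` from the right is a homomorphism of shuffle algebras. -/
theorem compose_shuffle (F G : List κ → R) (h : κ → List ι → R) :
    compose (shuffle F G) h = shuffle (compose F h) (compose G h) := by
  refine eq_of_hasOrder_trivial fun m => ?_
  induction m generalizing F G with
  | zero => exact hasOrder_trivial_zero
  | succ m ih =>
    refine HasOrder.of_nil_of_der (by simp) fun i => ?_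
    have e : der i (compose (shuffle F G) h - shuffle (compose F h) (compose G h)) =
        ∑ j, (shuffle (compose (shuffle (der j F) G) h -
            shuffle (compose (der j F) h) (compose G h)) (der i (h j)) +
          shuffle (compose (shuffle F (der j G)) h -
            shuffle (compose F h) (compose (der j G) h)) (der i (h j))) := by
      rw [der_sub, der_shuffle, der_compose, der_compose, der_compose, shuffle_sum_left,
        shuffle_sum_right, ← Finset.sum_add_distrib, ← Finset.sum_sub_distrib]
      refine Finset.sum_congr rfl fun j _ => ?_
      rw [der_shuffle, compose_add, shuffle_add_left, shuffle_sub_left, shuffle_sub_left,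
        shuffle_right_comm (compose (der j F) h), shuffle_assoc (compose F h)]
      abel
    rw [e]
    exact HasOrder.sum fun j _ => ((ih _ _).shuffle_zero_right hasOrder_trivial_zero).add
      ((ih _ _).shuffle_zero_right hasOrder_trivial_zero)

/-- The composition is associative. -/
theorem compose_compose [Fintype ν] (G : List ν → R) (h : ν → List κ → R) (k : κ → List ι → R) :
    compose (compose G h) k = compose G (fun j => compose (h j) k) := by
  refine eq_of_hasOrder_trivial fun m => ?_
  induction m generalizing G with
  | zero => exact hasOrder_trivial_zero
  | succ m ih =>
    refine HasOrder.of_nil_of_der (by simp) fun i => ?_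
    have e : der i (compose (compose G h) k - compose G (fun j => compose (h j) k)) =
        ∑ l, shuffle (compose (compose (der l G) h) k -
          compose (der l G) (fun j => compose (h j) k)) (der i (compose (h l) k)) := by
      rw [der_sub, der_compose (compose G h), der_compose G]
      simp only [der_compose G, compose_sum, compose_shuffle, shuffle_sum_left]
      rw [Finset.sum_comm, ← Finset.sum_sub_distrib]
      refine Finset.sum_congr rfl fun l _ => ?_
      simp only [shuffle_sub_left, der_compose (h l), shuffle_sum_right, shuffle_assoc,
        Finset.sum_sub_distrib]
    rw [e]
    exact HasOrder.sum fun j _ => (ih _).shuffle_zero_right hasOrder_trivial_zero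

/-- The value of a composition at a word of length less than `m` involves the outer function only
at words of length less than `m`, and the inner ones only at nonempty words of length less
than `m`. -/
theorem compose_congr {G G' : List κ → R} {h h' : κ → List ι → R} {m : ℕ}
    (hG : ∀ w, w.length < m → G w = G' w)
    (hh : ∀ j i v, v.length + 1 < m → h j (i :: v) = h' j (i :: v)) {v : List ι}
    (hv : v.length < m) : compose G h v = compose G' h' v := by
  have h1 : HasOrder (trivialFiltration R) m (compose G h - compose G h') :=
    compose_sub_right (𝓕 := trivialFiltration R) hasOrder_trivial_zero
      (fun _ => hasOrder_trivial_zero)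
      (fun _ => hasOrder_trivial_zero) fun j i => hasOrder_trivial_iff.2 fun w hw => by
        simp [hh j i w (by omega)]
  have h2 : compose G h v - compose G h' v = 0 := hasOrder_trivial_iff.1 h1 v hv
  rw [sub_eq_zero.1 h2]
  exact pairing_congr (fun w hw => hG w (hw.trans_lt hv)) (fun _ _ => rfl)

end Exact

/-! ### Characters of the shuffle algebra -/

/-- A function supported in degrees less than `a` times one supported in degrees less than `b`. -/
theorem shuffle_eq_zero_of_le {f g : List ι → R} {a b : ℕ}
    (hf : ∀ w, a ≤ w.length → f w = 0) (hg : ∀ w, b ≤ w.length → g w = 0) :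
    ∀ w, a + b ≤ w.length + 1 → shuffle f g w = 0 := by
  intro w
  induction w generalizing f g a b with
  | nil =>
    intro h
    rcases Nat.eq_zero_or_pos a with rfl | ha
    · simp [hf [] (by simp)]
    · obtain rfl : b = 0 := by simp at h; omega
      simp [hg [] (by simp)]
  | cons i w ih =>
    intro h
    simp only [List.length_cons] at h
    have h1 : shuffle (der i f) g w = 0 := by
      rcases Nat.eq_zero_or_pos a with rfl | ha
      · have : der i f = 0 := funext fun v => hf _ (Nat.zero_le _)
        simp [this]
      · exact ih (a := a - 1) (fun v hv => hf _ (by simp only [List.length_cons]; omega)) hg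
          (by omega)
    have h2 : shuffle f (der i g) w = 0 := by
      rcases Nat.eq_zero_or_pos b with rfl | hb
      · have : der i g = 0 := funext fun v => hg _ (Nat.zero_le _)
        simp [this]
      · exact ih (b := b - 1) hf (fun v hv => hg _ (by simp only [List.length_cons]; omega))
          (by omega)
    rw [shuffle_cons, h1, h2, add_zero]

variable {𝓕 : MulFiltration R} {N : ℕ}

/-- `x` is a character of the shuffle algebra, up to degree `N`. -/
structure IsCharacter [Fintype ι] (N : ℕ) (x : List ι → R) : Prop where
  nil : x [] = 1
  mul : ∀ i j, i + j ≤ N → ∀ f g : List ι → R, gradedPairing i x f * gradedPairing j x g =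
    gradedPairing (i + j) x (shuffle (component i f) (component j g))

theorem component_sum (f : List ι → R) {w : List ι} (hw : w.length ≤ N) :
    (∑ i ∈ Finset.range (N + 1), component i f) w = f w := by
  rw [Finset.sum_apply, Finset.sum_eq_single w.length]
  · simp [component]
  · intro i _ hi
    simp [component, hi.symm]
  · intro h
    exact absurd (Finset.mem_range.2 (Nat.lt_succ_of_le hw)) h

theorem shuffle_component_eq_zero {i j : ℕ} {f g : List ι → R} {w : List ι}
    (h : w.length ≠ i + j) : shuffle (component i f) (component j g) w = 0 := by
  rcases lt_or_gt_of_ne h with h | h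
  · exact shuffle_eq_zero_of_length (a := i) (b := j) (fun v hv => if_neg hv.ne)
      (fun v hv => if_neg hv.ne) w h
  · exact shuffle_eq_zero_of_le (a := i + 1) (b := j + 1)
      (fun v hv => if_neg (by omega)) (fun v hv => if_neg (by omega)) w (by omega)

variable [Fintype ι]

/-- The pairing of a truncated character with a shuffle product, degree by degree. -/
theorem pairing_shuffle_eq_sum (x f g : List ι → R) :
    pairing N x (shuffle f g) = ∑ i ∈ Finset.range (N + 1), ∑ j ∈ Finset.range (N + 1),
      if i + j ≤ N then gradedPairing (i + j) x (shuffle (component i f) (component j g))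
      else 0 := by
  have h1 : pairing N x (shuffle f g) = pairing N x (shuffle
      (∑ i ∈ Finset.range (N + 1), component i f) (∑ i ∈ Finset.range (N + 1), component i g)) :=
    pairing_congr (fun _ _ => rfl) fun w hw => shuffle_congr
      (fun v hv => (component_sum f (hv.trans hw)).symm)
      (fun v hv => (component_sum g (hv.trans hw)).symm)
  rw [h1, shuffle_sum_left, pairing_sum_right]
  refine Finset.sum_congr rfl fun i _ => ?_
  rw [shuffle_sum_right, pairing_sum_right]
  refine Finset.sum_congr rfl fun j _ => ?_
  rw [pairing]
  split_ifs with h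
  · refine Finset.sum_eq_single_of_mem _ (Finset.mem_range.2 (by omega)) fun n _ hn => ?_
    exact gradedPairing_eq_zero fun w hw => shuffle_component_eq_zero (by omega)
  · refine Finset.sum_eq_zero fun n hn => ?_
    rw [Finset.mem_range] at hn
    exact gradedPairing_eq_zero fun w hw => shuffle_component_eq_zero (by omega)

theorem IsCharacter.pairing_mul_sub_mem {x f g : List ι → R} (hx : IsCharacter N x)
    (hd : Decays 𝓕 N x) (hf : HasOrder 𝓕 0 f) (hg : HasOrder 𝓕 0 g) :
    pairing N x f * pairing N x g - pairing N x (shuffle f g) ∈ 𝓕.F (N + 1) := by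
  rw [pairing_shuffle_eq_sum, pairing, pairing, Finset.sum_mul_sum, ← Finset.sum_sub_distrib]
  refine (𝓕.F _).sum_mem fun i hi => ?_
  rw [← Finset.sum_sub_distrib]
  refine (𝓕.F _).sum_mem fun j hj => ?_
  rw [Finset.mem_range] at hi hj
  split_ifs with h
  · rw [hx.mul i j h, sub_self]
    exact (𝓕.F _).zero_mem
  · rw [sub_zero]
    have key : ∀ (n : ℕ) (f : List ι → R), n ≤ N → HasOrder 𝓕 0 f →
        gradedPairing n x f ∈ 𝓕.F n := fun n f hn hf => gradedPairing_mem fun w hw => by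
      have := 𝓕.mul (hd w (hw.trans_le hn)) (hf w)
      rwa [hw, Nat.zero_sub, add_zero] at this
    exact 𝓕.anti (by omega) (𝓕.mul (key i f (by omega) hf) (key j g (by omega) hg))

/-- The translation by a character is multiplicative. -/
theorem IsCharacter.leftTranslate_shuffle_sub {x f g : List ι → R} (hx : IsCharacter N x)
    (hd : Decays 𝓕 N x) (hf : HasOrder 𝓕 0 f) (hg : HasOrder 𝓕 0 g) :
    HasOrder 𝓕 (N + 1)
      (leftTranslate N x (shuffle f g) - shuffle (leftTranslate N x f) (leftTranslate N x g)) := by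
  suffices h : ∀ M ≤ N + 1, ∀ f g : List ι → R, HasOrder 𝓕 0 f → HasOrder 𝓕 0 g →
      HasOrder 𝓕 M (leftTranslate N x (shuffle f g) -
        shuffle (leftTranslate N x f) (leftTranslate N x g)) from
    h _ le_rfl f g hf hg
  intro M
  induction M with
  | zero =>
    intro _ f g hf hg
    exact ((hf.shuffle hg).leftTranslate hd).sub
      ((hf.leftTranslate hd).shuffle (hg.leftTranslate hd))
  | succ M ih =>
    intro hM f g hf hg
    refine HasOrder.of_nil_of_der ?_ fun i => ?_
    · rw [← neg_mem_iff]
      refine 𝓕.anti hM ?_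
      simpa using hx.pairing_mul_sub_mem hd hf hg
    · have e : der i (leftTranslate N x (shuffle f g) -
            shuffle (leftTranslate N x f) (leftTranslate N x g)) =
          (leftTranslate N x (shuffle (der i f) g) -
            shuffle (leftTranslate N x (der i f)) (leftTranslate N x g)) +
          (leftTranslate N x (shuffle f (der i g)) -
            shuffle (leftTranslate N x f) (leftTranslate N x (der i g))) := by
        rw [der_sub, der_leftTranslate, der_shuffle, der_shuffle, leftTranslate_add,
          der_leftTranslate, der_leftTranslate]
        abel
      rw [e]
      exact (ih (by omega) _ _ (hf.der_zero i) hg).add (ih (by omega) _ _ hf (hg.der_zero i))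

/-- A version of Chen's identity: pairing with `x ⊗ y` is translating by `x` and pairing with `y`,
up to terms of order `N + 1`. -/
theorem pairing_conv_sub_mem {x y f : List ι → R} (hx : Decays 𝓕 N x) (hy : Decays 𝓕 N y)
    (hf : HasOrder 𝓕 0 f) :
    pairing N (conv x y) f - pairing N y (leftTranslate N x f) ∈ 𝓕.F (N + 1) := by
  rw [pairing_conv, ← pairing_sub_right]
  refine pairing_mem fun w hw => ?_
  refine 𝓕.anti (by omega : N + 1 ≤ w.length + (N - w.length + 1)) (𝓕.mul (hy w hw) ?_)
  rw [Pi.sub_apply, leftTranslate, ← neg_mem_iff, neg_sub, pairing, pairing,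
    ← Finset.sum_sdiff_eq_sub (by simp)]
  refine (𝓕.F _).sum_mem fun n hn => gradedPairing_mem fun u hu => ?_
  simp only [Finset.mem_sdiff, Finset.mem_range, not_lt] at hn
  exact 𝓕.anti (by omega) (𝓕.mul (hx u (by omega)) (hf (w ++ u)))

/-! ### Translation of a composition -/

theorem Decays.pushforward {x : List ι → R} {h : κ → List ι → R} (hd : Decays 𝓕 N x)
    (hh : ∀ j, HasOrder 𝓕 0 (h j)) : Decays 𝓕 N (pushforward N h x) := fun w _ =>
  (HasOrder.blockSum_map hh w).pairing_mem hd

variable [Fintype κ]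

/-- The translation of `G * h` is the composition of the translations, where `G` is translated by
the pushforward of `x`. -/
theorem IsCharacter.leftTranslate_compose_sub {x : List ι → R} {G : List κ → R} {h : κ → List ι → R}
    (hx : IsCharacter N x) (hd : Decays 𝓕 N x) (hG : HasOrder 𝓕 0 G)
    (hh : ∀ j, HasOrder 𝓕 0 (h j)) :
    HasOrder 𝓕 (N + 1) (leftTranslate N x (compose G h) -
      compose (leftTranslate N (WordSeries.pushforward N h x) G)
        (fun j => leftTranslate N x (h j))) := by
  suffices H : ∀ M ≤ N + 1, ∀ G : List κ → R, HasOrder 𝓕 0 G → HasOrder 𝓕 M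
      (leftTranslate N x (compose G h) - compose (leftTranslate N (WordSeries.pushforward N h x) G)
        (fun j => leftTranslate N x (h j))) from H _ le_rfl G hG
  intro M
  induction M with
  | zero =>
    intro _ G hG
    exact ((hG.compose hh).leftTranslate hd).sub
      ((hG.leftTranslate (hd.pushforward hh)).compose fun j => (hh j).leftTranslate hd)
  | succ M ih =>
    intro hM G hG
    refine HasOrder.of_nil_of_der ?_ fun i => ?_
    · simp [pairing_compose]
    · have e : der i (leftTranslate N x (compose G h) -
          compose (leftTranslate N (WordSeries.pushforward N h x) G)
            (fun j => leftTranslate N x (h j))) =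
          ∑ j, ((leftTranslate N x (shuffle (compose (der j G) h) (der i (h j))) -
              shuffle (leftTranslate N x (compose (der j G) h)) (leftTranslate N x (der i (h j)))) +
            shuffle (leftTranslate N x (compose (der j G) h) -
              compose (leftTranslate N (WordSeries.pushforward N h x) (der j G))
                (fun j => leftTranslate N x (h j))) (leftTranslate N x (der i (h j)))) := by
        rw [der_sub, der_leftTranslate, der_compose, der_compose, leftTranslate_sum,
          ← Finset.sum_sub_distrib]
        refine Finset.sum_congr rfl fun j _ => ?_
        rw [shuffle_sub_left, der_leftTranslate, der_leftTranslate]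
        abel
      rw [e]
      refine HasOrder.sum fun j _ => HasOrder.add ?_ ?_
      · exact (hx.leftTranslate_shuffle_sub hd ((hG.der_zero j).compose hh)
          ((hh j).der_zero i)).mono (by omega)
      · exact (ih (by omega) _ (hG.der_zero j)).shuffle_zero_right
          (((hh j).der_zero i).leftTranslate hd)

/-- The pushforward by a controlled family is almost multiplicative: `h` and `h'` are the values
of the family at the beginning and in the middle of an interval, `x` and `y` those of the rough
path over the two halves. -/
theorem IsCharacter.pushforward_sub_conv_mem {x y z : List ι → R} {h h' : κ → List ι → R}
    (hx : IsCharacter N x) (hdx : Decays 𝓕 N x) (hdy : Decays 𝓕 N y)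
    (hz : ∀ w, w.length ≤ N → z w = conv x y w)
    (hh : ∀ j, HasOrder 𝓕 0 (h j)) (hh' : ∀ j, HasOrder 𝓕 0 (h' j))
    (hc : ∀ j, HasOrder 𝓕 (N + 1) (h' j - leftTranslate N x (h j))) {w : List κ}
    (hw : w.length ≤ N) :
    WordSeries.pushforward N h z w -
      conv (WordSeries.pushforward N h x) (WordSeries.pushforward N h' y) w ∈ 𝓕.F (N + 1) := by
  classical
  set a := WordSeries.pushforward N h x
  set b := WordSeries.pushforward N h' y
  have ha : Decays 𝓕 N a := hdx.pushforward hh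
  have hb : Decays 𝓕 N b := hdy.pushforward hh'
  set G : List κ → R := single w
  have hG : HasOrder 𝓕 0 G := HasOrder.single w
  have e1 : WordSeries.pushforward N h z w = pairing N (conv x y) (compose G h) := by
    rw [← pairing_single (WordSeries.pushforward N h z) hw, ← pairing_compose]
    exact pairing_congr hz fun _ _ => rfl
  have e2 : conv a b w = pairing N (conv a b) G := (pairing_single _ hw).symm
  have s1 := pairing_conv_sub_mem hdx hdy (hG.compose hh)
  have s2 := (hx.leftTranslate_compose_sub hdx hG hh).pairing_mem hdy
  have s3 := (compose_sub_right (M := N + 1) (hG.leftTranslate ha)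
    (fun j => (hh j).leftTranslate hdx) hh' fun j i => by
      have := (hc j).der i
      rw [der_sub] at this
      intro v
      have := this v
      rw [Pi.sub_apply] at this ⊢
      rw [← neg_mem_iff, neg_sub]
      exact this).pairing_mem hdy
  have s4 := pairing_conv_sub_mem ha hb hG
  have e3 : pairing N y (compose (leftTranslate N a G) h') = pairing N b (leftTranslate N a G) :=
    pairing_compose N y _ h'
  rw [pairing_sub_right] at s2 s3
  rw [e3] at s3
  have := (𝓕.F _).sub_mem ((𝓕.F _).add_mem ((𝓕.F _).add_mem s1 s2) s3) s4
  rw [e1, e2]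
  convert this using 1
  ring

/-- Two functions controlled by each other's lifts: if `G' ≈ θ_b G` with `b ≈ h_* x`, and if
`h' ≈ θ_x h`, then `G' * h' ≈ θ_x (G * h)`. -/
theorem IsCharacter.compose_sub_leftTranslate {x : List ι → R} {b G G' : List κ → R}
    {h h' : κ → List ι → R} {M : ℕ} (hM : M ≤ N + 1)
    (hx : IsCharacter N x) (hdx : Decays 𝓕 N x)
    (hb : ∀ w, w.length ≤ N → b w - WordSeries.pushforward N h x w ∈ 𝓕.F M)
    (hG : HasOrder 𝓕 0 G) (hGG' : HasOrder 𝓕 M (G' - leftTranslate N b G))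
    (hh : ∀ j, HasOrder 𝓕 0 (h j)) (hh' : ∀ j, HasOrder 𝓕 0 (h' j))
    (hc : ∀ j, HasOrder 𝓕 M (h' j - leftTranslate N x (h j))) :
    HasOrder 𝓕 M (compose G' h' - leftTranslate N x (compose G h)) := by
  set a := WordSeries.pushforward N h x
  have ha : Decays 𝓕 N a := hdx.pushforward hh
  have s1 : HasOrder 𝓕 M (compose (G' - leftTranslate N b G) h') := hGG'.compose hh'
  have s2 : HasOrder 𝓕 M (compose (leftTranslate N (b - a) G) h') :=
    (HasOrder.leftTranslate_of_small hb hG).compose hh'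
  have s3 : HasOrder 𝓕 M (compose (leftTranslate N a G) h' -
      compose (leftTranslate N a G) fun j => leftTranslate N x (h j)) :=
    compose_sub_right (hG.leftTranslate ha) hh' (fun j => (hh j).leftTranslate hdx)
      fun j i => by simpa using (hc j).der i
  have s4 := (hx.leftTranslate_compose_sub hdx hG hh).mono hM
  rw [leftTranslate_sub_left, compose_sub] at s2
  rw [compose_sub] at s1
  have := ((s1.add s2).add s3).sub s4
  convert this using 1
  abel

end WordSeries

namespace GeomRough

open WordSeries Filter Topology Set

/-! ### Functions of two and three times, filtered by their order -/

/-- The functions `α → ℝ` filtered by their order with respect to a bounded weight `ρ ≥ 0`: those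
of order `m` are `O(ρ^m)`. -/
def orderFiltration {α : Type*} (ρ : α → ℝ) (h0 : ∀ q, 0 ≤ ρ q) (hb : ∃ K, ∀ q, ρ q ≤ K) :
    MulFiltration (α → ℝ) where
  F m :=
    { carrier := {f | ∃ C, ∀ q, |f q| ≤ C * ρ q ^ m}
      zero_mem' := ⟨0, by simp⟩
      add_mem' := by
        rintro f g ⟨C, hC⟩ ⟨D, hD⟩
        refine ⟨C + D, fun q => (abs_add_le _ _).trans ?_⟩
        rw [add_mul]
        exact add_le_add (hC q) (hD q)
      neg_mem' := by
        rintro f ⟨C, hC⟩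
        exact ⟨C, fun q => by simpa using hC q⟩ }
  anti := by
    rintro m n hmn f ⟨C, hC⟩
    obtain ⟨K, hK⟩ := hb
    refine ⟨|C| * |K| ^ (n - m), fun q => (hC q).trans ?_⟩
    have h1 : ρ q ^ n = ρ q ^ (n - m) * ρ q ^ m := by rw [← pow_add, Nat.sub_add_cancel hmn]
    have h2 : ρ q ≤ |K| := (hK q).trans (le_abs_self K)
    have h3 := h0 q
    rw [h1, ← mul_assoc]
    gcongr
    exact le_abs_self C
  mul := by
    rintro m n f g ⟨C, hC⟩ ⟨D, hD⟩
    refine ⟨C * D, fun q => ?_⟩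
    have := mul_le_mul (hC q) (hD q) (abs_nonneg _) ((abs_nonneg _).trans (hC q))
    rw [Pi.mul_apply, abs_mul, pow_add]
    calc _ ≤ _ := this
      _ = _ := by ring
  one := ⟨1, by simp⟩

theorem mem_orderFiltration {α : Type*} {ρ : α → ℝ} {h0 : ∀ q, 0 ≤ ρ q} {hb : ∃ K, ∀ q, ρ q ≤ K}
    {m : ℕ} {f : α → ℝ} :
    f ∈ (orderFiltration ρ h0 hb).F m ↔ ∃ C, ∀ q, |f q| ≤ C * ρ q ^ m := Iff.rfl

/-- The pairs of times `0 ≤ s ≤ t ≤ T`. -/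
abbrev Pairs (T : ℝ) : Type := {q : ℝ × ℝ // 0 ≤ q.1 ∧ q.1 ≤ q.2 ∧ q.2 ≤ T}

/-- The triples of times `0 ≤ s ≤ u ≤ t ≤ T`. -/
abbrev Triples (T : ℝ) : Type :=
  {q : ℝ × ℝ × ℝ // 0 ≤ q.1 ∧ q.1 ≤ q.2.1 ∧ q.2.1 ≤ q.2.2 ∧ q.2.2 ≤ T}

variable {p T : ℝ} {ω : ℝ → ℝ → ℝ}

namespace IsControl

theorem mono (hω : IsControl T ω) {s s' t t' : ℝ} (h0 : 0 ≤ s) (hs : s ≤ s') (h : s' ≤ t')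
    (ht : t' ≤ t) (hT : t ≤ T) : ω s' t' ≤ ω s t := by
  have h1 := hω.superadd s s' t h0 hs (h.trans ht) hT
  have h2 := hω.superadd s' t' t (h0.trans hs) h ht hT
  have h3 := hω.nonneg s s' h0 hs (h.trans (ht.trans hT))
  have h4 := hω.nonneg t' t (h0.trans (hs.trans h)) ht hT
  linarith

theorem le_total (hω : IsControl T ω) {s t : ℝ} (h0 : 0 ≤ s) (h : s ≤ t) (hT : t ≤ T) :
    ω s t ≤ ω 0 T := hω.mono le_rfl h0 h hT le_rfl

end IsControl

/-- The filtration of the functions of `0 ≤ s ≤ t ≤ T` by the order `O(ω(s,t)^(m/p))`. -/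
noncomputable def pairFiltration (hp : 1 ≤ p) (hω : IsControl T ω) : MulFiltration (Pairs T → ℝ) :=
  orderFiltration (fun q => ω q.1.1 q.1.2 ^ (1 / p))
    (fun q => Real.rpow_nonneg (hω.nonneg _ _ q.2.1 q.2.2.1 q.2.2.2) _)
    ⟨ω 0 T ^ (1 / p), fun q => Real.rpow_le_rpow (hω.nonneg _ _ q.2.1 q.2.2.1 q.2.2.2)
      (hω.le_total q.2.1 q.2.2.1 q.2.2.2) (by positivity)⟩

/-- The filtration of the functions of `0 ≤ s ≤ u ≤ t ≤ T` by the order `O(ω(s,t)^(m/p))`. -/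
noncomputable def tripleFiltration (hp : 1 ≤ p) (hω : IsControl T ω) :
    MulFiltration (Triples T → ℝ) :=
  orderFiltration (fun q => ω q.1.1 q.1.2.2 ^ (1 / p))
    (fun q => Real.rpow_nonneg
      (hω.nonneg _ _ q.2.1 (q.2.2.1.trans q.2.2.2.1) q.2.2.2.2) _)
    ⟨ω 0 T ^ (1 / p), fun q => Real.rpow_le_rpow
      (hω.nonneg _ _ q.2.1 (q.2.2.1.trans q.2.2.2.1) q.2.2.2.2)
      (hω.le_total q.2.1 (q.2.2.1.trans q.2.2.2.1) q.2.2.2.2) (by positivity)⟩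

theorem rpow_one_div_pow {x : ℝ} (hx : 0 ≤ x) (p : ℝ) (m : ℕ) :
    (x ^ (1 / p)) ^ m = x ^ ((m : ℝ) / p) := by
  rw [← Real.rpow_natCast, ← Real.rpow_mul hx]
  congr 1
  ring

theorem mem_pairFiltration (hp : 1 ≤ p) (hω : IsControl T ω) {m : ℕ} {f : ℝ → ℝ → ℝ} :
    (fun q : Pairs T => f q.1.1 q.1.2) ∈ (pairFiltration hp hω).F m ↔ IsOrder p T ω m f := by
  rw [pairFiltration, mem_orderFiltration]
  refine exists_congr fun C => ⟨fun h s t h1 h2 h3 => ?_, fun h q => ?_⟩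
  · have := h ⟨(s, t), h1, h2, h3⟩
    rwa [rpow_one_div_pow (hω.nonneg _ _ h1 h2 h3)] at this
  · rw [rpow_one_div_pow (hω.nonneg _ _ q.2.1 q.2.2.1 q.2.2.2)]
    exact h _ _ q.2.1 q.2.2.1 q.2.2.2

theorem mem_tripleFiltration (hp : 1 ≤ p) (hω : IsControl T ω) {m : ℕ} {f : ℝ → ℝ → ℝ → ℝ} :
    (fun q : Triples T => f q.1.1 q.1.2.1 q.1.2.2) ∈ (tripleFiltration hp hω).F m ↔
      ∃ C, ∀ s u t, 0 ≤ s → s ≤ u → u ≤ t → t ≤ T → |f s u t| ≤ C * ω s t ^ ((m : ℝ) / p) := by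
  rw [tripleFiltration, mem_orderFiltration]
  refine exists_congr fun C => ⟨fun h s u t h1 h2 h3 h4 => ?_, fun h q => ?_⟩
  · have := h ⟨(s, u, t), h1, h2, h3, h4⟩
    rwa [rpow_one_div_pow (hω.nonneg _ _ h1 (h2.trans h3) h4)] at this
  · rw [rpow_one_div_pow (hω.nonneg _ _ q.2.1 (q.2.2.1.trans q.2.2.2.1) q.2.2.2.2)]
    exact h _ _ _ q.2.1 q.2.2.1 q.2.2.2.1 q.2.2.2.2

theorem mem_triple_left (hp : 1 ≤ p) (hω : IsControl T ω) {m : ℕ} {f : ℝ → ℝ → ℝ}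
    (hf : (fun q : Pairs T => f q.1.1 q.1.2) ∈ (pairFiltration hp hω).F m) :
    (fun q : Triples T => f q.1.1 q.1.2.1) ∈ (tripleFiltration hp hω).F m := by
  obtain ⟨C, hC⟩ := (mem_pairFiltration hp hω).1 hf
  refine (mem_tripleFiltration hp hω (f := fun s u t => f s u)).2
    ⟨|C|, fun s u t h1 h2 h3 h4 => (hC s u h1 h2 (h3.trans h4)).trans ?_⟩
  have h5 := hω.nonneg s u h1 h2 (h3.trans h4)
  have h6 := hω.mono h1 le_rfl h2 h3 h4
  gcongr
  exact le_abs_self C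

theorem mem_triple_right (hp : 1 ≤ p) (hω : IsControl T ω) {m : ℕ} {f : ℝ → ℝ → ℝ}
    (hf : (fun q : Pairs T => f q.1.1 q.1.2) ∈ (pairFiltration hp hω).F m) :
    (fun q : Triples T => f q.1.2.1 q.1.2.2) ∈ (tripleFiltration hp hω).F m := by
  obtain ⟨C, hC⟩ := (mem_pairFiltration hp hω).1 hf
  refine (mem_tripleFiltration hp hω (f := fun s u t => f u t)).2
    ⟨|C|, fun s u t h1 h2 h3 h4 => (hC u t (h1.trans h2) h3 h4).trans ?_⟩
  have h5 := hω.nonneg u t (h1.trans h2) h3 h4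
  have h6 := hω.mono h1 h2 h3 le_rfl h4
  gcongr
  exact le_abs_self C

/-! ### The sewing lemma -/

/-- The sum of an almost additive function over a partition stays close to its value at the
endpoints, uniformly in the partition: split the partition where `ω` is halved. -/
theorem abs_sum_sub_le (hω : IsControl T ω) {θ C : ℝ} (hθ : 1 < θ) (hC : 0 ≤ C)
    {Ξ : ℝ → ℝ → ℝ}
    (hΞ : ∀ s u t, 0 ≤ s → s ≤ u → u ≤ t → t ≤ T → |Ξ s t - Ξ s u - Ξ u t| ≤ C * ω s t ^ θ)
    {τ : ℕ → ℝ} (hτ : Monotone τ) (h0 : ∀ n, 0 ≤ τ n) (hT : ∀ n, τ n ≤ T) (n i : ℕ) :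
    |∑ l ∈ Finset.range n, Ξ (τ (i + l)) (τ (i + l + 1)) - Ξ (τ i) (τ (i + n))| ≤
      2 * C / (1 - 2 ^ (1 - θ)) * ω (τ i) (τ (i + n)) ^ θ := by
  have hr : (2 : ℝ) ^ (1 - θ) < 1 := Real.rpow_lt_one_of_one_lt_of_neg (by norm_num) (by linarith)
  set M := 2 * C / (1 - 2 ^ (1 - θ)) with hM
  have hM0 : 0 ≤ M := div_nonneg (by linarith) (by linarith)
  have hMeq : M * 2 ^ (1 - θ) + 2 * C = M := by
    have : (1 - (2 : ℝ) ^ (1 - θ)) ≠ 0 := by linarith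
    have h : M * (1 - 2 ^ (1 - θ)) = 2 * C := by rw [hM]; field_simp
    linarith
  induction n using Nat.strong_induction_on generalizing i with
  | _ n ih =>
  rcases Nat.eq_zero_or_pos n with rfl | hn
  · have := hΞ (τ i) (τ i) (τ i) (h0 i) le_rfl le_rfl (hT i)
    rw [hω.diag _ (h0 i) (hT i), Real.zero_rpow (by linarith), mul_zero] at this
    have h2 : Ξ (τ i) (τ i) = 0 := by
      have := abs_nonpos_iff.1 this
      linarith
    simp [h2, hω.diag _ (h0 i) (hT i), Real.zero_rpow (by linarith : θ ≠ 0)]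
  set s := τ i
  set t := τ (i + n)
  -- `j` is the last point of the partition up to which at most half of `ω s t` is used up
  set P : ℕ → Prop := fun j => ω s (τ (i + j)) ≤ ω s t / 2 with hP
  classical
  set j := Nat.findGreatest P (n - 1) with hj
  have hjn : j < n := (Nat.findGreatest_le (n - 1)).trans_lt (by omega)
  have hst : s ≤ t := hτ (by omega)
  have hωst := hω.nonneg s t (h0 _) hst (hT _)
  have hPj : P j := by
    refine Nat.findGreatest_spec (m := 0) (Nat.zero_le _) ?_
    simp only [hP, add_zero]
    rw [hω.diag _ (h0 _) (hT _)]
    linarith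
  have hPj' : ω (τ (i + j + 1)) t ≤ ω s t / 2 := by
    rcases eq_or_lt_of_le (Nat.succ_le_of_lt hjn) with h | h
    · have : τ (i + j + 1) = t := by rw [add_assoc]; simp only [t]; rw [← h]
      rw [this, hω.diag _ (h0 _) (hT _)]
      linarith
    · have h1 : ¬ P (j + 1) := Nat.findGreatest_is_greatest (n := n - 1) (Nat.lt_succ_self _)
        (by omega)
      simp only [hP, not_le] at h1
      have := hω.superadd s (τ (i + j + 1)) t (h0 _) (hτ (by omega)) (hτ (by omega)) (hT _)
      rw [← add_assoc] at h1
      linarith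
  have e1 := ih j hjn i
  have e2 := ih (n - (j + 1)) (by omega) (i + j + 1)
  rw [show i + j + 1 + (n - (j + 1)) = i + n by omega] at e2
  have e3 := hΞ s (τ (i + j)) t (h0 _) (hτ (by omega)) (hτ (by omega)) (hT _)
  have e4 := hΞ (τ (i + j)) (τ (i + j + 1)) t (h0 _) (hτ (by omega)) (hτ (by omega)) (hT _)
  have e5 : ω (τ (i + j)) t ^ θ ≤ ω s t ^ θ :=
    Real.rpow_le_rpow (hω.nonneg _ _ (h0 _) (hτ (by omega)) (hT _))
      (hω.mono (h0 _) (hτ (by omega)) (hτ (by omega)) le_rfl (hT _)) (by linarith)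
  have half : ∀ {x : ℝ}, 0 ≤ x → x ≤ ω s t / 2 →
      M * x ^ θ ≤ M * (2 ^ (1 - θ) / 2 * ω s t ^ θ) := by
    intro x hx hx'
    refine mul_le_mul_of_nonneg_left ?_ hM0
    calc x ^ θ ≤ (ω s t / 2) ^ θ := Real.rpow_le_rpow hx hx' (by linarith)
      _ = 2 ^ (1 - θ) / 2 * ω s t ^ θ := by
        rw [Real.div_rpow hωst (by norm_num), Real.rpow_sub (by norm_num), Real.rpow_one]
        field_simp
  have e6 := half (hω.nonneg s (τ (i + j)) (h0 _) (hτ (by omega)) (hT _)) hPj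
  have e7 := half (hω.nonneg (τ (i + j + 1)) t (h0 _) (hτ (by omega)) (hT _)) hPj'
  have hsum : ∑ l ∈ Finset.range n, Ξ (τ (i + l)) (τ (i + l + 1)) =
      (∑ l ∈ Finset.range j, Ξ (τ (i + l)) (τ (i + l + 1))) + Ξ (τ (i + j)) (τ (i + j + 1)) +
        ∑ l ∈ Finset.range (n - (j + 1)), Ξ (τ (i + j + 1 + l)) (τ (i + j + 1 + l + 1)) := by
    rw [← Finset.sum_range_succ]
    conv_lhs => rw [show n = (j + 1) + (n - (j + 1)) by omega, Finset.sum_range_add]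
    congr 1
    refine Finset.sum_congr rfl fun l _ => ?_
    rw [show i + (j + 1 + l) = i + j + 1 + l by omega]
  have e5' := mul_le_mul_of_nonneg_left e5 hC
  have hfin : M * ω s t ^ θ = 2 * (M * (2 ^ (1 - θ) / 2 * ω s t ^ θ)) + 2 * (C * ω s t ^ θ) := by
    conv_lhs => rw [← hMeq]
    ring
  rw [hsum, hfin]
  rw [abs_le] at *
  constructor <;> linarith [e1.1, e1.2, e2.1, e2.2, e3.1, e3.2, e4.1, e4.2]

/-- The sewing lemma: an almost additive function is close to the increments of a path. The path is
a limit along an ultrafilter of sums over finite sets of times, and needs no convergence of these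
sums. -/
theorem exists_path_of_almost_additive (hω : IsControl T ω) (hT : 0 ≤ T) {θ C : ℝ} (hθ : 1 < θ)
    (hC : 0 ≤ C) {Ξ : ℝ → ℝ → ℝ}
    (hΞ : ∀ s u t, 0 ≤ s → s ≤ u → u ≤ t → t ≤ T → |Ξ s t - Ξ s u - Ξ u t| ≤ C * ω s t ^ θ) :
    ∃ φ : ℝ → ℝ, ∃ C', ∀ s t, 0 ≤ s → s ≤ t → t ≤ T →
      |φ t - φ s - Ξ s t| ≤ C' * ω s t ^ θ := by
  set M := 2 * C / (1 - 2 ^ (1 - θ))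
  -- on finitely many times, the sums over consecutive times form such a path
  have fin : ∀ S : Finset ℝ, ∃ φ : ℝ → ℝ, φ 0 = 0 ∧ ∀ s ∈ insert 0 S, ∀ t ∈ insert 0 S,
      0 ≤ s → s ≤ t → t ≤ T → |φ t - φ s - Ξ s t| ≤ M * ω s t ^ θ := by
    intro S
    set S' := (insert 0 S).filter (fun t => 0 ≤ t ∧ t ≤ T) with hS'
    have mem : ∀ k, 0 ≤ S'.orderEmbOfFin rfl k ∧ S'.orderEmbOfFin rfl k ≤ T := fun k =>
      (Finset.mem_filter.1 (Finset.orderEmbOfFin_mem S' rfl k)).2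
    set τ : ℕ → ℝ := fun n => if h : n < S'.card then S'.orderEmbOfFin rfl ⟨n, h⟩ else T with hτ
    have hmono : Monotone τ := by
      intro m n hmn
      simp only [hτ]
      split_ifs with h1 h2 h2
      · exact (S'.orderEmbOfFin rfl).monotone (by simpa using hmn)
      · exact (mem _).2
      · omega
      · exact le_rfl
    have h0 : ∀ n, 0 ≤ τ n := by
      intro n
      simp only [hτ]
      split_ifs
      · exact (mem _).1
      · exact hT
    have h1 : ∀ n, τ n ≤ T := by
      intro n
      simp only [hτ]
      split_ifs
      · exact (mem _).2
      · exact le_rfl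
    have hsurj : ∀ t ∈ S', ∃ n, τ n = t := by
      intro t ht
      have : t ∈ Set.range (S'.orderEmbOfFin rfl) := by
        rw [Finset.range_orderEmbOfFin]; exact ht
      obtain ⟨k, hk⟩ := this
      exact ⟨k, by simp [hτ, hk]⟩
    have hr : ∃ r : ℝ → ℕ, ∀ t ∈ S', τ (r t) = t := by
      classical
      refine ⟨fun t => if h : t ∈ S' then (hsurj t h).choose else 0, fun t ht => ?_⟩
      simp only [ht, dif_pos]
      exact (hsurj t ht).choose_spec
    obtain ⟨r, hr⟩ := hr
    set ψ : ℝ → ℝ := fun t => ∑ l ∈ Finset.range (r t), Ξ (τ l) (τ (l + 1)) with hψ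
    refine ⟨fun t => ψ t - ψ 0, sub_self _, fun s hs t ht hs0 hst htT => ?_⟩
    have hsS : s ∈ S' := Finset.mem_filter.2 ⟨hs, hs0, hst.trans htT⟩
    have htS : t ∈ S' := Finset.mem_filter.2 ⟨ht, hs0.trans hst, htT⟩
    have hrst : r s ≤ r t := by
      rcases eq_or_lt_of_le hst with rfl | hlt
      · exact le_rfl
      · by_contra! hcon
        have := hmono hcon.le
        rw [hr s hsS, hr t htS] at this
        linarith
    have := abs_sum_sub_le hω hθ hC hΞ hmono h0 h1 (r t - r s) (r s)
    rw [Nat.add_sub_cancel' hrst, hr s hsS, hr t htS] at this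
    have e : ψ t - ψ s = ∑ l ∈ Finset.range (r t - r s), Ξ (τ (r s + l)) (τ (r s + l + 1)) := by
      simp only [hψ]
      rw [sub_eq_iff_eq_add', ← Finset.sum_range_add, Nat.add_sub_cancel' hrst]
    rwa [sub_sub_sub_cancel_right, e]
  choose Φ hΦ0 hΦ using fin
  -- pass to the limit along the finite sets of times, directed by inclusion
  let 𝒰 : Ultrafilter (Finset ℝ) := Ultrafilter.of atTop
  have hU : (𝒰 : Filter (Finset ℝ)) ≤ atTop := Ultrafilter.of_le atTop
  have ev : ∀ s : ℝ, ∀ᶠ S in (𝒰 : Filter (Finset ℝ)), s ∈ S := fun s =>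
    hU ((eventually_ge_atTop {s}).mono fun S hS => hS (Finset.mem_singleton_self s))
  have lim : ∀ t, ∃ x : ℝ, 0 ≤ t → t ≤ T → Tendsto (fun S => Φ S t) 𝒰 (𝓝 x) := by
    intro t
    by_cases ht : 0 ≤ t ∧ t ≤ T
    · have hb : ∀ᶠ S in (𝒰 : Filter (Finset ℝ)), Φ S t ∈
          Set.Icc (Ξ 0 t - M * ω 0 t ^ θ) (Ξ 0 t + M * ω 0 t ^ θ) := by
        filter_upwards [ev t] with S hS
        have := hΦ S 0 (Finset.mem_insert_self _ _) t (Finset.mem_insert_of_mem hS) le_rfl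
          ht.1 ht.2
        rw [hΦ0, abs_le] at this
        constructor <;> linarith [this.1, this.2]
      obtain ⟨x, _, hx⟩ := (isCompact_Icc (a := Ξ 0 t - M * ω 0 t ^ θ)
        (b := Ξ 0 t + M * ω 0 t ^ θ)).ultrafilter_le_nhds (𝒰.map fun S => Φ S t)
        (le_principal_iff.2 hb)
      exact ⟨x, fun _ _ => hx⟩
    · exact ⟨0, fun h1 h2 => absurd ⟨h1, h2⟩ ht⟩
  choose φ hφ using lim
  refine ⟨φ, M, fun s t hs hst ht => ?_⟩
  have l1 := hφ t (hs.trans hst) ht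
  have l2 := hφ s hs (hst.trans ht)
  have l3 : Tendsto (fun S => |Φ S t - Φ S s - Ξ s t|) 𝒰 (𝓝 |φ t - φ s - Ξ s t|) :=
    ((l1.sub l2).sub_const _).abs
  refine le_of_tendsto l3 ?_
  filter_upwards [ev t, ev s] with S h1 h2
  exact hΦ S s (Finset.mem_insert_of_mem h2) t (Finset.mem_insert_of_mem h1) hs hst ht

/-- An additive function of order larger than one vanishes: halving the interval in the sense of
`ω` improves the constant. -/
theorem eq_zero_of_additive (hω : IsControl T ω) {θ C : ℝ} (hθ : 1 < θ) {d : ℝ → ℝ → ℝ}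
    (hd : ∀ s u t, 0 ≤ s → s ≤ u → u ≤ t → t ≤ T → d s t = d s u + d u t)
    (hC : ∀ s t, 0 ≤ s → s ≤ t → t ≤ T → |d s t| ≤ C * ω s t ^ θ) {s t : ℝ}
    (hs : 0 ≤ s) (hst : s ≤ t) (ht : t ≤ T) : d s t = 0 := by
  set r : ℝ := 2 ^ (1 - θ) with hr_def
  have hr : r < 1 := Real.rpow_lt_one_of_one_lt_of_neg (by norm_num) (by linarith)
  have hr0 : 0 ≤ r := by positivity
  have key : ∀ n : ℕ, ∀ s t, 0 ≤ s → s ≤ t → t ≤ T → |d s t| ≤ |C| * r ^ n * ω s t ^ θ := by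
    intro n
    induction n with
    | zero =>
      intro s t hs hst ht
      have := Real.rpow_nonneg (hω.nonneg s t hs hst ht) θ
      refine (hC s t hs hst ht).trans ?_
      rw [pow_zero, mul_one]
      gcongr
      exact le_abs_self C
    | succ n ih =>
      intro s t hs hst ht
      have hωst := hω.nonneg s t hs hst ht
      have hcont : ContinuousOn (fun u => ω s u) (Set.Icc s t) :=
        hω.continuousOn.comp (f := fun u => (s, u)) (by fun_prop)
          fun u hu => ⟨hs, hu.1, hu.2.trans ht⟩
      obtain ⟨u, hu, hωu⟩ : ω s t / 2 ∈ (fun u => ω s u) '' Set.Icc s t := by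
        refine intermediate_value_Icc hst hcont ⟨?_, ?_⟩
        · rw [hω.diag s hs (hst.trans ht)]; linarith
        · exact (by linarith : ω s t / 2 ≤ ω s t)
      have h2 := hω.superadd s u t hs hu.1 hu.2 ht
      simp only at hωu
      have half : ∀ {x : ℝ}, 0 ≤ x → x ≤ ω s t / 2 → x ^ θ ≤ r / 2 * ω s t ^ θ := by
        intro x hx hx'
        calc x ^ θ ≤ (ω s t / 2) ^ θ := Real.rpow_le_rpow hx hx' (by linarith)
          _ = r / 2 * ω s t ^ θ := by
            rw [hr_def, Real.div_rpow hωst (by norm_num), Real.rpow_sub (by norm_num),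
              Real.rpow_one]
            field_simp
      have e1 := ih s u hs hu.1 (hu.2.trans ht)
      have e2 := ih u t (hs.trans hu.1) hu.2 ht
      have e3 := half (hω.nonneg s u hs hu.1 (hu.2.trans ht)) (by linarith)
      have e4 := half (hω.nonneg u t (hs.trans hu.1) hu.2 ht) (by linarith)
      have hK : 0 ≤ |C| * r ^ n := by positivity
      rw [hd s u t hs hu.1 hu.2 ht]
      calc |d s u + d u t| ≤ |d s u| + |d u t| := abs_add_le _ _
        _ ≤ |C| * r ^ n * (r / 2 * ω s t ^ θ) + |C| * r ^ n * (r / 2 * ω s t ^ θ) :=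
          add_le_add (e1.trans (mul_le_mul_of_nonneg_left e3 hK))
            (e2.trans (mul_le_mul_of_nonneg_left e4 hK))
        _ = |C| * r ^ (n + 1) * ω s t ^ θ := by ring
  have lim : Tendsto (fun n : ℕ => |C| * r ^ n * ω s t ^ θ) atTop (𝓝 (|C| * 0 * ω s t ^ θ)) :=
    ((tendsto_pow_atTop_nhds_zero_of_lt_one hr0 hr).const_mul _).mul_const _
  rw [mul_zero, zero_mul] at lim
  exact abs_nonpos_iff.1 (ge_of_tendsto' lim fun n => key n s t hs hst ht)

theorem one_lt_order_div (hp : 1 ≤ p) : 1 < ((⌊p⌋₊ + 1 : ℕ) : ℝ) / p := by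
  rw [one_lt_div (by linarith)]
  push_cast
  exact Nat.lt_floor_add_one p

/-- A path with increments of order one is continuous. -/
theorem continuousOn_of_isOrder_one {E : Type*} [SeminormedAddCommGroup E] (hp : 1 ≤ p)
    (hω : IsControl T ω) {φ : ℝ → E} (hφ : IsOrder p T ω 1 (fun s t => φ t - φ s)) :
    ContinuousOn φ (Set.Icc 0 T) := by
  obtain ⟨C, hC⟩ := hφ
  intro t₀ ht₀
  have hcont : ContinuousOn (fun t => ω (min t t₀) (max t t₀)) (Set.Icc 0 T) :=
    hω.continuousOn.comp (f := fun t => (min t t₀, max t t₀)) (by fun_prop)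
      fun t ht => ⟨le_min ht.1 ht₀.1, min_le_max, max_le ht.2 ht₀.2⟩
  have h1 := hcont t₀ ht₀
  have h2 : Tendsto (fun t => C * ω (min t t₀) (max t t₀) ^ (((1 : ℕ) : ℝ) / p))
      (𝓝[Set.Icc 0 T] t₀) (𝓝 (C * ω (min t₀ t₀) (max t₀ t₀) ^ (((1 : ℕ) : ℝ) / p))) :=
    (h1.rpow_const (Or.inr (by positivity))).const_mul C
  rw [min_self, max_self, hω.diag _ ht₀.1 ht₀.2, Real.zero_rpow (by simp; linarith), mul_zero]
    at h2
  rw [ContinuousWithinAt, tendsto_iff_norm_sub_tendsto_zero]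
  refine squeeze_zero' (Eventually.of_forall fun _ => norm_nonneg _) ?_ h2
  filter_upwards [self_mem_nhdsWithin] with t ht
  rcases le_total t t₀ with h | h
  · rw [min_eq_left h, max_eq_right h, norm_sub_rev]
    exact hC t t₀ ht.1 h ht₀.2
  · rw [min_eq_right h, max_eq_left h]
    exact hC t₀ t ht₀.1 h ht.2

end GeomRough

namespace WordSeries

/-! ### Perturbation of the concatenation product -/

section Conv

variable {ι R : Type*} [CommRing R] {𝓕 : MulFiltration R} {x x' y y' : List ι → R}

theorem conv_mem {m n : ℕ} {w : List ι} (hx : ∀ v, v.length ≤ w.length → x v ∈ 𝓕.F m)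
    (hy : ∀ v, v.length ≤ w.length → y v ∈ 𝓕.F n) : conv x y w ∈ 𝓕.F (m + n) := by
  induction w generalizing y with
  | nil => exact 𝓕.mul (hx [] le_rfl) (hy [] le_rfl)
  | cons i w ih =>
    exact (𝓕.F _).add_mem (𝓕.mul (hx _ le_rfl) (hy [] (by simp)))
      (ih (fun v hv => hx v (hv.trans (by simp))) (fun v hv => hy _ (by simpa using hv)))

theorem conv_sub_conv_mem {m : ℕ} {w : List ι}
    (hy : ∀ v, v.length ≤ w.length → y v ∈ 𝓕.F 0)
    (hx' : ∀ v, v.length ≤ w.length → x' v ∈ 𝓕.F 0)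
    (hxx : ∀ v, v.length ≤ w.length → x v - x' v ∈ 𝓕.F m)
    (hyy : ∀ v, v.length ≤ w.length → y v - y' v ∈ 𝓕.F m) :
    conv x y w - conv x' y' w ∈ 𝓕.F m := by
  have e : conv x y w - conv x' y' w = conv (x - x') y w + conv x' (y - y') w := by
    rw [conv_sub_left, conv_sub_right]
    simp
  rw [e]
  refine (𝓕.F _).add_mem (conv_mem (m := m) (n := 0) hxx hy) ?_
  have := conv_mem (𝓕 := 𝓕) (m := 0) (n := m) (w := w) hx' (y := y - y') hyy
  rwa [zero_add] at this

/-- The part of `(x ⊗ y)(w)` in which both factors are nonempty depends only on words shorter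
than `w`; here is the quantitative version. -/
theorem conv_cons_sub_mem {m : ℕ} {i : ι} {w : List ι}
    (hx : ∀ v, v.length ≤ w.length + 1 → x v ∈ 𝓕.F 0)
    (hy : ∀ v, v.length ≤ w.length + 1 → y v ∈ 𝓕.F 0)
    (hxx : ∀ v, v.length ≤ w.length → x v - x' v ∈ 𝓕.F m)
    (hyy : ∀ v, v.length ≤ w.length → y v - y' v ∈ 𝓕.F m)
    (hx0 : x' [] = 1) (hy0 : y' [] = 1) :
    (conv x y (i :: w) - x (i :: w) - y (i :: w)) -
      (conv x' y' (i :: w) - x' (i :: w) - y' (i :: w)) ∈ 𝓕.F m := by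
  set x₁ : List ι → R := fun v => if v.length ≤ w.length then x' v else x v with hx₁
  set y₁ : List ι → R := fun v => if v.length ≤ w.length then y' v else y v with hy₁
  have e := conv_cons_congr (x := x') (x' := x₁) (y := y') (y' := y₁) (i := i) (w := w)
    (fun v hv => by simp [hx₁, hv]) (fun v hv => by simp [hy₁, hv]) hx0 hy0
  have ex : x₁ (i :: w) = x (i :: w) := by simp [hx₁]
  have ey : y₁ (i :: w) = y (i :: w) := by simp [hy₁]
  have hxd : ∀ v, v.length ≤ (i :: w).length → x v - x₁ v ∈ 𝓕.F m := by
    intro v _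
    by_cases h : v.length ≤ w.length
    · simpa [hx₁, h] using hxx v h
    · simp [hx₁, h]
  have hyd : ∀ v, v.length ≤ (i :: w).length → y v - y₁ v ∈ 𝓕.F m := by
    intro v _
    by_cases h : v.length ≤ w.length
    · simpa [hy₁, h] using hyy v h
    · simp [hy₁, h]
  have hx₁0 : ∀ v, v.length ≤ (i :: w).length → x₁ v ∈ 𝓕.F 0 := by
    intro v hv
    have := (𝓕.F 0).sub_mem (hx v (by simpa using hv)) (𝓕.anti (Nat.zero_le m) (hxd v hv))
    simpa using this
  have := conv_sub_conv_mem (fun v hv => hy v (by simpa using hv)) hx₁0 hxd hyd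
  rw [e, ex, ey]
  convert this using 1
  ring

theorem leftDiv_congr {w : List ι} (hx : ∀ v, v.length ≤ w.length → x v = x' v)
    (hy : ∀ v, v.length ≤ w.length → y v = y' v) : leftDiv x y w = leftDiv x' y' w := by
  induction w generalizing y y' with
  | nil => exact hy [] le_rfl
  | cons i w ih =>
    rw [leftDiv_cons, leftDiv_cons]
    refine ih (fun v hv => hx v (hv.trans (by simp))) fun v hv => ?_
    have h1 : v.length + 1 ≤ (i :: w).length := by simpa using hv
    simp [hx (i :: v) h1, hy (i :: v) h1, hy [] (by simp)]

end Conv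

end WordSeries

namespace GeomRough

open WordSeries Filter Topology Set

variable {p T : ℝ} {ω : ℝ → ℝ → ℝ} {κ : Type*}

/-! ### Multiplicative functionals -/

/-- A multiplicative functional, up to degree `N`: a two-parameter family with Chen's identity. -/
structure IsMultiplicative (T : ℝ) (N : ℕ) (Y : ℝ → ℝ → List κ → ℝ) : Prop where
  nil : ∀ s t, 0 ≤ s → s ≤ t → t ≤ T → Y s t [] = 1
  chen : ∀ s u t, 0 ≤ s → s ≤ u → u ≤ t → t ≤ T → ∀ w, w.length ≤ N →
    conv (Y s u) (Y u t) w = Y s t w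

/-- The sewing lemma for multiplicative functionals. The functional found is of the form
`Z_s⁻¹ ⊗ Z_t` and is constructed degree by degree, by the additive sewing lemma. -/
theorem exists_leftDiv_of_almost_multiplicative (hp : 1 ≤ p) (hω : IsControl T ω) (hT : 0 ≤ T)
    {a : ℝ → ℝ → List κ → ℝ} (ha0 : ∀ s t, 0 ≤ s → s ≤ t → t ≤ T → a s t [] = 1)
    (ha : ∀ w : List κ, w.length ≤ ⌊p⌋₊ → IsOrder p T ω 0 (fun s t => a s t w))
    (hmul : ∀ w : List κ, w.length ≤ ⌊p⌋₊ → (fun q : Triples T => a q.1.1 q.1.2.2 w -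
      conv (a q.1.1 q.1.2.1) (a q.1.2.1 q.1.2.2) w) ∈ (tripleFiltration hp hω).F (⌊p⌋₊ + 1)) :
    ∃ Z : ℝ → List κ → ℝ, (∀ t, Z t [] = 1) ∧ ∀ w, w.length ≤ ⌊p⌋₊ →
      IsOrder p T ω (⌊p⌋₊ + 1) (fun s t => leftDiv (Z s) (Z t) w - a s t w) := by
  suffices H : ∀ n ≤ ⌊p⌋₊, ∃ Z : ℝ → List κ → ℝ, (∀ t, Z t [] = 1) ∧ ∀ w, w.length ≤ n →
      IsOrder p T ω (⌊p⌋₊ + 1) (fun s t => leftDiv (Z s) (Z t) w - a s t w) from H _ le_rfl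
  intro n
  induction n with
  | zero =>
    refine fun _ =>
      ⟨fun _ => WordSeries.unit, fun _ => rfl, fun w hw => ⟨0, fun s t h1 h2 h3 => ?_⟩⟩
    obtain rfl : w = [] := by simpa using hw
    simp [ha0 s t h1 h2 h3]
  | succ n ih =>
    intro hn
    obtain ⟨Z, hZ0, hZ⟩ := ih (by omega)
    set Y : ℝ → ℝ → List κ → ℝ := fun s t => leftDiv (Z s) (Z t) with hY
    have hY0 : ∀ s t, Y s t [] = 1 := fun s t => hZ0 t
    have hφ : ∀ w : List κ, ∃ φ : ℝ → ℝ, w.length = n + 1 →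
        IsOrder p T ω (⌊p⌋₊ + 1) (fun s t => φ t - φ s - (a s t w - Y s t w)) := by
      intro w
      by_cases hw : w.length = n + 1
      swap
      · exact ⟨0, fun h => absurd h hw⟩
      obtain ⟨i, w, rfl⟩ : ∃ i v, w = i :: v := by
        cases w with
        | nil => simp at hw
        | cons i v => exact ⟨i, v, rfl⟩
      have hwn : w.length = n := by simpa using hw
      have hb : ∀ v : List κ, v.length ≤ w.length + 1 →
          (fun q : Pairs T => a q.1.1 q.1.2 v) ∈ (pairFiltration hp hω).F 0 := fun v hv =>
        (mem_pairFiltration hp hω).2 (ha v (by omega))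
      have hd : ∀ v : List κ, v.length ≤ w.length →
          (fun q : Pairs T => a q.1.1 q.1.2 v - Y q.1.1 q.1.2 v) ∈
            (pairFiltration hp hω).F (⌊p⌋₊ + 1) := fun v hv => by
        have := neg_mem ((mem_pairFiltration hp hω).2 (hZ v (by omega)))
        convert this using 1
        funext q
        simp [hY]
      -- `a - Y` is almost additive at words of length `n + 1`, as it is small at shorter words
      have key := conv_cons_sub_mem (𝓕 := tripleFiltration hp hω) (m := ⌊p⌋₊ + 1) (i := i) (w := w)
        (x := fun v q => a q.1.1 q.1.2.1 v) (y := fun v q => a q.1.2.1 q.1.2.2 v)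
        (x' := fun v q => Y q.1.1 q.1.2.1 v) (y' := fun v q => Y q.1.2.1 q.1.2.2 v)
        (fun v hv => mem_triple_left hp hω (f := fun s t => a s t v) (hb v hv))
        (fun v hv => mem_triple_right hp hω (f := fun s t => a s t v) (hb v hv))
        (fun v hv => mem_triple_left hp hω (f := fun s t => a s t v - Y s t v) (hd v hv))
        (fun v hv => mem_triple_right hp hω (f := fun s t => a s t v - Y s t v) (hd v hv))
        (by funext q; exact hY0 _ _) (by funext q; exact hY0 _ _)
      have key2 := (AddSubgroup.add_mem _ (hmul (i :: w) (by simp; omega)) key)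
      have e : ((fun q : Triples T => a q.1.1 q.1.2.2 (i :: w) -
          conv (a q.1.1 q.1.2.1) (a q.1.2.1 q.1.2.2) (i :: w)) +
          (conv (fun v (q : Triples T) => a q.1.1 q.1.2.1 v)
              (fun v q => a q.1.2.1 q.1.2.2 v) (i :: w) -
            (fun q => a q.1.1 q.1.2.1 (i :: w)) - (fun q => a q.1.2.1 q.1.2.2 (i :: w)) -
          (conv (fun v (q : Triples T) => Y q.1.1 q.1.2.1 v)
              (fun v q => Y q.1.2.1 q.1.2.2 v) (i :: w) -
            (fun q => Y q.1.1 q.1.2.1 (i :: w)) - (fun q => Y q.1.2.1 q.1.2.2 (i :: w))))) =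
          fun q : Triples T => (a q.1.1 q.1.2.2 (i :: w) - Y q.1.1 q.1.2.2 (i :: w)) -
            (a q.1.1 q.1.2.1 (i :: w) - Y q.1.1 q.1.2.1 (i :: w)) -
            (a q.1.2.1 q.1.2.2 (i :: w) - Y q.1.2.1 q.1.2.2 (i :: w)) := by
        funext q
        have e1 := map_conv (Pi.evalRingHom (fun _ : Triples T => ℝ) q)
          (fun v (q : Triples T) => a q.1.1 q.1.2.1 v) (fun v q => a q.1.2.1 q.1.2.2 v) (i :: w)
        have e2 := map_conv (Pi.evalRingHom (fun _ : Triples T => ℝ) q)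
          (fun v (q : Triples T) => Y q.1.1 q.1.2.1 v) (fun v q => Y q.1.2.1 q.1.2.2 v) (i :: w)
        simp only [Pi.evalRingHom_apply] at e1 e2
        simp only [Pi.add_apply, Pi.sub_apply, e1, e2]
        have e3 : conv (Y q.1.1 q.1.2.1) (Y q.1.2.1 q.1.2.2) = Y q.1.1 q.1.2.2 :=
          leftDiv_conv (hZ0 _) (hZ0 _)
        change _ - conv (a q.1.1 q.1.2.1) (a q.1.2.1 q.1.2.2) (i :: w) +
          (conv (a q.1.1 q.1.2.1) (a q.1.2.1 q.1.2.2) (i :: w) - _ - _ -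
          (conv (Y q.1.1 q.1.2.1) (Y q.1.2.1 q.1.2.2) (i :: w) - _ - _)) = _
        rw [e3]
        ring
      rw [e] at key2
      obtain ⟨C, hC⟩ := (mem_tripleFiltration hp hω (f := fun s u t =>
        (a s t (i :: w) - Y s t (i :: w)) - (a s u (i :: w) - Y s u (i :: w)) -
          (a u t (i :: w) - Y u t (i :: w)))).1 key2
      obtain ⟨φ, C', hφ⟩ := exists_path_of_almost_additive hω hT (one_lt_order_div hp)
        (abs_nonneg C) (Ξ := fun s t => a s t (i :: w) - Y s t (i :: w))
        (fun s u t h1 h2 h3 h4 => (hC s u t h1 h2 h3 h4).trans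
          (mul_le_mul_of_nonneg_right (le_abs_self C)
            (Real.rpow_nonneg (hω.nonneg s t h1 (h2.trans h3) h4) _)))
      exact ⟨φ, fun _ => ⟨C', hφ⟩⟩
    choose φ hφ using hφ
    -- adding a path in degree `n + 1` changes the increments of `Z` only from degree `n + 1` on
    set Z' : ℝ → List κ → ℝ := fun t v => if v.length = n + 1 then Z t v + φ v t else Z t v
      with hZ'
    have hZ'0 : ∀ t, Z' t [] = 1 := fun t => by simp [hZ', hZ0]
    have hlow : ∀ s t (v : List κ), v.length ≤ n → leftDiv (Z' s) (Z' t) v = Y s t v := by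
      intro s t v hv
      refine leftDiv_congr (fun u hu => ?_) (fun u hu => ?_) <;>
        exact if_neg (by omega)
    refine ⟨Z', hZ'0, fun w hw => ?_⟩
    rcases Nat.lt_or_ge w.length (n + 1) with h | h
    · simp only [hlow _ _ w (Nat.lt_succ_iff.1 h)]
      exact hZ w (Nat.lt_succ_iff.1 h)
    · have hwn : w.length = n + 1 := le_antisymm hw h
      have e : ∀ s t, leftDiv (Z' s) (Z' t) w = Y s t w + φ w t - φ w s := by
        intro s t
        obtain ⟨i, v, rfl⟩ : ∃ i v, w = i :: v := by
          cases w with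
          | nil => simp at hwn
          | cons i v => exact ⟨i, v, rfl⟩
        have hvn : v.length = n := by simpa using hwn
        have h1 := conv_cons_congr (x := Z' s) (x' := Z s) (y := leftDiv (Z' s) (Z' t))
          (y' := Y s t) (i := i) (w := v)
          (fun u hu => if_neg (by omega)) (fun u hu => hlow s t u (by omega)) (hZ'0 s)
          (hZ'0 t)
        rw [conv_leftDiv (hZ'0 s), hY, conv_leftDiv (hZ0 s)] at h1
        simp only [hZ', hwn, if_true] at h1 ⊢
        linarith
      simp only [e]
      obtain ⟨C, hC⟩ := hφ w hwn
      refine ⟨C, fun s t h1 h2 h3 => (congrArg norm ?_).trans_le (hC s t h1 h2 h3)⟩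
      beta_reduce
      ring

theorem isMultiplicative_leftDiv {Z : ℝ → List κ → ℝ} (hZ : ∀ t, Z t [] = 1) (N : ℕ) :
    IsMultiplicative T N (fun s t => leftDiv (Z s) (Z t)) :=
  ⟨fun _ _ _ _ _ => hZ _, fun s u _ _ _ _ _ w _ => congrFun (leftDiv_conv (hZ s) (hZ u)) w⟩

/-- Multiplicative functionals that agree up to order `⌊p⌋ + 1` are equal. -/
theorem IsMultiplicative.eq_of_isOrder (hp : 1 ≤ p) (hω : IsControl T ω)
    {Y Y' : ℝ → ℝ → List κ → ℝ} {N : ℕ} (hY : IsMultiplicative T N Y)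
    (hY' : IsMultiplicative T N Y') (h : ∀ w : List κ, w.length ≤ N →
      IsOrder p T ω (⌊p⌋₊ + 1) (fun s t => Y s t w - Y' s t w))
    {w : List κ} (hw : w.length ≤ N) {s t : ℝ} (hs : 0 ≤ s) (hst : s ≤ t) (ht : t ≤ T) :
    Y s t w = Y' s t w := by
  suffices H : ∀ n ≤ N, ∀ w : List κ, w.length ≤ n → ∀ s t, 0 ≤ s → s ≤ t → t ≤ T →
      Y s t w = Y' s t w from H _ le_rfl w hw s t hs hst ht
  intro n
  induction n with
  | zero =>
    intro _ w hw s t h1 h2 h3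
    obtain rfl : w = [] := by simpa using hw
    rw [hY.nil s t h1 h2 h3, hY'.nil s t h1 h2 h3]
  | succ n ih =>
    intro hn w hw s t h1 h2 h3
    cases w with
    | nil => exact ih (by omega) [] (by simp) s t h1 h2 h3
    | cons i w =>
      have hwn : w.length ≤ n := by simpa using hw
      have ih := ih (by omega)
      obtain ⟨C, hC⟩ := h (i :: w) (hw.trans hn)
      refine sub_eq_zero.1 (eq_zero_of_additive hω (one_lt_order_div hp)
        (d := fun s t => Y s t (i :: w) - Y' s t (i :: w)) ?_ hC h1 h2 h3)
      intro s u t h1 h2 h3 h4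
      -- by Chen's identity, as `Y` and `Y'` agree at shorter words
      have e := conv_cons_congr (x := Y s u) (x' := Y' s u) (y := Y u t) (y' := Y' u t) (i := i)
        (w := w) (fun v hv => ih v (hv.trans hwn) s u h1 h2 (h3.trans h4))
        (fun v hv => ih v (hv.trans hwn) u t (h1.trans h2) h3 h4)
        (hY.nil s u h1 h2 (h3.trans h4)) (hY.nil u t (h1.trans h2) h3 h4)
      rw [hY.chen s u t h1 h2 h3 h4 _ (hw.trans hn), hY'.chen s u t h1 h2 h3 h4 _ (hw.trans hn)]
        at e
      linarith

theorem continuousOn_leftDiv {α : Type*} [TopologicalSpace α] {S : Set α}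
    {x z : α → List κ → ℝ} {w : List κ}
    (hx : ∀ v : List κ, v.length ≤ w.length → ContinuousOn (fun q => x q v) S)
    (hz : ∀ v : List κ, v.length ≤ w.length → ContinuousOn (fun q => z q v) S) :
    ContinuousOn (fun q => leftDiv (x q) (z q) w) S := by
  induction w generalizing z with
  | nil => exact hz [] le_rfl
  | cons i w ih =>
    simp only [leftDiv_cons]
    refine ih (z := fun q => der i (z q) - z q [] • der i (x q))
      (fun v hv => hx v (hv.trans (by simp))) fun v hv => ?_
    have h1 : (i :: v).length ≤ (i :: w).length := by simpa using hv
    exact (hz _ h1).sub ((hz [] (by simp)).mul (hx _ h1))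

/-- A multiplicative functional that decays like a rough path is continuous. -/
theorem IsMultiplicative.continuousOn (hp : 1 ≤ p) (hω : IsControl T ω)
    {Y : ℝ → ℝ → List κ → ℝ} {N : ℕ} (hY : IsMultiplicative T N Y)
    (hd : ∀ w : List κ, w.length ≤ N → IsOrder p T ω w.length (fun s t => Y s t w))
    {w : List κ} (hw : w.length ≤ N) :
    ContinuousOn (fun q : ℝ × ℝ => Y q.1 q.2 w) {q | 0 ≤ q.1 ∧ q.1 ≤ q.2 ∧ q.2 ≤ T} := by
  have hcont : ∀ v : List κ, v.length ≤ N → ContinuousOn (fun t => Y 0 t v) (Set.Icc 0 T) := by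
    intro v hv
    refine continuousOn_of_isOrder_one hp hω ?_
    refine (mem_pairFiltration hp hω (f := fun s t => Y 0 t v - Y 0 s v)).1 ?_
    have hd' : ∀ w : List κ, w.length ≤ N → (fun q : Pairs T => Y q.1.1 q.1.2 w) ∈
        (pairFiltration hp hω).F w.length := fun w hw => (mem_pairFiltration hp hω).2 (hd w hw)
    have h0 : ∀ w : List κ, w.length ≤ N → (fun q : Pairs T => Y 0 q.1.1 w) ∈
        (pairFiltration hp hω).F 0 := by
      intro w hw
      obtain ⟨C, hC⟩ := hd w hw
      refine (mem_pairFiltration hp hω (f := fun s _ => Y 0 s w)).2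
        ⟨|C| * ω 0 T ^ ((w.length : ℝ) / p), fun s t h1 h2 h3 => ?_⟩
      have h4 := hω.nonneg 0 s le_rfl h1 (h2.trans h3)
      have h5 := hω.le_total le_rfl h1 (h2.trans h3)
      refine (hC 0 s le_rfl h1 (h2.trans h3)).trans ?_
      simp only [Nat.cast_zero, zero_div, Real.rpow_zero, mul_one]
      gcongr
      exact le_abs_self C
    have e : (fun q : Pairs T => Y 0 q.1.2 v - Y 0 q.1.1 v) =
        conv (fun w q => Y 0 q.1.1 w) (fun w (q : Pairs T) => Y q.1.1 q.1.2 w) v -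
          conv (fun w q => Y 0 q.1.1 w) WordSeries.unit v := by
      funext q
      have e1 := map_conv (Pi.evalRingHom (fun _ : Pairs T => ℝ) q)
        (fun w q => Y 0 q.1.1 w) (fun w (q : Pairs T) => Y q.1.1 q.1.2 w) v
      simp only [Pi.evalRingHom_apply] at e1
      rw [conv_unit, Pi.sub_apply, e1]
      exact congrArg (· - _) (hY.chen 0 q.1.1 q.1.2 le_rfl q.2.1 q.2.2.1 q.2.2.2 v hv).symm
    rw [e]
    refine conv_sub_conv_mem (fun u hu => (pairFiltration hp hω).anti (Nat.zero_le _)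
      (hd' u (hu.trans hv))) (fun u hu => h0 u (hu.trans hv))
      (fun u hu => by simp) fun u hu => ?_
    cases u with
    | nil =>
      convert (AddSubgroup.zero_mem _) using 1
      funext q
      simp [hY.nil _ _ q.2.1 q.2.2.1 q.2.2.2]
    | cons i u =>
      have := (pairFiltration hp hω).anti (by simp : 1 ≤ (i :: u).length) (hd' _ (hu.trans hv))
      simpa using this
  have h1 : ContinuousOn (fun q : ℝ × ℝ => leftDiv (Y 0 q.1) (Y 0 q.2) w)
      {q | 0 ≤ q.1 ∧ q.1 ≤ q.2 ∧ q.2 ≤ T} :=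
    continuousOn_leftDiv
      (fun v hv => (hcont v (hv.trans hw)).comp (f := fun q : ℝ × ℝ => q.1) (by fun_prop)
        fun q hq => ⟨hq.1, hq.2.1.trans hq.2.2⟩)
      (fun v hv => (hcont v (hv.trans hw)).comp (f := fun q : ℝ × ℝ => q.2) (by fun_prop)
        fun q hq => ⟨hq.1.trans hq.2.1, hq.2.2⟩)
  refine h1.congr fun q hq => ?_
  have h0 := hY.nil 0 q.1 le_rfl hq.1 (hq.2.1.trans hq.2.2)
  have e : leftDiv (Y 0 q.1) (conv (Y 0 q.1) (Y q.1 q.2)) = Y q.1 q.2 :=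
    conv_left_cancel h0 (conv_leftDiv h0 _)
  have e2 : leftDiv (Y 0 q.1) (Y 0 q.2) w = leftDiv (Y 0 q.1) (conv (Y 0 q.1) (Y q.1 q.2)) w :=
    leftDiv_congr (fun _ _ => rfl) fun v hv =>
      (hY.chen 0 q.1 q.2 le_rfl hq.1 hq.2.1 hq.2.2 v (hv.trans hw)).symm
  simp only
  rw [e2, e]

end GeomRough

namespace GeomRough

open WordSeries Filter Topology Set

variable {p T : ℝ} {ω : ℝ → ℝ → ℝ} {κ : Type*}

/-! ### Products along partitions -/

/-- The product `A_{τ₀τ₁} ⊗ ⋯ ⊗ A_{τ_{k-1}τ_k}`, in coordinates. -/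
def wordProd (A : ℝ → ℝ → List κ → ℝ) (τ : ℕ → ℝ) : ℕ → List κ → ℝ
  | 0 => WordSeries.unit
  | k + 1 => conv (wordProd A τ k) (A (τ k) (τ (k + 1)))

theorem abs_conv_le {x y : List κ → ℝ} {w : List κ} {a b : ℝ}
    (hx : ∀ v, v.length ≤ w.length → |x v| ≤ a) (hy : ∀ v, v.length ≤ w.length → |y v| ≤ b) :
    |conv x y w| ≤ (w.length + 1) * (a * b) := by
  have ha : 0 ≤ a := (abs_nonneg _).trans (hx [] (by simp))
  induction w generalizing y with
  | nil =>
    simp only [conv_nil, abs_mul, List.length_nil, Nat.cast_zero, zero_add, one_mul]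
    exact mul_le_mul (hx [] le_rfl) (hy [] le_rfl) (abs_nonneg _) ha
  | cons i w ih =>
    have h1 := ih (y := der i y) (fun v hv => hx v (hv.trans (by simp)))
      (fun v hv => hy (i :: v) (by simpa using hv))
    have h2 : |x (i :: w) * y []| ≤ a * b := by
      rw [abs_mul]
      exact mul_le_mul (hx _ le_rfl) (hy [] (by simp)) (abs_nonneg _) ha
    rw [conv_cons, List.length_cons]
    push_cast
    linarith [abs_add_le (x (i :: w) * y []) (conv x (der i y) w)]

theorem IsMultiplicative.self {Y : ℝ → ℝ → List κ → ℝ} {N : ℕ} (hY : IsMultiplicative T N Y)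
    {s : ℝ} (hs : 0 ≤ s) (hsT : s ≤ T) {w : List κ} (hw : w.length ≤ N) :
    Y s s w = WordSeries.unit w := by
  suffices H : ∀ n ≤ N, ∀ w : List κ, w.length ≤ n → Y s s w = WordSeries.unit w from
    H _ le_rfl w hw
  intro n
  induction n with
  | zero =>
    intro _ w hw
    obtain rfl : w = [] := by simpa using hw
    rw [hY.nil s s hs le_rfl hsT, unit_nil]
  | succ n ih =>
    intro hn w hw
    cases w with
    | nil => exact ih (by omega) [] (by simp)
    | cons i w =>
      have hwn : w.length ≤ n := by simpa using hw
      have ih := ih (by omega)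
      have e := conv_cons_congr (x := Y s s) (x' := WordSeries.unit) (y := Y s s)
        (y' := WordSeries.unit) (i := i) (w := w) (fun v hv => ih v (hv.trans hwn))
        (fun v hv => ih v (hv.trans hwn)) (hY.nil s s hs le_rfl hsT) (hY.nil s s hs le_rfl hsT)
      rw [hY.chen s s s hs le_rfl le_rfl hsT _ (hw.trans hn)] at e
      simp only [conv_unit, unit_cons] at e ⊢
      linarith

/-- The telescoping formula for the difference of the product of `A` along a partition and `Y`. -/
theorem wordProd_eq {A Y : ℝ → ℝ → List κ → ℝ} {N : ℕ} (hY : IsMultiplicative T N Y) {τ : ℕ → ℝ}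
    (hτ : Monotone τ) (h0 : 0 ≤ τ 0) {k : ℕ} (hk : τ k ≤ T) {w : List κ} (hw : w.length ≤ N) :
    wordProd A τ k w = Y (τ 0) (τ k) w + ∑ i ∈ Finset.range k,
      conv (conv (wordProd A τ i) (A (τ i) (τ (i + 1)) - Y (τ i) (τ (i + 1))))
        (Y (τ (i + 1)) (τ k)) w := by
  induction k generalizing w with
  | zero => simp [wordProd, hY.self h0 hk hw]
  | succ k ih =>
    have hk' : τ k ≤ T := (hτ (Nat.le_succ k)).trans hk
    have h0k : ∀ i, 0 ≤ τ i := fun i => h0.trans (hτ (Nat.zero_le i))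
    have e1 : wordProd A τ (k + 1) w =
        conv (wordProd A τ k) (Y (τ k) (τ (k + 1))) w +
          conv (wordProd A τ k) (A (τ k) (τ (k + 1)) - Y (τ k) (τ (k + 1))) w := by
      rw [wordProd, conv_sub_right]
      simp
    have e2 : conv (wordProd A τ k) (Y (τ k) (τ (k + 1))) w =
        Y (τ 0) (τ (k + 1)) w + ∑ i ∈ Finset.range k,
          conv (conv (wordProd A τ i) (A (τ i) (τ (i + 1)) - Y (τ i) (τ (i + 1))))
            (Y (τ (i + 1)) (τ (k + 1))) w := by
      have e3 : conv (wordProd A τ k) (Y (τ k) (τ (k + 1))) w =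
          conv (Y (τ 0) (τ k) + ∑ i ∈ Finset.range k,
            conv (conv (wordProd A τ i) (A (τ i) (τ (i + 1)) - Y (τ i) (τ (i + 1))))
              (Y (τ (i + 1)) (τ k))) (Y (τ k) (τ (k + 1))) w :=
        conv_congr (fun v hv => by
          rw [ih hk' (hv.trans hw), Pi.add_apply, Finset.sum_apply]) (fun _ _ => rfl)
      rw [e3, conv_add_left, conv_sum_left, Pi.add_apply, Finset.sum_apply,
        hY.chen _ _ _ h0 (hτ (Nat.zero_le k)) (hτ (Nat.le_succ k)) hk w hw]
      congr 1
      refine Finset.sum_congr rfl fun i hi => ?_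
      rw [conv_assoc]
      exact conv_congr (fun _ _ => rfl) fun v hv => hY.chen _ _ _ (h0k _)
        (hτ (Finset.mem_range.1 hi)) (hτ (Nat.le_succ k)) hk v (hv.trans hw)
    have e4 : conv (conv (wordProd A τ k) (A (τ k) (τ (k + 1)) - Y (τ k) (τ (k + 1))))
        (Y (τ (k + 1)) (τ (k + 1))) w =
        conv (wordProd A τ k) (A (τ k) (τ (k + 1)) - Y (τ k) (τ (k + 1))) w := by
      conv_rhs => rw [← conv_unit (conv (wordProd A τ k) _)]
      exact conv_congr (fun _ _ => rfl) fun v hv => hY.self (h0k _) hk (hv.trans hw)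
    rw [e1, e2, Finset.sum_range_succ, e4, add_assoc]

theorem exists_forall_words [Finite κ] {N : ℕ} {P : List κ → ℝ → Prop}
    (hP : ∀ w C D, C ≤ D → P w C → P w D) (h : ∀ w : List κ, w.length ≤ N → ∃ C, P w C) :
    ∃ C, 0 ≤ C ∧ ∀ w : List κ, w.length ≤ N → P w C := by
  classical
  choose! C hC using h
  set S := (List.finite_length_le κ N).toFinset
  refine ⟨∑ w ∈ S, |C w|, Finset.sum_nonneg fun _ _ => abs_nonneg _, fun w hw => ?_⟩
  refine hP w _ _ ((le_abs_self _).trans ?_) (hC w hw)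
  exact Finset.single_le_sum (f := fun w => |C w|) (fun _ _ => abs_nonneg _)
    (by simpa [S] using hw)

/-- A control is small on short intervals. -/
theorem IsControl.exists_mesh (hω : IsControl T ω) {η : ℝ} (hη : 0 < η) :
    ∃ δ > 0, ∀ s t, 0 ≤ s → s ≤ t → t ≤ T → t - s < δ → ω s t ≤ η := by
  have hcomp : IsCompact {q : ℝ × ℝ | 0 ≤ q.1 ∧ q.1 ≤ q.2 ∧ q.2 ≤ T} := by
    refine (isCompact_Icc (a := ((0, 0) : ℝ × ℝ)) (b := (T, T))).of_isClosed_subset ?_ ?_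
    · exact (isClosed_le continuous_const continuous_fst).inter
        ((isClosed_le continuous_fst continuous_snd).inter
          (isClosed_le continuous_snd continuous_const))
    · rintro ⟨a, b⟩ ⟨h1, h2, h3⟩
      exact ⟨⟨h1, h1.trans h2⟩, ⟨h2.trans h3, h3⟩⟩
  have huc := hcomp.uniformContinuousOn_of_continuous hω.continuousOn
  obtain ⟨δ, hδ, h⟩ := Metric.uniformContinuousOn_iff.1 huc η hη
  refine ⟨δ, hδ, fun s t h1 h2 h3 h4 => ?_⟩
  have := h (s, t) ⟨h1, h2, h3⟩ (s, s) ⟨h1, le_rfl, h2.trans h3⟩ (by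
    rw [Prod.dist_eq, dist_self, Real.dist_eq, abs_of_nonneg (by simpa using h2)]
    exact max_lt hδ h4)
  rw [hω.diag s h1 (h2.trans h3), Real.dist_eq, sub_zero] at this
  exact (le_abs_self _).trans this.le

theorem IsControl.sum_le (hω : IsControl T ω) {τ : ℕ → ℝ} (hτ : Monotone τ) (h0 : 0 ≤ τ 0) {k : ℕ}
    (hk : τ k ≤ T) : ∑ i ∈ Finset.range k, ω (τ i) (τ (i + 1)) ≤ ω (τ 0) (τ k) := by
  induction k with
  | zero => simp [hω.diag _ h0 hk]
  | succ k ih =>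
    rw [Finset.sum_range_succ]
    have h1 := ih ((hτ (Nat.le_succ k)).trans hk)
    have h2 := hω.superadd _ _ _ h0 (hτ (Nat.zero_le k)) (hτ (Nat.le_succ k)) hk
    linarith

/-- If `A` is close to the multiplicative functional `Y`, then the products of `A` along partitions
converge to `Y`, uniformly, as the mesh tends to zero. -/
theorem exists_mesh_wordProd [Finite κ] (hp : 1 ≤ p) (hω : IsControl T ω) (hT : 0 ≤ T)
    {A Y : ℝ → ℝ → List κ → ℝ} (hY : IsMultiplicative T ⌊p⌋₊ Y)
    (hYb : ∀ w : List κ, w.length ≤ ⌊p⌋₊ → IsOrder p T ω 0 (fun s t => Y s t w))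
    (hA0 : ∀ s t, 0 ≤ s → s ≤ t → t ≤ T → A s t [] = 1)
    (hAY : ∀ w : List κ, w.length ≤ ⌊p⌋₊ →
      IsOrder p T ω (⌊p⌋₊ + 1) (fun s t => A s t w - Y s t w)) {ε : ℝ} (hε : 0 < ε) :
    ∃ δ > 0, ∀ (k : ℕ) (τ : ℕ → ℝ), Monotone τ → 0 ≤ τ 0 → τ k ≤ T →
      (∀ i < k, τ (i + 1) - τ i < δ) → ∀ w : List κ, w.length ≤ ⌊p⌋₊ →
        |wordProd A τ k w - Y (τ 0) (τ k) w| < ε := by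
  set N := ⌊p⌋₊ with hN
  obtain ⟨B, hB0, hB⟩ := exists_forall_words (N := N) (P := fun w C => ∀ s t, 0 ≤ s → s ≤ t →
    t ≤ T → |Y s t w| ≤ C) (fun w C D hCD h s t h1 h2 h3 => (h s t h1 h2 h3).trans hCD)
    (fun w hw => by
      obtain ⟨C, hC⟩ := hYb w hw
      exact ⟨C, fun s t h1 h2 h3 => by simpa using hC s t h1 h2 h3⟩)
  set θ : ℝ := ((N + 1 : ℕ) : ℝ) / p with hθ_def
  have hθ : 1 < θ := one_lt_order_div hp
  obtain ⟨C, hC0, hC⟩ := exists_forall_words (N := N) (P := fun w C => ∀ s t, 0 ≤ s → s ≤ t →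
    t ≤ T → |A s t w - Y s t w| ≤ C * ω s t ^ θ)
    (fun w C D hCD h s t h1 h2 h3 => (h s t h1 h2 h3).trans
      (mul_le_mul_of_nonneg_right hCD (Real.rpow_nonneg (hω.nonneg s t h1 h2 h3) _)))
    (fun w hw => hAY w hw)
  suffices H : ∀ n ≤ N, ∀ ε > 0, ∃ δ > 0, ∀ (k : ℕ) (τ : ℕ → ℝ), Monotone τ → 0 ≤ τ 0 →
      τ k ≤ T → (∀ i < k, τ (i + 1) - τ i < δ) → ∀ w : List κ, w.length ≤ n →
        |wordProd A τ k w - Y (τ 0) (τ k) w| < ε from H N le_rfl ε hε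
  intro n
  induction n with
  | zero =>
    intro _ ε hε
    refine ⟨1, one_pos, fun k τ hτ h0 hk hmesh w hw => ?_⟩
    obtain rfl : w = [] := by simpa using hw
    have h1 : wordProd A τ k [] = 1 := by
      clear hw
      induction k with
      | zero => rfl
      | succ k ih =>
        rw [wordProd, conv_nil, ih ((hτ (Nat.le_succ k)).trans hk)
            fun i hi => hmesh i (hi.trans k.lt_succ_self),
          hA0 _ _ (h0.trans (hτ (Nat.zero_le k))) (hτ (Nat.le_succ k)) hk, mul_one]
    rw [h1, hY.nil _ _ h0 (hτ (Nat.zero_le k)) hk, sub_self, abs_zero]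
    exact hε
  | succ n ih =>
    intro hn ε hε
    obtain ⟨δ₁, hδ₁, H₁⟩ := ih (by omega) 1 one_pos
    -- every term of the telescoping sum is at most `K * ω ^ θ`
    set K : ℝ := ((n + 1 : ℕ) + 1) * ((((n : ℕ) + 1) * ((B + 1) * C)) * B) with hK
    have hK0 : 0 ≤ K := by positivity
    have hΩ : 0 ≤ ω 0 T := hω.nonneg 0 T le_rfl hT le_rfl
    obtain ⟨η, hη, hηε⟩ : ∃ η > 0, K * (η ^ (θ - 1) * ω 0 T) < ε := by
      have lim : Tendsto (fun η : ℝ => K * (η ^ (θ - 1) * ω 0 T)) (𝓝[>] 0) (𝓝 0) := by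
        have h1 : Tendsto (fun η : ℝ => K * (η ^ (θ - 1) * ω 0 T)) (𝓝 0)
            (𝓝 (K * ((0 : ℝ) ^ (θ - 1) * ω 0 T))) :=
          ((Real.continuousAt_rpow_const 0 (θ - 1) (Or.inr (by linarith))).tendsto.mul_const
            _).const_mul _
        rw [Real.zero_rpow (by linarith), zero_mul, mul_zero] at h1
        exact h1.mono_left nhdsWithin_le_nhds
      obtain ⟨η, h1, h2⟩ := ((lim.eventually (gt_mem_nhds hε)).and self_mem_nhdsWithin).exists
      exact ⟨η, h2, h1⟩
    obtain ⟨δ₂, hδ₂, H₂⟩ := hω.exists_mesh hη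
    refine ⟨min δ₁ δ₂, lt_min hδ₁ hδ₂, fun k τ hτ h0 hk hmesh w hw => ?_⟩
    have h0i : ∀ i, 0 ≤ τ i := fun i => h0.trans (hτ (Nat.zero_le i))
    have hwN : w.length ≤ N := hw.trans hn
    rw [wordProd_eq hY hτ h0 hk hwN, add_sub_cancel_left]
    refine (Finset.abs_sum_le_sum_abs _ _).trans_lt ?_
    have term : ∀ i ∈ Finset.range k, |conv (conv (wordProd A τ i)
        (A (τ i) (τ (i + 1)) - Y (τ i) (τ (i + 1)))) (Y (τ (i + 1)) (τ k)) w| ≤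
        K * (η ^ (θ - 1) * ω (τ i) (τ (i + 1))) := by
      intro i hi
      have hik : i < k := Finset.mem_range.1 hi
      have hi1 : τ (i + 1) ≤ T := (hτ hik).trans hk
      have hωi := hω.nonneg _ _ (h0i i) (hτ (Nat.le_succ i)) hi1
      set r := A (τ i) (τ (i + 1)) - Y (τ i) (τ (i + 1)) with hr
      set x := ω (τ i) (τ (i + 1)) ^ θ with hx
      have hx0 : 0 ≤ x := Real.rpow_nonneg hωi _
      have hQ : ∀ v : List κ, v.length ≤ n → |wordProd A τ i v| ≤ B + 1 := by
        intro v hv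
        have h1 := H₁ i τ hτ h0 ((hτ (Nat.le_succ i)).trans hi1)
          (fun l hl => (hmesh l (hl.trans hik)).trans_le (min_le_left _ _)) v hv
        have h2 := hB v (by omega) (τ 0) (τ i) h0 (hτ (Nat.zero_le i))
          ((hτ (Nat.le_succ i)).trans hi1)
        have h3 := abs_sub_abs_le_abs_sub (wordProd A τ i v) (Y (τ 0) (τ i) v)
        linarith
      have hr1 : ∀ v : List κ, v.length ≤ N → |r v| ≤ C * x := fun v hv =>
        hC v hv _ _ (h0i i) (hτ (Nat.le_succ i)) hi1
      have hr0 : r [] = 0 := by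
        simp [hr, hA0 _ _ (h0i i) (hτ (Nat.le_succ i)) hi1,
          hY.nil _ _ (h0i i) (hτ (Nat.le_succ i)) hi1]
      -- the empty word does not contribute to the factor `r`
      have hconv : ∀ v : List κ, v.length ≤ n + 1 →
          |conv (wordProd A τ i) r v| ≤ ((n : ℕ) + 1) * ((B + 1) * C) * x := by
        intro v hv
        cases v with
        | nil =>
          rw [conv_nil, hr0, mul_zero, abs_zero]
          positivity
        | cons j v =>
          have hvn : v.length ≤ n := by simpa using hv
          rw [conv_cons, hr0, mul_zero, zero_add]
          have h1 := abs_conv_le (x := wordProd A τ i) (y := der j r) (w := v) (a := B + 1)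
            (b := C * x) (fun u hu => hQ u (hu.trans hvn))
            (fun u hu => hr1 _ (by simp only [List.length_cons]; omega))
          refine h1.trans ?_
          have : ((v.length : ℝ) + 1) ≤ (n : ℝ) + 1 := by exact_mod_cast Nat.succ_le_succ hvn
          calc ((v.length : ℝ) + 1) * ((B + 1) * (C * x)) ≤
              ((n : ℝ) + 1) * ((B + 1) * (C * x)) := by gcongr
            _ = _ := by ring
      have h2 := abs_conv_le (x := conv (wordProd A τ i) r) (y := Y (τ (i + 1)) (τ k)) (w := w)
        (fun u hu => hconv u (hu.trans hw))
        (fun u hu => hB u (hu.trans hwN) _ _ (h0i _) (hτ hik) hk)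
      refine h2.trans ?_
      have h3 : ((w.length : ℝ) + 1) ≤ ((n + 1 : ℕ) : ℝ) + 1 := by
        exact_mod_cast Nat.succ_le_succ hw
      have h4 : x ≤ η ^ (θ - 1) * ω (τ i) (τ (i + 1)) := by
        rcases eq_or_lt_of_le hωi with h | h
        · rw [hx, ← h, Real.zero_rpow (by linarith), mul_zero]
        · have h5 := H₂ _ _ (h0i i) (hτ (Nat.le_succ i)) hi1
            ((hmesh i hik).trans_le (min_le_right _ _))
          have h6 : x = ω (τ i) (τ (i + 1)) ^ (θ - 1) * ω (τ i) (τ (i + 1)) := by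
            rw [hx, ← Real.rpow_add_one h.ne']
            congr 1
            ring
          rw [h6]
          refine mul_le_mul_of_nonneg_right ?_ hωi
          exact Real.rpow_le_rpow hωi h5 (by linarith)
      calc ((w.length : ℝ) + 1) * (((n : ℕ) + 1) * ((B + 1) * C) * x * B) ≤
          (((n + 1 : ℕ) : ℝ) + 1) * (((n : ℕ) + 1) * ((B + 1) * C) * x * B) := by gcongr
        _ = K * x := by rw [hK]; ring
        _ ≤ _ := mul_le_mul_of_nonneg_left h4 hK0
    refine (Finset.sum_le_sum term).trans_lt ?_
    rw [← Finset.mul_sum, ← Finset.mul_sum]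
    refine lt_of_le_of_lt ?_ hηε
    have h7 := (hω.sum_le hτ h0 hk).trans (hω.le_total h0 (hτ (Nat.zero_le k)) hk)
    have h8 := Real.rpow_nonneg hη.le (θ - 1)
    gcongr

/-! ### Multiplicative functionals that are almost characters are characters -/

section Character

variable [Fintype κ]

/-- The failure of `x` to be multiplicative on a pair of functions. -/
def characterDefect (N : ℕ) (x f g : List κ → ℝ) : ℝ :=
  pairing N x f * pairing N x g - pairing N x (shuffle f g)

theorem pairing_conv_of_degree {N : ℕ} {x y f : List κ → ℝ}
    (hf : ∀ w, N + 1 ≤ w.length → f w = 0) :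
    pairing N (conv x y) f = pairing N y (leftTranslate N x f) := by
  rw [pairing_conv]
  refine pairing_congr (fun _ _ => rfl) fun w hw => ?_
  refine (pairing_eq_of_le (Nat.sub_le _ _) fun u hu => hf _ ?_).symm
  rw [List.length_append]
  omega

theorem leftTranslate_eq_zero {N a : ℕ} {x f : List κ → ℝ} (hf : ∀ w, a ≤ w.length → f w = 0) :
    ∀ w, a ≤ w.length → leftTranslate N x f w = 0 := by
  intro w hw
  have : (fun u => f (w ++ u)) = 0 := funext fun u => hf _ (by rw [List.length_append]; omega)
  rw [leftTranslate, this, pairing_zero_right]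

/-- If `x` is multiplicative in total degrees less than `n`, then so is the translation by it. -/
theorem leftTranslate_shuffle_of_defect {N n : ℕ} {x : List κ → ℝ}
    (hx : ∀ a b, a + b ≤ n → ∀ f g : List κ → ℝ, (∀ w, a ≤ w.length → f w = 0) →
      (∀ w, b ≤ w.length → g w = 0) → characterDefect N x f g = 0)
    {a b : ℕ} (hab : a + b ≤ n) {f g : List κ → ℝ} (hf : ∀ w, a ≤ w.length → f w = 0)
    (hg : ∀ w, b ≤ w.length → g w = 0) :
    leftTranslate N x (shuffle f g) = shuffle (leftTranslate N x f) (leftTranslate N x g) := by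
  funext w
  induction w generalizing f g with
  | nil => exact (sub_eq_zero.1 (hx a b hab f g hf hg)).symm
  | cons i w ih =>
    have e : leftTranslate N x (shuffle f g) (i :: w) =
        leftTranslate N x (shuffle (der i f) g) w + leftTranslate N x (shuffle f (der i g)) w := by
      rw [← Pi.add_apply, ← leftTranslate_add, ← der_shuffle, ← der_leftTranslate, der_apply]
    rw [e, shuffle_cons, der_leftTranslate, der_leftTranslate,
      ih (f := der i f) (fun v hv => hf _ (by simp only [List.length_cons]; omega)) hg,
      ih (g := der i g) hf (fun v hv => hg _ (by simp only [List.length_cons]; omega))]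

theorem characterDefect_add_left (N : ℕ) (x f f' g : List κ → ℝ) :
    characterDefect N x (f + f') g = characterDefect N x f g + characterDefect N x f' g := by
  simp only [characterDefect, shuffle_add_left, pairing_add_right]
  ring

theorem characterDefect_add_right (N : ℕ) (x f g g' : List κ → ℝ) :
    characterDefect N x f (g + g') = characterDefect N x f g + characterDefect N x f g' := by
  simp only [characterDefect, shuffle_add_right, pairing_add_right]
  ring

/-- The translation of `f` has the same top-degree part as `f`. -/
theorem leftTranslate_sub_self_eq_zero {N a : ℕ} {x f : List κ → ℝ} (hx : x [] = 1)
    (hf : ∀ w, a + 1 ≤ w.length → f w = 0) :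
    ∀ w, a ≤ w.length → (leftTranslate N x f - f) w = 0 := by
  intro w hw
  rw [Pi.sub_apply, leftTranslate, pairing_eq_of_le (Nat.zero_le N) fun u hu => hf _ ?_]
  · simp [pairing_zero, hx]
  · rw [List.length_append]
    omega

/-- A multiplicative functional that is a character up to order `⌊p⌋ + 1` is a character: by
induction on the degree, the defect is additive, and it is of order larger than one. -/
theorem IsMultiplicative.isCharacter (hp : 1 ≤ p) (hω : IsControl T ω) {Y : ℝ → ℝ → List κ → ℝ}
    (hY : IsMultiplicative T ⌊p⌋₊ Y)
    (hd : ∀ f g : List κ → ℝ,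
      IsOrder p T ω (⌊p⌋₊ + 1) (fun s t => characterDefect ⌊p⌋₊ (Y s t) f g))
    {s t : ℝ} (hs : 0 ≤ s) (hst : s ≤ t) (ht : t ≤ T) : IsCharacter ⌊p⌋₊ (Y s t) := by
  set N := ⌊p⌋₊ with hN
  -- `f` is supported in degrees less than `a`, and `g` in degrees less than `b`
  have key : ∀ n ≤ N + 2, ∀ a b, a + b ≤ n → ∀ f g : List κ → ℝ, (∀ w, a ≤ w.length → f w = 0) →
      (∀ w, b ≤ w.length → g w = 0) → ∀ s t, 0 ≤ s → s ≤ t → t ≤ T →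
        characterDefect N (Y s t) f g = 0 := by
    intro n
    induction n with
    | zero =>
      intro _ a b hab f g hf _ s t _ _ _
      have : f = 0 := funext fun w => hf w (by omega)
      simp [characterDefect, this]
    | succ n ih =>
      intro hn a b hab f g hf hg s t hs hst ht
      have ih := ih (by omega)
      rcases Nat.eq_zero_or_pos a with rfl | ha
      · have : f = 0 := funext fun w => hf w (by omega)
        simp [characterDefect, this]
      rcases Nat.eq_zero_or_pos b with rfl | hb
      · have : g = 0 := funext fun w => hg w (by omega)
        simp [characterDefect, this]
      obtain ⟨a, rfl⟩ : ∃ a', a = a' + 1 := ⟨a - 1, by omega⟩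
      obtain ⟨b, rfl⟩ : ∃ b', b = b' + 1 := ⟨b - 1, by omega⟩
      obtain ⟨C, hC⟩ := hd f g
      refine eq_zero_of_additive hω (one_lt_order_div hp)
        (d := fun s t => characterDefect N (Y s t) f g) ?_ hC hs hst ht
      intro s u t h1 h2 h3 h4
      set x := Y s u
      set y := Y u t
      have hx0 : x [] = 1 := hY.nil s u h1 h2 (h3.trans h4)
      have hy0 : y [] = 1 := hY.nil u t (h1.trans h2) h3 h4
      have hx : ∀ a b, a + b ≤ n → ∀ f g : List κ → ℝ, (∀ w, a ≤ w.length → f w = 0) →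
          (∀ w, b ≤ w.length → g w = 0) → characterDefect N x f g = 0 :=
        fun a b hab f g hf hg => ih a b hab f g hf hg s u h1 h2 (h3.trans h4)
      have hy : ∀ a b, a + b ≤ n → ∀ f g : List κ → ℝ, (∀ w, a ≤ w.length → f w = 0) →
          (∀ w, b ≤ w.length → g w = 0) → characterDefect N y f g = 0 :=
        fun a b hab f g hf hg => ih a b hab f g hf hg u t (h1.trans h2) h3 h4
      have e1 : ∀ f : List κ → ℝ, (∀ w, N + 1 ≤ w.length → f w = 0) →
          pairing N (Y s t) f = pairing N y (leftTranslate N x f) := by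
        intro f hf
        rw [← pairing_conv_of_degree hf]
        exact pairing_congr (fun w hw => (hY.chen s u t h1 h2 h3 h4 w hw).symm) fun _ _ => rfl
      have hfN : ∀ w, N + 1 ≤ w.length → f w = 0 := fun w hw => hf w (by omega)
      have hgN : ∀ w, N + 1 ≤ w.length → g w = 0 := fun w hw => hg w (by omega)
      have hfgN : ∀ w, N + 1 ≤ w.length → shuffle f g w = 0 := fun w hw =>
        shuffle_eq_zero_of_le hf hg w (by omega)
      -- by induction, the translation by `x` fails to be multiplicative only at the empty word
      have e2 : leftTranslate N x (shuffle f g) =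
          shuffle (leftTranslate N x f) (leftTranslate N x g) -
          characterDefect N x f g • WordSeries.unit := by
        funext w
        cases w with
        | nil => simp [characterDefect]
        | cons i w =>
          have e : leftTranslate N x (shuffle f g) (i :: w) =
              leftTranslate N x (shuffle (der i f) g) w +
                leftTranslate N x (shuffle f (der i g)) w := by
            rw [← Pi.add_apply, ← leftTranslate_add, ← der_shuffle, ← der_leftTranslate, der_apply]
          have e5 := leftTranslate_shuffle_of_defect hx (a := a) (b := b + 1) (f := der i f)
            (g := g)
            (by omega) (fun v hv => hf _ (by simpa using hv)) hg
          have e6 := leftTranslate_shuffle_of_defect hx (a := a + 1) (b := b) (f := f)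
            (g := der i g) (by omega) hf (fun v hv => hg _ (by simpa using hv))
          rw [e, e5, e6, Pi.sub_apply, shuffle_cons, der_leftTranslate, der_leftTranslate]
          simp
      set f' := leftTranslate N x f - f with hf'
      set g' := leftTranslate N x g - g with hg'
      -- `f'` and `g'` have lower degree than `f` and `g`
      have z1 : characterDefect N y f' (leftTranslate N x g) = 0 :=
        hy a (b + 1) (by omega) _ _ (leftTranslate_sub_self_eq_zero hx0 hf)
          (leftTranslate_eq_zero hg)
      have z2 : characterDefect N y f g' = 0 :=
        hy (a + 1) b (by omega) _ _ hf (leftTranslate_sub_self_eq_zero hx0 hg)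
      have e3 : characterDefect N y (leftTranslate N x f) (leftTranslate N x g) =
          characterDefect N y f g := by
        have h5 : leftTranslate N x f = f + f' := by rw [hf']; abel
        have h6 : leftTranslate N x g = g + g' := by rw [hg']; abel
        conv_lhs => rw [h5, characterDefect_add_left, z1, add_zero, h6,
          characterDefect_add_right, z2, add_zero]
      have e4 : characterDefect N (Y s t) f g =
          characterDefect N y (leftTranslate N x f) (leftTranslate N x g) +
            characterDefect N x f g := by
        unfold characterDefect at e2 ⊢
        rw [e1 f hfN, e1 g hgN, e1 _ hfgN, e2, pairing_sub_right, pairing_smul_right,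
          pairing_unit_right, hy0]
        ring
      rw [e4, e3, add_comm]
  refine ⟨hY.nil s t hs hst ht, fun i j hij f g => ?_⟩
  have hg1 : ∀ (n : ℕ), n ≤ N → ∀ (h : List κ → ℝ),
      (∀ w, w.length ≠ n → h w = 0) → pairing N (Y s t) h = gradedPairing n (Y s t) h := by
    intro n hn h hh
    exact Finset.sum_eq_single_of_mem _ (Finset.mem_range.2 (by omega)) fun m _ hm =>
      gradedPairing_eq_zero fun w hw => hh w (by omega)
  have hg2 : ∀ (n : ℕ) (h : List κ → ℝ),
      gradedPairing n (Y s t) (component n h) = gradedPairing n (Y s t) h := fun n h =>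
    gradedPairing_congr (fun _ _ => rfl) fun w hw => if_pos hw
  have := key (N + 2) le_rfl (i + 1) (j + 1) (by omega) (component i f) (component j g)
    (fun w hw => if_neg (by omega)) (fun w hw => if_neg (by omega)) s t hs hst ht
  rw [characterDefect, hg1 i (by omega) (component i f) (fun w hw => if_neg hw),
    hg1 j (by omega) (component j g) (fun w hw => if_neg hw), hg2, hg2,
    hg1 (i + j) hij _ (fun w hw => shuffle_component_eq_zero hw)] at this
  exact sub_eq_zero.1 this

end Character

end GeomRough

namespace GeomRough

open WordSeries Filter Topology Set

variable {p T : ℝ} {ω : ℝ → ℝ → ℝ} {ι κ ν : Type*}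

/-! ### Rough paths and controlled paths in coordinates -/

section Bounded

variable {J : ℝ → List ι → ℝ}

theorem hasOrder_left (hp : 1 ≤ p) (hω : IsControl T ω)
    (hJ : ∀ w, ∃ C, ∀ t, 0 ≤ t → t ≤ T → |J t w| ≤ C) :
    HasOrder (pairFiltration hp hω) 0 (fun w (q : Pairs T) => J q.1.1 w) := fun w => by
  obtain ⟨C, hC⟩ := hJ w
  rw [Nat.zero_sub]
  exact (mem_pairFiltration hp hω (f := fun s _ => J s w)).2
    ⟨C, fun s t h1 h2 h3 => by simpa using hC s h1 (h2.trans h3)⟩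

theorem hasOrder_right (hp : 1 ≤ p) (hω : IsControl T ω)
    (hJ : ∀ w, ∃ C, ∀ t, 0 ≤ t → t ≤ T → |J t w| ≤ C) :
    HasOrder (pairFiltration hp hω) 0 (fun w (q : Pairs T) => J q.1.2 w) := fun w => by
  obtain ⟨C, hC⟩ := hJ w
  rw [Nat.zero_sub]
  exact (mem_pairFiltration hp hω (f := fun _ t => J t w)).2
    ⟨C, fun s t h1 h2 h3 => by simpa using hC t (h1.trans h2) h3⟩

end Bounded

theorem compose_pi [Fintype κ] {α : Type*} {G : List κ → α → ℝ} {h : κ → List ι → α → ℝ}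
    (w : List ι) (q : α) :
    compose G h w q = compose (fun v => G v q) (fun j v => h j v q) w :=
  map_compose (Pi.evalRingHom (fun _ : α => ℝ) q) G h w

theorem shuffle_pi {α : Type*} {f g : List ι → α → ℝ} (w : List ι) (q : α) :
    shuffle f g w q = shuffle (fun v => f v q) (fun v => g v q) w :=
  map_shuffle (Pi.evalRingHom (fun _ : α => ℝ) q) f g w

theorem conv_pi {α : Type*} {f g : List ι → α → ℝ} (w : List ι) (q : α) :
    conv f g w q = conv (fun v => f v q) (fun v => g v q) w :=
  map_conv (Pi.evalRingHom (fun _ : α => ℝ) q) f g w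

variable [Fintype ι]

/-- A weakly geometric rough path, in coordinates. -/
structure IsWordRough (p T : ℝ) (ω : ℝ → ℝ → ℝ) (x : ℝ → ℝ → List ι → ℝ) : Prop where
  mult : IsMultiplicative T ⌊p⌋₊ x
  order : ∀ w : List ι, w.length ≤ ⌊p⌋₊ → IsOrder p T ω w.length (fun s t => x s t w)
  character : ∀ s t, 0 ≤ s → s ≤ t → t ≤ T → IsCharacter ⌊p⌋₊ (x s t)

/-- A family of functions on words that is controlled by `x` with remainders of order `M - |w|`.
For a controlled path `M = ⌊p⌋`; the integrals of controlled paths are controlled with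
`M = ⌊p⌋ + 1`. -/
structure IsWordControlled (p T : ℝ) (ω : ℝ → ℝ → ℝ) (M : ℕ) (x : ℝ → ℝ → List ι → ℝ)
    (J : ℝ → List ι → ℝ) : Prop where
  bounded : ∀ w, ∃ C, ∀ t, 0 ≤ t → t ≤ T → |J t w| ≤ C
  expansion : ∀ w, IsOrder p T ω (M - w.length)
    (fun s t => J t w - leftTranslate ⌊p⌋₊ (x s t) (J s) w)

section Filtered

variable {x : ℝ → ℝ → List ι → ℝ} {J : ℝ → List ι → ℝ} {M : ℕ}

theorem IsWordRough.decays (hp : 1 ≤ p) (hω : IsControl T ω) (hx : IsWordRough p T ω x) :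
    Decays (pairFiltration hp hω) ⌊p⌋₊ (fun w (q : Pairs T) => x q.1.1 q.1.2 w) := fun w hw =>
  (mem_pairFiltration hp hω).2 (hx.order w hw)

/-- Characters of the shuffle algebra with coefficients in a ring of functions. -/
theorem isCharacter_pi {α : Type*} {N : ℕ} {x : List ι → α → ℝ}
    (hx : ∀ q, IsCharacter N (fun w => x w q)) : IsCharacter N x where
  nil := funext fun q => (hx q).nil
  mul := by
    intro i j hij f g
    funext q
    have h1 := map_gradedPairing (ι := ι) (Pi.evalRingHom (fun _ : α => ℝ) q)
    have h2 := map_shuffle (ι := ι) (Pi.evalRingHom (fun _ : α => ℝ) q)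
    simp only [Pi.evalRingHom_apply] at h1 h2
    have h3 : ∀ (n : ℕ) (f : List ι → α → ℝ), (fun v => component n f v q) =
        component n (fun v => f v q) := by
      intro n f
      funext v
      simp only [component]
      split_ifs <;> rfl
    rw [Pi.mul_apply, h1, h1, h1]
    simp only [h2, h3]
    exact (hx q).mul i j hij _ _

theorem IsWordRough.isCharacter (hx : IsWordRough p T ω x) :
    IsCharacter ⌊p⌋₊ (fun w (q : Pairs T) => x q.1.1 q.1.2 w) :=
  isCharacter_pi fun q => hx.character _ _ q.2.1 q.2.2.1 q.2.2.2

theorem leftTranslate_pi {α : Type*} {N : ℕ} {x f : List ι → α → ℝ} (w : List ι) (q : α) :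
    leftTranslate N x f w q = leftTranslate N (fun v => x v q) (fun v => f v q) w :=
  map_leftTranslate (Pi.evalRingHom (fun _ : α => ℝ) q) N x f w

theorem pairing_pi {α : Type*} {N : ℕ} {x f : List ι → α → ℝ} (q : α) :
    pairing N x f q = pairing N (fun v => x v q) (fun v => f v q) :=
  map_pairing (Pi.evalRingHom (fun _ : α => ℝ) q) N x f

theorem pushforward_pi {α : Type*} {N : ℕ} {x : List ι → α → ℝ} {h : κ → List ι → α → ℝ}
    (w : List κ) (q : α) :
    pushforward N h x w q = pushforward N (fun j v => h j v q) (fun v => x v q) w :=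
  map_pushforward (Pi.evalRingHom (fun _ : α => ℝ) q) N h x w

theorem hasOrder_expansion_iff (hp : 1 ≤ p) (hω : IsControl T ω) :
    HasOrder (pairFiltration hp hω) M ((fun w (q : Pairs T) => J q.1.2 w) -
      leftTranslate ⌊p⌋₊ (fun w (q : Pairs T) => x q.1.1 q.1.2 w) (fun w q => J q.1.1 w)) ↔
    ∀ w, IsOrder p T ω (M - w.length)
      (fun s t => J t w - leftTranslate ⌊p⌋₊ (x s t) (J s) w) := by
  refine forall_congr' fun w => ?_
  rw [← mem_pairFiltration hp hω]
  have : ((fun w (q : Pairs T) => J q.1.2 w) - leftTranslate ⌊p⌋₊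
      (fun w (q : Pairs T) => x q.1.1 q.1.2 w) (fun w q => J q.1.1 w)) w =
      fun q : Pairs T => J q.1.2 w - leftTranslate ⌊p⌋₊ (x q.1.1 q.1.2) (J q.1.1) w := by
    funext q
    simp only [Pi.sub_apply, leftTranslate_pi]
  rw [this]

/-- The increments of a controlled family are of order one, at the words of length less
than `M`. -/
theorem IsWordControlled.isOrder_one (hp : 1 ≤ p) (hω : IsControl T ω) (hx : IsWordRough p T ω x)
    (hJ : IsWordControlled p T ω M x J) {w : List ι} (hw : w.length < M) :
    IsOrder p T ω 1 (fun s t => J t w - J s w) := by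
  rw [← mem_pairFiltration hp hω]
  have h1 := (pairFiltration hp hω).anti (by omega : 1 ≤ M - w.length)
    ((hasOrder_expansion_iff hp hω).2 hJ.expansion w)
  have h2 : leftTranslate ⌊p⌋₊ ((fun w (q : Pairs T) => x q.1.1 q.1.2 w) - WordSeries.unit)
      (fun w (q : Pairs T) => J q.1.1 w) w ∈ (pairFiltration hp hω).F 1 := by
    refine pairing_mem fun u hu => ?_
    have hb := hasOrder_left hp hω hJ.bounded (w ++ u)
    rw [Nat.zero_sub] at hb
    refine (pairFiltration hp hω).mul (m := 1) (n := 0) ?_ hb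
    cases u with
    | nil =>
      convert AddSubgroup.zero_mem _ using 1
      funext q
      simp [hx.mult.nil _ _ q.2.1 q.2.2.1 q.2.2.2]
    | cons i u =>
      have := (pairFiltration hp hω).anti (by simp : 1 ≤ (i :: u).length)
        (hx.decays hp hω (i :: u) hu)
      simpa using this
  have h3 := AddSubgroup.add_mem _ h1 h2
  rw [leftTranslate_sub_left] at h3
  convert h3 using 1
  have h4 : leftTranslate ⌊p⌋₊ (WordSeries.unit : List ι → Pairs T → ℝ)
      (fun w (q : Pairs T) => J q.1.1 w) w = fun q => J q.1.1 w := by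
    rw [leftTranslate, pairing_comm, pairing_unit_right, List.append_nil]
  simp only [Pi.sub_apply, h4]
  funext q
  simp

theorem IsWordControlled.mono (hp : 1 ≤ p) (hω : IsControl T ω) {M' : ℕ} (h : M' ≤ M)
    (hJ : IsWordControlled p T ω M x J) : IsWordControlled p T ω M' x J :=
  ⟨hJ.bounded, (hasOrder_expansion_iff hp hω).1
    (((hasOrder_expansion_iff hp hω).2 hJ.expansion).mono h)⟩

theorem isWordControlled_zero :
    IsWordControlled p T ω M x 0 := by
  refine ⟨fun w => ⟨0, fun _ _ _ => by simp⟩, fun w => ⟨0, fun s t _ _ _ => ?_⟩⟩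
  have : leftTranslate ⌊p⌋₊ (x s t) 0 w = 0 := pairing_zero_right _ _
  simp [this]

theorem IsWordControlled.add (hp : 1 ≤ p) (hω : IsControl T ω) {J' : ℝ → List ι → ℝ}
    (hJ : IsWordControlled p T ω M x J) (hJ' : IsWordControlled p T ω M x J') :
    IsWordControlled p T ω M x (J + J') := by
  refine ⟨fun w => ?_, (hasOrder_expansion_iff hp hω).1 ?_⟩
  · obtain ⟨C, hC⟩ := hJ.bounded w
    obtain ⟨C', hC'⟩ := hJ'.bounded w
    exact ⟨C + C', fun t h1 h2 => (abs_add_le _ _).trans (add_le_add (hC t h1 h2) (hC' t h1 h2))⟩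
  · have := ((hasOrder_expansion_iff hp hω).2 hJ.expansion).add
      ((hasOrder_expansion_iff hp hω).2 hJ'.expansion)
    have e : (fun w (q : Pairs T) => (J + J') q.1.1 w) =
        (fun w (q : Pairs T) => J q.1.1 w) + fun w (q : Pairs T) => J' q.1.1 w := rfl
    rw [e, leftTranslate_add]
    convert this using 1
    rw [sub_add_sub_comm]
    rfl

theorem IsWordControlled.sum (hp : 1 ≤ p) (hω : IsControl T ω) {α : Type*} (S : Finset α)
    {J : α → ℝ → List ι → ℝ} (hJ : ∀ a ∈ S, IsWordControlled p T ω M x (J a)) :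
    IsWordControlled p T ω M x (∑ a ∈ S, J a) := by
  classical
  induction S using Finset.induction_on with
  | empty => simpa using isWordControlled_zero (T := T)
  | insert a S ha ih =>
    rw [Finset.sum_insert ha]
    exact (hJ a (Finset.mem_insert_self a S)).add hp hω
      (ih fun b hb => hJ b (Finset.mem_insert_of_mem hb))

/-- The Leibniz rule: shuffle products of controlled families are controlled. -/
theorem IsWordControlled.shuffle (hp : 1 ≤ p) (hω : IsControl T ω) (hx : IsWordRough p T ω x)
    {K : ℝ → List ι → ℝ} (hM : M ≤ ⌊p⌋₊ + 1) (hK : IsWordControlled p T ω M x K)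
    (hJ : IsWordControlled p T ω M x J) :
    IsWordControlled p T ω M x (fun t => WordSeries.shuffle (K t) (J t)) := by
  set 𝓕 := pairFiltration hp hω
  have eL : (fun w (q : Pairs T) => WordSeries.shuffle (K q.1.1) (J q.1.1) w) =
      WordSeries.shuffle (fun w (q : Pairs T) => K q.1.1 w) (fun w q => J q.1.1 w) := by
    funext w q
    rw [shuffle_pi]
  have eR : (fun w (q : Pairs T) => WordSeries.shuffle (K q.1.2) (J q.1.2) w) =
      WordSeries.shuffle (fun w (q : Pairs T) => K q.1.2 w) (fun w q => J q.1.2 w) := by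
    funext w q
    rw [shuffle_pi]
  have hKL := hasOrder_left hp hω hK.bounded
  have hJL := hasOrder_left hp hω hJ.bounded
  have hJR := hasOrder_right hp hω hJ.bounded
  refine ⟨fun w => ?_, (hasOrder_expansion_iff hp hω).1 ?_⟩
  · have h := hKL.shuffle hJL w
    rw [← eL, add_zero, Nat.zero_sub, mem_pairFiltration hp hω
      (f := fun s _ => WordSeries.shuffle (K s) (J s) w)] at h
    obtain ⟨C, hC⟩ := h
    exact ⟨C, fun t h1 h2 => by simpa using hC t t h1 le_rfl h2⟩
  · rw [eL, eR]
    have h1 := ((hasOrder_expansion_iff hp hω).2 hK.expansion).shuffle_zero_right hJR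
    have h2 := HasOrder.shuffle_zero_left (hKL.leftTranslate (hx.decays hp hω))
      ((hasOrder_expansion_iff hp hω).2 hJ.expansion)
    have h3 := (hx.isCharacter.leftTranslate_shuffle_sub (hx.decays hp hω) hKL hJL).mono hM
    have := (h1.add h2).sub h3
    rw [shuffle_sub_left, shuffle_sub_right] at this
    convert this using 1
    abel

end Filtered

/-! ### The rough integral in coordinates -/

/-- The function on words with derivatives `H i` and with value `c` at the empty word. -/
def primitive (c : ℝ) (H : ι → List ι → ℝ) : List ι → ℝ
  | [] => c
  | i :: w => H i w

/-- The germ of the rough integral is almost additive, so that the integral exists. -/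
theorem exists_integral (hp : 1 ≤ p) (hω : IsControl T ω) (hT : 0 ≤ T)
    {x : ℝ → ℝ → List ι → ℝ} (hx : IsWordRough p T ω x) {H : ι → ℝ → List ι → ℝ}
    (hH : ∀ i, IsWordControlled p T ω ⌊p⌋₊ x (H i)) :
    ∃ I : ℝ → ℝ, IsOrder p T ω (⌊p⌋₊ + 1) (fun s t => I t - I s -
      pairing ⌊p⌋₊ (x s t) (primitive 0 fun i => H i s)) := by
  set N := ⌊p⌋₊
  set 𝓕 := tripleFiltration hp hω
  set g : ℝ → List ι → ℝ := fun s => primitive 0 fun i => H i s with hg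
  have hgb : ∀ w, ∃ C, ∀ t, 0 ≤ t → t ≤ T → |g t w| ≤ C := by
    intro w
    cases w with
    | nil => exact ⟨0, fun t _ _ => by simp [hg, primitive]⟩
    | cons i w => exact (hH i).bounded w
  set xl : List ι → Triples T → ℝ := fun w q => x q.1.1 q.1.2.1 w
  set xr : List ι → Triples T → ℝ := fun w q => x q.1.2.1 q.1.2.2 w with hxr
  set gs : List ι → Triples T → ℝ := fun w q => g q.1.1 w
  set gu : List ι → Triples T → ℝ := fun w q => g q.1.2.1 w
  have hdl : Decays 𝓕 N xl := fun w hw =>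
    mem_triple_left hp hω (f := fun s t => x s t w) (hx.decays hp hω w hw)
  have hdr : Decays 𝓕 N xr := fun w hw =>
    mem_triple_right hp hω (f := fun s t => x s t w) (hx.decays hp hω w hw)
  have hgs : HasOrder 𝓕 0 gs := fun w => by
    rw [Nat.zero_sub]
    have := hasOrder_left hp hω hgb w
    rw [Nat.zero_sub] at this
    exact mem_triple_left hp hω (f := fun s _ => g s w) this
  have s1 := pairing_conv_sub_mem hdl hdr hgs
  have s2 : HasOrder 𝓕 (N + 1) (gu - leftTranslate N xl gs +
      pairing N xl gs • WordSeries.unit) := by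
    refine HasOrder.of_nil_of_der ?_ fun i w => ?_
    · convert AddSubgroup.zero_mem _ using 1
      simp only [Pi.add_apply, Pi.sub_apply, leftTranslate_nil, Pi.smul_apply, unit_nil,
        smul_eq_mul, mul_one, sub_add_cancel]
      rfl
    · have h1 := (mem_pairFiltration hp hω).2 ((hH i).expansion w)
      have h2 := mem_triple_left hp hω
        (f := fun s t => H i t w - leftTranslate N (x s t) (H i s) w) h1
      convert h2 using 1
      funext q
      simp only [der_apply, Pi.add_apply, Pi.sub_apply, Pi.smul_apply, unit_cons, smul_zero,
        Pi.zero_apply, add_zero, leftTranslate_pi]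
      rfl
  have s3 := s2.pairing_mem hdr
  rw [pairing_add_right, pairing_sub_right, pairing_smul_right, pairing_unit_right] at s3
  have s4 := AddSubgroup.add_mem _ s1 (neg_mem s3)
  have s4' := AddSubgroup.add_mem _ s1 s3
  have e : (fun q : Triples T => pairing N (x q.1.1 q.1.2.2) (g q.1.1) -
      pairing N (x q.1.1 q.1.2.1) (g q.1.1) - pairing N (x q.1.2.1 q.1.2.2) (g q.1.2.1)) =
      pairing N (conv xl xr) gs - pairing N xr (leftTranslate N xl gs) -
        (pairing N xr gu - pairing N xr (leftTranslate N xl gs) +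
          pairing N xl gs * xr []) := by
    have h0 : xr [] = 1 := funext fun q =>
      hx.mult.nil _ _ (q.2.1.trans q.2.2.1) q.2.2.2.1 q.2.2.2.2
    rw [h0]
    funext q
    simp only [Pi.sub_apply, Pi.add_apply, mul_one, pairing_pi, conv_pi]
    have h1 : pairing N (x q.1.1 q.1.2.2) (g q.1.1) =
        pairing N (fun v => conv (fun v => xl v q) (fun v => xr v q) v) (fun v => gs v q) :=
      pairing_congr (fun w hw => (hx.mult.chen _ _ _ q.2.1 q.2.2.1 q.2.2.2.1 q.2.2.2.2 w hw).symm)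
        fun _ _ => rfl
    rw [h1]
    change _ - pairing N (fun v => xl v q) (fun v => gs v q) -
      pairing N (fun v => xr v q) (fun v => gu v q) = _
    ring
  rw [← sub_eq_add_neg, ← e, mem_tripleFiltration hp hω (f := fun s u t =>
    pairing N (x s t) (g s) - pairing N (x s u) (g s) - pairing N (x u t) (g u))] at s4
  obtain ⟨C, hC⟩ := s4
  obtain ⟨I, C', hI⟩ := exists_path_of_almost_additive hω hT (one_lt_order_div hp) (abs_nonneg C)
    (Ξ := fun s t => pairing N (x s t) (g s))
    (fun s u t h1 h2 h3 h4 => (hC s u t h1 h2 h3 h4).trans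
      (mul_le_mul_of_nonneg_right (le_abs_self C)
        (Real.rpow_nonneg (hω.nonneg s t h1 (h2.trans h3) h4) _)))
  exact ⟨I, C', hI⟩

/-- Rough integrals are controlled with remainders of one order more than their integrands. -/
theorem IsWordControlled.integral
    {x : ℝ → ℝ → List ι → ℝ} (hx : IsWordRough p T ω x) {H : ι → ℝ → List ι → ℝ}
    (hH : ∀ i, IsWordControlled p T ω ⌊p⌋₊ x (H i)) {I : ℝ → ℝ}
    (hI : ContinuousOn I (Icc 0 T)) (hIH : IsOrder p T ω (⌊p⌋₊ + 1) (fun s t => I t - I s -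
      pairing ⌊p⌋₊ (x s t) (primitive 0 fun i => H i s))) :
    IsWordControlled p T ω (⌊p⌋₊ + 1) x (fun t => primitive (I t) fun i => H i t) := by
  refine ⟨fun w => ?_, fun w => ?_⟩
  · cases w with
    | nil =>
      obtain ⟨C, hC⟩ := isCompact_Icc.exists_bound_of_continuousOn hI
      exact ⟨C, fun t h1 h2 => hC t ⟨h1, h2⟩⟩
    | cons i w => exact (hH i).bounded w
  · cases w with
    | nil =>
      obtain ⟨C, hC⟩ := hIH
      refine ⟨C, fun s t h1 h2 h3 => (congrArg norm ?_).trans_le (hC s t h1 h2 h3)⟩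
      have e : primitive (I s) (fun i => H i s) =
          primitive 0 (fun i => H i s) + I s • WordSeries.unit := by
        funext w
        cases w <;> simp [primitive]
      simp only [leftTranslate_nil]
      rw [e, pairing_add_right, pairing_smul_right, pairing_unit_right, hx.mult.nil s t h1 h2 h3]
      simp only [primitive]
      ring
    | cons i w =>
      rw [List.length_cons, Nat.add_sub_add_right]
      exact (hH i).expansion w

/-! ### The lift and the composition in coordinates -/

section Lift

variable {x : ℝ → ℝ → List ι → ℝ} {J : κ → ℝ → List ι → ℝ}

theorem pushforward_decays (hp : 1 ≤ p) (hω : IsControl T ω) (hx : IsWordRough p T ω x)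
    (hJ : ∀ j, ∀ w, ∃ C, ∀ t, 0 ≤ t → t ≤ T → |J j t w| ≤ C) :
    Decays (pairFiltration hp hω) ⌊p⌋₊ (fun w (q : Pairs T) =>
      pushforward ⌊p⌋₊ (fun j => J j q.1.1) (x q.1.1 q.1.2) w) := by
  have := (hx.decays hp hω).pushforward (fun j => hasOrder_left hp hω (hJ j))
  intro w hw
  convert this w hw using 1
  funext q
  rw [pushforward_pi]

/-- The lift of a controlled family with remainders of order `⌊p⌋ + 1` to a rough path. -/
theorem exists_lift [Fintype κ] (hp : 1 ≤ p) (hω : IsControl T ω) (hT : 0 ≤ T)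
    (hx : IsWordRough p T ω x) (hJ : ∀ j, IsWordControlled p T ω (⌊p⌋₊ + 1) x (J j)) :
    ∃ Y : ℝ → ℝ → List κ → ℝ, IsWordRough p T ω Y ∧ ∀ w : List κ, w.length ≤ ⌊p⌋₊ →
      IsOrder p T ω (⌊p⌋₊ + 1)
        (fun s t => Y s t w - pushforward ⌊p⌋₊ (fun j => J j s) (x s t) w) := by
  set N := ⌊p⌋₊
  set a : ℝ → ℝ → List κ → ℝ := fun s t => pushforward N (fun j => J j s) (x s t) with ha
  have had : Decays (pairFiltration hp hω) N (fun w (q : Pairs T) => a q.1.1 q.1.2 w) :=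
    pushforward_decays hp hω hx fun j => (hJ j).bounded
  have hbd : ∀ w : List κ, w.length ≤ N → IsOrder p T ω 0 (fun s t => a s t w) := fun w hw =>
    (mem_pairFiltration hp hω).1 ((pairFiltration hp hω).anti (Nat.zero_le _) (had w hw))
  have hmul : ∀ w : List κ, w.length ≤ N → (fun q : Triples T => a q.1.1 q.1.2.2 w -
      conv (a q.1.1 q.1.2.1) (a q.1.2.1 q.1.2.2) w) ∈ (tripleFiltration hp hω).F (N + 1) := by
    intro w hw
    have hdl : Decays (tripleFiltration hp hω) N (fun w (q : Triples T) => x q.1.1 q.1.2.1 w) :=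
      fun w hw => mem_triple_left hp hω (f := fun s t => x s t w) (hx.decays hp hω w hw)
    have hdr : Decays (tripleFiltration hp hω) N (fun w (q : Triples T) => x q.1.2.1 q.1.2.2 w) :=
      fun w hw => mem_triple_right hp hω (f := fun s t => x s t w) (hx.decays hp hω w hw)
    have hcl : IsCharacter N (fun w (q : Triples T) => x q.1.1 q.1.2.1 w) :=
      isCharacter_pi fun q => hx.character _ _ q.2.1 q.2.2.1 (q.2.2.2.1.trans q.2.2.2.2)
    have key := hcl.pushforward_sub_conv_mem hdl hdr
      (z := fun w (q : Triples T) => x q.1.1 q.1.2.2 w)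
      (h := fun j w (q : Triples T) => J j q.1.1 w)
      (h' := fun j w (q : Triples T) => J j q.1.2.1 w) ?_ ?_ ?_ ?_ hw
    · convert key using 1
      funext q
      rw [Pi.sub_apply, pushforward_pi, conv_pi]
      simp only [pushforward_pi]
      rfl
    · intro w hw
      funext q
      rw [conv_pi]
      exact (hx.mult.chen _ _ _ q.2.1 q.2.2.1 q.2.2.2.1 q.2.2.2.2 w hw).symm
    · intro j w
      have := hasOrder_left hp hω (hJ j).bounded w
      rw [Nat.zero_sub] at this ⊢
      exact mem_triple_left hp hω (f := fun s _ => J j s w) this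
    · intro j w
      have := hasOrder_right hp hω (hJ j).bounded w
      rw [Nat.zero_sub] at this ⊢
      exact mem_triple_left hp hω (f := fun _ t => J j t w) this
    · intro j w
      have := (mem_pairFiltration hp hω).2 ((hJ j).expansion w)
      convert mem_triple_left hp hω
        (f := fun s t => J j t w - leftTranslate N (x s t) (J j s) w) this using 1
      funext q
      rw [Pi.sub_apply, Pi.sub_apply, leftTranslate_pi]
  obtain ⟨Z, hZ0, hZ⟩ := exists_leftDiv_of_almost_multiplicative hp hω hT
    (fun s t h1 h2 h3 => by
      simp only [ha, pushforward_nil]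
      exact hx.mult.nil s t h1 h2 h3) hbd hmul
  set Y : ℝ → ℝ → List κ → ℝ := fun s t => leftDiv (Z s) (Z t)
  have hYm : IsMultiplicative T N Y := isMultiplicative_leftDiv hZ0 N
  have hYa : ∀ w : List κ, w.length ≤ N → (fun q : Pairs T => Y q.1.1 q.1.2 w -
      a q.1.1 q.1.2 w) ∈ (pairFiltration hp hω).F (N + 1) := fun w hw =>
    (mem_pairFiltration hp hω (f := fun s t => Y s t w - a s t w)).2 (hZ w hw)
  have hYd : Decays (pairFiltration hp hω) N (fun w (q : Pairs T) => Y q.1.1 q.1.2 w) := by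
    intro w hw
    have := AddSubgroup.add_mem _ ((pairFiltration hp hω).anti (by omega) (hYa w hw)) (had w hw)
    convert this using 1
    funext q
    simp
  refine ⟨Y, ⟨hYm, fun w hw => (mem_pairFiltration hp hω).1 (hYd w hw), fun s t h1 h2 h3 =>
    hYm.isCharacter hp hω (fun f g => ?_) h1 h2 h3⟩, hZ⟩
  -- `Y` is a character up to order `⌊p⌋ + 1` since the pushforward of `x` is one
  set 𝓕 := pairFiltration hp hω
  set fP : List κ → Pairs T → ℝ := fun w _ => f w
  set gP : List κ → Pairs T → ℝ := fun w _ => g w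
  have hconst : ∀ f : List κ → ℝ, HasOrder 𝓕 0 (fun w (_ : Pairs T) => f w) := fun f w =>
    (mem_pairFiltration hp hω (f := fun _ _ => f w)).2 ⟨|f w|, fun s t _ _ _ => by simp⟩
  set YP : List κ → Pairs T → ℝ := fun w q => Y q.1.1 q.1.2 w
  set xP : List ι → Pairs T → ℝ := fun w q => x q.1.1 q.1.2 w
  set JP : κ → List ι → Pairs T → ℝ := fun j w q => J j q.1.1 w
  have hJP : ∀ j, HasOrder 𝓕 0 (JP j) := fun j => hasOrder_left hp hω (hJ j).bounded
  have diff : ∀ F : List κ → Pairs T → ℝ, HasOrder 𝓕 0 F →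
      pairing N YP F - pairing N xP (compose F JP) ∈ 𝓕.F (N + 1) := by
    intro F hF
    rw [pairing_compose, ← pairing_sub_left]
    refine pairing_mem fun w hw => 𝓕.anti (by omega) (𝓕.mul (m := N + 1) (n := 0) ?_
      (𝓕.anti (Nat.zero_le _) (hF w)))
    convert hYa w hw using 1
    funext q
    rw [Pi.sub_apply, Pi.sub_apply, pushforward_pi]
  have bnd : ∀ F : List κ → Pairs T → ℝ, HasOrder 𝓕 0 F → pairing N YP F ∈ 𝓕.F 0 :=
    fun F hF => hF.pairing_mem hYd
  have bnd' : ∀ F : List κ → Pairs T → ℝ, HasOrder 𝓕 0 F →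
      pairing N xP (compose F JP) ∈ 𝓕.F 0 := fun F hF =>
    (hF.compose hJP).pairing_mem (hx.decays hp hω)
  have t1 := 𝓕.mul (diff fP (hconst f)) (bnd gP (hconst g))
  have t2 := 𝓕.mul (bnd' fP (hconst f)) (diff gP (hconst g))
  have t3 := diff (shuffle fP gP) ((hconst f).shuffle (hconst g))
  have t4 := hx.isCharacter.pairing_mul_sub_mem (hx.decays hp hω) ((hconst f).compose hJP)
    ((hconst g).compose hJP)
  rw [compose_shuffle] at t3
  rw [zero_add] at t2
  have := AddSubgroup.sub_mem _ (AddSubgroup.add_mem _ (AddSubgroup.add_mem _ t1 t2) t4) t3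
  refine (mem_pairFiltration hp hω).1 ?_
  convert this using 1
  have e : (fun q : Pairs T => characterDefect N (Y q.1.1 q.1.2) f g) =
      pairing N YP fP * pairing N YP gP - pairing N YP (shuffle fP gP) := by
    funext q
    simp only [Pi.sub_apply, Pi.mul_apply, pairing_pi, shuffle_pi]
    rfl
  rw [e]
  ring

/-- If `G` is controlled by a lift of `J`, then `G * J` is controlled by `x`. -/
theorem IsWordControlled.compose [Fintype κ] (hp : 1 ≤ p) (hω : IsControl T ω)
    (hx : IsWordRough p T ω x) (hJ : ∀ j, IsWordControlled p T ω (⌊p⌋₊ + 1) x (J j))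
    {y : ℝ → ℝ → List κ → ℝ}
    (hyx : ∀ w : List κ, w.length ≤ ⌊p⌋₊ → IsOrder p T ω (⌊p⌋₊ + 1)
        (fun s t => y s t w - pushforward ⌊p⌋₊ (fun j => J j s) (x s t) w))
    {G : ℝ → List κ → ℝ} {M : ℕ} (hM : M ≤ ⌊p⌋₊ + 1) (hG : IsWordControlled p T ω M y G) :
    IsWordControlled p T ω M x (fun t => WordSeries.compose (G t) (fun j => J j t)) := by
  set 𝓕 := pairFiltration hp hω
  have eL : (fun w (q : Pairs T) => WordSeries.compose (G q.1.1) (fun j => J j q.1.1) w) =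
      WordSeries.compose (fun w (q : Pairs T) => G q.1.1 w) (fun j w q => J j q.1.1 w) := by
    funext w q
    rw [compose_pi]
  have eR : (fun w (q : Pairs T) => WordSeries.compose (G q.1.2) (fun j => J j q.1.2) w) =
      WordSeries.compose (fun w (q : Pairs T) => G q.1.2 w) (fun j w q => J j q.1.2 w) := by
    funext w q
    rw [compose_pi]
  have hGL := hasOrder_left hp hω hG.bounded
  have hJL := fun j => hasOrder_left hp hω (hJ j).bounded
  have hJR := fun j => hasOrder_right hp hω (hJ j).bounded
  refine ⟨fun w => ?_, (hasOrder_expansion_iff hp hω).1 ?_⟩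
  · have h := hGL.compose hJL w
    rw [← eL, Nat.zero_sub, mem_pairFiltration hp hω
      (f := fun s _ => WordSeries.compose (G s) (fun j => J j s) w)] at h
    obtain ⟨C, hC⟩ := h
    exact ⟨C, fun t h1 h2 => by simpa using hC t t h1 le_rfl h2⟩
  · rw [eL, eR]
    refine hx.isCharacter.compose_sub_leftTranslate hM (hx.decays hp hω)
      (b := fun w (q : Pairs T) => y q.1.1 q.1.2 w) (fun w hw => ?_) hGL
      ((hasOrder_expansion_iff hp hω).2 hG.expansion) hJL hJR
      (fun j => ((hasOrder_expansion_iff hp hω).2 (hJ j).expansion).mono hM)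
    have := 𝓕.anti hM ((mem_pairFiltration hp hω).2 (hyx w hw))
    convert this using 1
    funext q
    rw [Pi.sub_apply, pushforward_pi]

/-- The pairing with a lift of `J` is, up to order `⌊p⌋ + 1`, the pairing of `x` with the
composition with `J`. -/
theorem isOrder_pairing_sub_compose [Fintype κ] (hp : 1 ≤ p) (hω : IsControl T ω)
    {y : ℝ → ℝ → List κ → ℝ}
    (hyx : ∀ w : List κ, w.length ≤ ⌊p⌋₊ → IsOrder p T ω (⌊p⌋₊ + 1)
        (fun s t => y s t w - pushforward ⌊p⌋₊ (fun j => J j s) (x s t) w))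
    {G : ℝ → List κ → ℝ} (hG : ∀ w, ∃ C, ∀ t, 0 ≤ t → t ≤ T → |G t w| ≤ C) :
    IsOrder p T ω (⌊p⌋₊ + 1) (fun s t => pairing ⌊p⌋₊ (y s t) (G s) -
      pairing ⌊p⌋₊ (x s t) (compose (G s) (fun j => J j s))) := by
  set 𝓕 := pairFiltration hp hω
  refine (mem_pairFiltration hp hω).1 ?_
  have : pairing ⌊p⌋₊ (fun w (q : Pairs T) => y q.1.1 q.1.2 w -
      pushforward ⌊p⌋₊ (fun j => J j q.1.1) (x q.1.1 q.1.2) w) (fun w q => G q.1.1 w) ∈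
        𝓕.F (⌊p⌋₊ + 1) :=
    pairing_mem fun w hw => 𝓕.anti (by omega) (𝓕.mul (m := ⌊p⌋₊ + 1) (n := 0)
      ((mem_pairFiltration hp hω (f := fun s t => y s t w -
        pushforward ⌊p⌋₊ (fun j => J j s) (x s t) w)).2 (hyx w hw))
      (𝓕.anti (Nat.zero_le _) (hasOrder_left hp hω hG w)))
  convert this using 1
  funext q
  rw [pairing_pi, pairing_compose, ← pairing_sub_left]
  rfl

/-- Almost rough paths over `G` and over `G * J` agree up to order `⌊p⌋ + 1`. -/
theorem isOrder_pushforward_sub_pushforward [Fintype κ] [Fintype ν] (hp : 1 ≤ p)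
    (hω : IsControl T ω) {y : ℝ → ℝ → List κ → ℝ}
    (hyx : ∀ w : List κ, w.length ≤ ⌊p⌋₊ → IsOrder p T ω (⌊p⌋₊ + 1)
        (fun s t => y s t w - pushforward ⌊p⌋₊ (fun j => J j s) (x s t) w))
    {G : ν → ℝ → List κ → ℝ} (hG : ∀ l w, ∃ C, ∀ t, 0 ≤ t → t ≤ T → |G l t w| ≤ C)
    (w : List ν) :
    IsOrder p T ω (⌊p⌋₊ + 1) (fun s t => pushforward ⌊p⌋₊ (fun l => G l s) (y s t) w -
      pushforward ⌊p⌋₊ (fun l => compose (G l s) (fun j => J j s)) (x s t) w) := by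
  classical
  have e : ∀ s, blockSum (w.map fun l => compose (G l s) (fun j => J j s)) =
      compose (blockSum (w.map fun l => G l s)) (fun j => J j s) := by
    intro s
    rw [← compose_single, ← compose_single, compose_compose]
  simp only [pushforward, e]
  refine isOrder_pairing_sub_compose hp hω hyx (G := fun s => blockSum (w.map fun l => G l s)) ?_
  intro v
  have h := (HasOrder.blockSum_map (𝓕 := pairFiltration hp hω)
    (fun l => hasOrder_left hp hω (hG l)) w).mono (Nat.zero_le _) v
  rw [Nat.zero_sub] at h
  have e2 : blockSum (w.map fun l v (q : Pairs T) => G l q.1.1 v) v =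
      fun q : Pairs T => blockSum (w.map fun l => G l q.1.1) v := by
    funext q
    have := map_blockSum (Pi.evalRingHom (fun _ : Pairs T => ℝ) q)
      (w.map fun l v (q : Pairs T) => G l q.1.1 v) v
    rw [List.map_map] at this
    exact this
  rw [e2, mem_pairFiltration hp hω (f := fun s _ => blockSum (w.map fun l => G l s) v)] at h
  obtain ⟨C, hC⟩ := h
  exact ⟨C, fun t h1 h2 => by simpa using hC t t h1 le_rfl h2⟩

end Lift

end GeomRough

namespace WordSeries

/-! ### Words and multi-indices -/

section Words

variable {ι M R : Type*}

/-- The word with letters `y 0, …, y (n - 1)`; words are listed backwards. -/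
def word {n : ℕ} (y : Fin n → ι) : List ι := (List.ofFn y).reverse

@[simp] theorem length_word {n : ℕ} (y : Fin n → ι) : (word y).length = n := by simp [word]

theorem word_snoc {n : ℕ} (y : Fin n → ι) (i : ι) :
    word (Fin.snoc (α := fun _ => ι) y i) = i :: word y := by
  rw [word, List.ofFn_succ', List.concat_eq_append, List.reverse_append]
  simp [word]

theorem word_cons {n : ℕ} (i : ι) (y : Fin n → ι) :
    word (Fin.cons (α := fun _ => ι) i y) = word y ++ [i] := by
  simp [word, List.ofFn_succ]

theorem word_surjective {w : List ι} {n : ℕ} (hw : w.length = n) : ∃ y : Fin n → ι, word y = w := by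
  subst hw
  refine ⟨fun k => w.reverse.get (k.cast (by simp)), ?_⟩
  rw [word, List.reverse_eq_iff]
  refine List.ext_get (by simp) fun k h1 h2 => by simp

theorem gradedPairing_eq_sum [CommRing R] [Fintype ι] (n : ℕ) (f g : List ι → R) :
    gradedPairing n f g = ∑ y : Fin n → ι, f (word y) * g (word y) := by
  induction n generalizing f g with
  | zero => simp [word]
  | succ n ih =>
    rw [← (Fin.snocEquiv fun _ : Fin (n + 1) => ι).sum_comp, Fintype.sum_prod_type,
      gradedPairing_succ]
    refine Finset.sum_congr rfl fun i _ => ?_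
    rw [ih]
    refine Finset.sum_congr rfl fun y _ => ?_
    have h : (Fin.snocEquiv fun _ : Fin (n + 1) => ι) (i, y) = Fin.snoc y i := rfl
    rw [h, word_snoc]
    rfl

/-- The value of `g` at the letter number `k` of `w`, counted from `0` in reading order; it is `0`
if `w` has no such letter. -/
def entry [Zero M] (g : ι → M) (w : List ι) (k : ℕ) : M := (w.reverse.map g).getD k 0

theorem entry_word [Zero M] (g : ι → M) {n : ℕ} (y : Fin n → ι) (k : Fin n) :
    entry g (word y) k = g (y k) := by
  simp [entry, word]

theorem entry_append_left [Zero M] (g : ι → M) (u v : List ι) {k : ℕ} (hk : k < v.length) :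
    entry g (u ++ v) k = entry g v k := by
  rw [entry, List.reverse_append, List.map_append, List.getD_append _ _ _ _ (by simpa using hk)]
  rfl

theorem entry_append_right [Zero M] (g : ι → M) (u v : List ι) (k : ℕ) :
    entry g (u ++ v) (v.length + k) = entry g u k := by
  rw [entry, List.reverse_append, List.map_append, List.getD_append_right _ _ _ _ (by simp)]
  simp [entry]

theorem conv_eq_sum [CommRing R] (x y : List ι → R) (w : List ι) :
    conv x y w = ∑ k ∈ Finset.range (w.length + 1), x (w.drop k) * y (w.take k) := by
  induction w generalizing y with
  | nil => simp
  | cons i w ih =>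
    rw [conv_cons, ih, List.length_cons, Finset.sum_range_succ' _ (w.length + 1)]
    simp [add_comm]

/-- The letters of the word of `y` at the positions in `s`. -/
def subword {n : ℕ} (y : Fin n → ι) (s : Finset (Fin n)) : List ι :=
  (((List.finRange n).filter (· ∈ s)).map y).reverse

theorem word_orderEmbOfFin {n k : ℕ} (y : Fin n → ι) {s : Finset (Fin n)} (hs : s.card = k) :
    word (fun i => y (s.orderEmbOfFin hs i)) = subword y s := by
  have h1 : s.sort (· ≤ ·) = (List.finRange n).filter (· ∈ s) := by
    have h2 := (List.toFinset_sort (α := Fin n) (· ≤ ·) (l := (List.finRange n).filter (· ∈ s))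
      ((List.nodup_finRange n).filter _)).2 (List.Pairwise.filter _ (by
        simpa using (List.pairwise_le_finRange n)))
    rw [← h2]
    congr 1
    ext a
    simp
  subst hs
  rw [subword, word, ← h1]
  congr 1
  refine List.ext_get (by simp) fun k h1 h2 => ?_
  simp [Finset.orderEmbOfFin_apply]

theorem subword_map_castSucc {n : ℕ} (y : Fin n → ι) (i : ι) (s : Finset (Fin n)) :
    subword (Fin.snoc (α := fun _ => ι) y i) (s.map Fin.castSuccEmb) = subword y s := by
  simp [subword, List.finRange_succ_last, List.filter_append, List.filter_map, Function.comp_def]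

theorem subword_insert_last {n : ℕ} (y : Fin n → ι) (i : ι) (s : Finset (Fin n)) :
    subword (Fin.snoc (α := fun _ => ι) y i) (insert (Fin.last n) (s.map Fin.castSuccEmb)) =
      i :: subword y s := by
  simp [subword, List.finRange_succ_last, List.filter_append, List.filter_map, Function.comp_def]

/-- The shuffle product as a sum over the subsets of the set of positions. -/
theorem sum_subword [CommRing R] (f g : List ι → R) {n : ℕ} (y : Fin n → ι) :
    ∑ s : Finset (Fin n), f (subword y s) * g (subword y sᶜ) = shuffle f g (word y) := by
  induction n generalizing f g with
  | zero => simp [Finset.univ_unique, subword, word]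
  | succ n ih =>
    obtain ⟨y, i, rfl⟩ : ∃ z i, y = Fin.snoc (α := fun _ => ι) z i :=
      ⟨Fin.init y, y (Fin.last n), (Fin.snoc_init_self y).symm⟩
    have hl : ∀ s : Finset (Fin n), Fin.last n ∉ s.map Fin.castSuccEmb := by simp
    have c1 : ∀ s : Finset (Fin n), (s.map Fin.castSuccEmb)ᶜ =
        insert (Fin.last n) (sᶜ.map Fin.castSuccEmb) := by
      intro s
      ext a
      induction a using Fin.lastCases <;> simp
    have c2 : ∀ s : Finset (Fin n), (insert (Fin.last n) (s.map Fin.castSuccEmb))ᶜ =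
        sᶜ.map Fin.castSuccEmb := by
      intro s
      rw [← compl_compl s, ← c1, compl_compl, compl_compl]
    have hu : (Finset.univ : Finset (Finset (Fin (n + 1)))) =
        (insert (Fin.last n) (Finset.univ.map Fin.castSuccEmb)).powerset := by
      rw [← Finset.powerset_univ]
      congr 1
      ext a
      induction a using Fin.lastCases <;> simp
    have hp : ∀ F : Finset (Fin (n + 1)) → R,
        ∑ t ∈ (Finset.univ.map Fin.castSuccEmb : Finset (Fin (n + 1))).powerset, F t =
          ∑ t : Finset (Fin n), F (t.map Fin.castSuccEmb) := by
      intro F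
      have h1 : (Finset.univ.map Fin.castSuccEmb : Finset (Fin (n + 1))).powerset =
          Finset.univ.map (Finset.mapEmbedding Fin.castSuccEmb).toEmbedding := by
        ext t
        simp only [Finset.mem_powerset, Finset.subset_map_iff, Finset.mem_map, Finset.subset_univ,
          true_and, Finset.mem_univ, eq_comm (a := t)]
        rfl
      rw [h1, Finset.sum_map]
      rfl
    rw [hu, Finset.sum_powerset_insert (hl _), hp, hp, word_snoc, shuffle_cons, ← ih, ← ih,
      add_comm]
    simp only [c1, c2, subword_insert_last, subword_map_castSucc, der_apply]

end Words

end WordSeries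

namespace GeomRough

open WordSeries Filter Topology Set
open scoped TensorProduct

/-! ### Coordinates of tensors and of multilinear maps -/

section Coordinates

variable {ι V U : Type*} [NormedAddCommGroup V] [NormedSpace ℝ V]
  [NormedAddCommGroup U] [NormedSpace ℝ U]

theorem pair_tprod {n : ℕ} (f : V [×n]→L[ℝ] U) (v : Fin n → V) :
    pair f (PiTensorProduct.tprod ℝ v) = f v := by
  simp [pair]

theorem pair_add {n : ℕ} (f : V [×n]→L[ℝ] U) (a a' : ⨂[ℝ]^n V) :
    pair f (a + a') = pair f a + pair f a' := map_add _ _ _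

theorem pair_smul {n : ℕ} (f : V [×n]→L[ℝ] U) (c : ℝ) (a : ⨂[ℝ]^n V) :
    pair f (c • a) = c • pair f a := map_smul _ _ _

theorem pair_sum {α : Type*} {n : ℕ} (f : V [×n]→L[ℝ] U) (s : Finset α) (a : α → ⨂[ℝ]^n V) :
    pair f (∑ i ∈ s, a i) = ∑ i ∈ s, pair f (a i) := map_sum _ _ _

theorem tmul_tprod {i j : ℕ} (v : Fin i → V) (v' : Fin j → V) :
    tmul (PiTensorProduct.tprod ℝ v) (PiTensorProduct.tprod ℝ v') =
      PiTensorProduct.tprod ℝ (Fin.append v v') :=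
  TensorPower.tprod_mul_tprod ℝ v v'

variable (b : Module.Basis ι ℝ V)

/-- The value of a multilinear map at the basis vectors listed by a word. -/
noncomputable def evalWord {n : ℕ} (f : V [×n]→L[ℝ] U) (w : List ι) : U := f fun k => entry b w k

@[simp] theorem evalWord_word {n : ℕ} (f : V [×n]→L[ℝ] U) (y : Fin n → ι) :
    evalWord b f (word y) = f fun k => b (y k) := by
  simp [evalWord, entry_word]

variable [FiniteDimensional ℝ V]

/-- The product of the coordinate functionals listed by a word. -/
noncomputable def coordMap (n : ℕ) (w : List ι) : V [×n]→L[ℝ] ℝ :=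
  (ContinuousMultilinearMap.mkPiAlgebra ℝ (Fin n) ℝ).compContinuousLinearMap
    fun k => entry (fun i => (b.coord i).toContinuousLinearMap) w k

/-- The coordinate of a tensor that belongs to a word. -/
noncomputable def tensorCoord {n : ℕ} (a : ⨂[ℝ]^n V) (w : List ι) : ℝ := pair (coordMap b n w) a

theorem coordMap_word {n : ℕ} (y : Fin n → ι) (v : Fin n → V) :
    coordMap b n (word y) v = ∏ k, b.coord (y k) (v k) := by
  simp [coordMap, entry_word]

theorem tensorCoord_tprod_word {n : ℕ} (v : Fin n → V) (y : Fin n → ι) :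
    tensorCoord b (PiTensorProduct.tprod ℝ v) (word y) = ∏ k, b.coord (y k) (v k) := by
  rw [tensorCoord, pair_tprod, coordMap_word]

theorem tensorCoord_add {n : ℕ} (a a' : ⨂[ℝ]^n V) :
    tensorCoord b (a + a') = tensorCoord b a + tensorCoord b a' := funext fun _ => pair_add _ _ _

theorem tensorCoord_sub {n : ℕ} (a a' : ⨂[ℝ]^n V) :
    tensorCoord b (a - a') = tensorCoord b a - tensorCoord b a' := funext fun _ => map_sub _ _ _

theorem tensorCoord_smul {n : ℕ} (c : ℝ) (a : ⨂[ℝ]^n V) :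
    tensorCoord b (c • a) = c • tensorCoord b a := funext fun _ => pair_smul _ _ _

theorem tensorCoord_sum {α : Type*} {n : ℕ} (s : Finset α) (a : α → ⨂[ℝ]^n V) :
    tensorCoord b (∑ i ∈ s, a i) = ∑ i ∈ s, tensorCoord b (a i) := by
  funext w
  rw [tensorCoord, pair_sum, Finset.sum_apply]
  rfl

theorem tensorCoord_cast {m n : ℕ} (h : m = n) (a : ⨂[ℝ]^m V) (w : List ι) :
    tensorCoord b (TensorPower.cast ℝ V h a) w = tensorCoord b a w := by
  subst h
  simp

theorem tensorCoord_tunit : tensorCoord b (tunit : ⨂[ℝ]^0 V) [] = 1 := by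
  rw [tunit]
  change tensorCoord b (PiTensorProduct.tprod ℝ (@Fin.elim0 V)) [] = 1
  have h := tensorCoord_tprod_word b (@Fin.elim0 V) (@Fin.elim0 ι)
  simpa [word] using h

/-- The coordinates of a tensor product. -/
theorem tensorCoord_tmul {i j : ℕ} (a : ⨂[ℝ]^i V) (c : ⨂[ℝ]^j V) {u v : List ι}
    (hv : v.length = i) :
    tensorCoord b (tmul a c) (u ++ v) = tensorCoord b a v * tensorCoord b c u := by
  induction a using PiTensorProduct.induction_on with
  | smul_tprod r x =>
    induction c using PiTensorProduct.induction_on with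
    | smul_tprod r' x' =>
      have h : tmul (r • PiTensorProduct.tprod ℝ x) (r' • PiTensorProduct.tprod ℝ x') =
          (r * r') • tmul (PiTensorProduct.tprod ℝ x) (PiTensorProduct.tprod ℝ x') := by
        simp only [tmul, TensorPower.gMul_eq_coe_linearMap, map_smul, LinearMap.smul_apply,
          smul_smul, mul_comm]
      have h2 : coordMap b (i + j) (u ++ v) (Fin.append x x') =
          coordMap b i v x * coordMap b j u x' := by
        subst hv
        simp [coordMap, Fin.prod_univ_add, entry_append_left, entry_append_right]
      rw [h, tmul_tprod]
      simp only [tensorCoord, pair_smul, pair_tprod, h2, smul_eq_mul]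
      ring
    | add c c' h h' =>
      have e : tmul (r • PiTensorProduct.tprod ℝ x) (c + c') =
          tmul (r • PiTensorProduct.tprod ℝ x) c + tmul (r • PiTensorProduct.tprod ℝ x) c' := by
        simp only [tmul, TensorPower.gMul_eq_coe_linearMap, map_add]
      rw [e, tensorCoord_add, tensorCoord_add, Pi.add_apply, Pi.add_apply, h, h', mul_add]
  | add a a' h h' =>
    have e : tmul (a + a') c = tmul a c + tmul a' c := by
      simp only [tmul, TensorPower.gMul_eq_coe_linearMap, map_add, LinearMap.add_apply]
    rw [e, tensorCoord_add, tensorCoord_add, Pi.add_apply, Pi.add_apply, h, h', add_mul]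

theorem abs_tensorCoord_le {n : ℕ} (a : ⨂[ℝ]^n V) (w : List ι) :
    |tensorCoord b a w| ≤ ‖coordMap b n w‖ * ‖a‖ := by
  have h := PiTensorProduct.norm_eval_le_projectiveSeminorm (coordMap b n w) a
  rwa [Real.norm_eq_abs] at h

/-- The coordinates of a family of tensors. -/
noncomputable def coords (a : Tensors V) (w : List ι) : ℝ := tensorCoord b (a w.length) w

theorem coords_of_length {a : Tensors V} {w : List ι} {n : ℕ} (hw : w.length = n) :
    coords b a w = tensorCoord b (a n) w := by
  subst hw
  rfl

theorem coords_one : coords b (Tensors.one : Tensors V) = WordSeries.unit := by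
  funext w
  cases w with
  | nil => exact tensorCoord_tunit b
  | cons i w =>
    rw [coords, unit_cons]
    exact map_zero _

theorem coords_mul (a c : Tensors V) : coords b (a.mul c) = conv (coords b a) (coords b c) := by
  funext w
  rw [coords, Tensors.mul, tensorCoord_sum, Finset.sum_apply, conv_eq_sum]
  simp only [tensorCoord_cast]
  have h := Finset.sum_coe_sort (Finset.HasAntidiagonal.antidiagonal w.length)
    (fun ij : ℕ × ℕ => tensorCoord b (tmul (a ij.1) (c ij.2)) w)
  refine h.trans ?_
  rw [← Finset.Nat.sum_antidiagonal_swap, Finset.Nat.sum_antidiagonal_eq_sum_range_succ_mk]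
  refine Finset.sum_congr rfl fun k hk => ?_
  have hk' : k ≤ w.length := by simpa [Nat.lt_succ_iff] using hk
  have h1 : (w.drop k).length = w.length - k := List.length_drop
  have h2 : (w.take k).length = k := by simpa using hk'
  rw [coords_of_length b h1, coords_of_length b h2]
  have key := tensorCoord_tmul b (a (w.length - k)) (c k) (u := w.take k) h1
  rwa [List.take_append_drop] at key

variable [Fintype ι]

/-- A tensor is the combination of the basic tensors given by its coordinates. -/
theorem eq_sum_tensorCoord {n : ℕ} (a : ⨂[ℝ]^n V) : a =
    ∑ y : Fin n → ι, tensorCoord b a (word y) • PiTensorProduct.tprod ℝ fun k => b (y k) := by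
  classical
  induction a using PiTensorProduct.induction_on with
  | smul_tprod r v =>
    simp only [tensorCoord_smul, Pi.smul_apply, tensorCoord_tprod_word, smul_assoc,
      ← Finset.smul_sum]
    congr 1
    conv_lhs => rw [show v = fun k => ∑ i, b.coord i (v k) • b i from
      funext fun k => (b.sum_repr (v k)).symm]
    rw [MultilinearMap.map_sum]
    exact Finset.sum_congr rfl fun y _ => MultilinearMap.map_smul_univ _ _ _
  | add a a' h h' =>
    conv_lhs => rw [h, h']
    simp only [tensorCoord_add, Pi.add_apply, add_smul, Finset.sum_add_distrib]

theorem tensor_ext {n : ℕ} {a a' : ⨂[ℝ]^n V}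
    (h : ∀ w : List ι, w.length = n → tensorCoord b a w = tensorCoord b a' w) : a = a' := by
  rw [eq_sum_tensorCoord b a, eq_sum_tensorCoord b a']
  exact Finset.sum_congr rfl fun y _ => by rw [h _ (length_word y)]

/-- The evaluation of a linear map at a tensor, in coordinates. -/
theorem pair_eq_gradedPairing {n : ℕ} (ℓ : U →L[ℝ] ℝ) (f : V [×n]→L[ℝ] U) (a : ⨂[ℝ]^n V) :
    ℓ (pair f a) = gradedPairing n (tensorCoord b a) (fun w => ℓ (evalWord b f w)) := by
  conv_lhs => rw [eq_sum_tensorCoord b a]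
  simp only [pair_sum, pair_smul, map_sum, map_smul, pair_tprod, smul_eq_mul,
    gradedPairing_eq_sum, evalWord_word]

/-- The tensor of degree `n` with given coordinates. -/
noncomputable def ofCoords (x : List ι → ℝ) : Tensors V := fun n =>
  ∑ y : Fin n → ι, x (word y) • PiTensorProduct.tprod ℝ fun k => b (y k)

theorem coords_ofCoords (x : List ι → ℝ) : coords b (ofCoords b x) = x := by
  classical
  funext w
  obtain ⟨n, hn⟩ : ∃ n, w.length = n := ⟨_, rfl⟩
  obtain ⟨z, rfl⟩ := word_surjective hn
  rw [coords_of_length b hn, ofCoords, tensorCoord_sum, Finset.sum_apply, Finset.sum_eq_single z]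
  · rw [tensorCoord_smul, Pi.smul_apply, tensorCoord_tprod_word]
    simp
  · intro y _ hy
    obtain ⟨k, hk⟩ := Function.ne_iff.1 hy
    rw [tensorCoord_smul, Pi.smul_apply, tensorCoord_tprod_word,
      Finset.prod_eq_zero (Finset.mem_univ k), smul_zero]
    simp [hk]
  · simp

/-- The projective norm on a tensor power is bounded by the sum of the coordinates. -/
theorem exists_norm_le_tensorCoord (n : ℕ) : ∃ C, ∀ a : ⨂[ℝ]^n V,
    ‖a‖ ≤ C * ∑ y : Fin n → ι, |tensorCoord b a (word y)| := by
  refine ⟨∑ y : Fin n → ι, ‖PiTensorProduct.tprod ℝ fun k => b (y k)‖, fun a => ?_⟩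
  conv_lhs => rw [eq_sum_tensorCoord b a]
  refine (norm_sum_le _ _).trans ?_
  rw [Finset.mul_sum]
  refine Finset.sum_le_sum fun y _ => ?_
  rw [norm_smul, mul_comm, Real.norm_eq_abs]
  exact mul_le_mul_of_nonneg_right (Finset.single_le_sum
    (f := fun y : Fin n → ι => ‖PiTensorProduct.tprod ℝ fun k => b (y k)‖)
    (fun _ _ => norm_nonneg _) (Finset.mem_univ y)) (abs_nonneg _)

end Coordinates

end GeomRough

namespace GeomRough

open WordSeries Filter Topology Set
open scoped TensorProduct

variable {p T : ℝ} {ω : ℝ → ℝ → ℝ}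

/-! ### Rough paths of tensors and their coordinates -/

section Order

/-- The order of a function is bounded below by that of finitely many functions that control its
norm. -/
theorem isOrder_of_norm_le {E α : Type*} [SeminormedAddCommGroup E] [Fintype α] {m : ℕ} {C : ℝ}
    {f : ℝ → ℝ → E} {g : α → ℝ → ℝ → ℝ}
    (h : ∀ s t, 0 ≤ s → s ≤ t → t ≤ T → ‖f s t‖ ≤ C * ∑ a, |g a s t|)
    (hg : ∀ a, IsOrder p T ω m (g a)) : IsOrder p T ω m f := by
  choose D hD using hg
  refine ⟨|C| * ∑ a, D a, fun s t h1 h2 h3 => (h s t h1 h2 h3).trans ?_⟩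
  rw [mul_assoc, Finset.sum_mul]
  refine (mul_le_mul_of_nonneg_right (le_abs_self C)
    (Finset.sum_nonneg fun _ _ => abs_nonneg _)).trans ?_
  exact mul_le_mul_of_nonneg_left (Finset.sum_le_sum fun a _ => hD a s t h1 h2 h3) (abs_nonneg C)

theorem IsOrder.congr {E : Type*} [Norm E] {m : ℕ} {f g : ℝ → ℝ → E} (hf : IsOrder p T ω m f)
    (h : ∀ s t, 0 ≤ s → s ≤ t → t ≤ T → f s t = g s t) : IsOrder p T ω m g := by
  obtain ⟨C, hC⟩ := hf
  exact ⟨C, fun s t h1 h2 h3 => h s t h1 h2 h3 ▸ hC s t h1 h2 h3⟩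

end Order

section Bridge

variable {ι V U : Type*} [Fintype ι] [NormedAddCommGroup V] [NormedSpace ℝ V]
  [FiniteDimensional ℝ V] [NormedAddCommGroup U] [NormedSpace ℝ U] (b : Module.Basis ι ℝ V)

/-- The sum over the shuffles in the integration by parts formula is a shuffle product. -/
theorem sum_pair_shuffleTerm {i j : ℕ} (f : V [×i]→L[ℝ] ℝ) (g : V [×j]→L[ℝ] ℝ)
    (a : ⨂[ℝ]^(i + j) V) :
    ∑ s : {s : Finset (Fin (i + j)) // s.card = i},
      pair (shuffleTerm s.2 (card_compl_of_card s.2) (ContinuousLinearMap.mul ℝ ℝ) f g) a =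
    gradedPairing (i + j) (tensorCoord b a)
      (WordSeries.shuffle (component i (evalWord b f)) (component j (evalWord b g))) := by
  have h1 : ∀ s : {s : Finset (Fin (i + j)) // s.card = i},
      pair (shuffleTerm s.2 (card_compl_of_card s.2) (ContinuousLinearMap.mul ℝ ℝ) f g) a =
      ∑ y : Fin (i + j) → ι, tensorCoord b a (word y) *
        (component i (evalWord b f) (subword y s.1) *
          component j (evalWord b g) (subword y s.1ᶜ)) := by
    intro s
    refine (pair_eq_gradedPairing b (ContinuousLinearMap.id ℝ ℝ) _ a).trans ?_
    rw [gradedPairing_eq_sum]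
    refine Finset.sum_congr rfl fun y _ => ?_
    rw [evalWord_word, shuffleTerm_apply, ← word_orderEmbOfFin y s.2,
      ← word_orderEmbOfFin y (card_compl_of_card s.2)]
    simp [component]
  simp only [h1]
  rw [Finset.sum_comm, gradedPairing_eq_sum]
  refine Finset.sum_congr rfl fun y _ => ?_
  rw [← Finset.mul_sum, ← sum_subword]
  congr 1
  refine (Finset.sum_subtype (Finset.univ.filter fun s : Finset (Fin (i + j)) => s.card = i)
    (p := fun s => s.card = i) (by simp) (fun s => component i (evalWord b f) (subword y s) *
      component j (evalWord b g) (subword y sᶜ))).symm.trans ?_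
  refine Finset.sum_filter_of_ne fun s _ hs => ?_
  by_contra hne
  refine hs ?_
  rw [component, if_neg, zero_mul]
  rwa [← word_orderEmbOfFin y rfl, length_word]

variable {b} {X : ℝ → ℝ → Tensors V}

/-- The coordinates of a rough path form a rough path. -/
theorem IsRoughPath.isWordRough (hX : IsRoughPath p T ω X) :
    IsWordRough p T ω (fun s t => coords b (X s t)) where
  mult :=
    { nil := fun s t h1 h2 h3 => by
        rw [coords_of_length b List.length_nil, hX.degree_zero s t h1 h2 h3, tensorCoord_tunit]
      chen := fun s u t h1 h2 h3 h4 w hw => by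
        refine (congrFun (coords_mul b _ _) w).symm.trans ?_
        exact congrArg (fun a => tensorCoord b a w) (hX.multiplicative s u t h1 h2 h3 h4 _ hw) }
  order := fun w hw => by
    rcases Nat.eq_zero_or_pos w.length with h | h
    · obtain rfl := List.length_eq_zero_iff.1 h
      refine ⟨1, fun s t h1 h2 h3 => ?_⟩
      beta_reduce
      rw [coords_of_length b List.length_nil, hX.degree_zero s t h1 h2 h3, tensorCoord_tunit]
      simp
    · obtain ⟨C, hC⟩ := hX.regularity _ h hw
      refine ⟨‖coordMap b w.length w‖ * C, fun s t h1 h2 h3 => ?_⟩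
      rw [mul_assoc]
      exact (abs_tensorCoord_le b _ w).trans
        (mul_le_mul_of_nonneg_left (hC s t h1 h2 h3) (norm_nonneg _))
  character := fun s t h1 h2 h3 =>
    { nil := by
        rw [coords_of_length b List.length_nil, hX.degree_zero s t h1 h2 h3, tensorCoord_tunit]
      mul := fun i j hij f g => by
        classical
        -- the multilinear map with prescribed values at the basis vectors
        have key : ∀ (n : ℕ) (f : List ι → ℝ), ∃ F : V [×n]→L[ℝ] ℝ,
            ∀ w : List ι, w.length = n → evalWord b F w = f w := by
          intro n f
          refine ⟨∑ y : Fin n → ι, f (word y) • coordMap b n (word y), fun w hw => ?_⟩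
          obtain ⟨z, rfl⟩ := word_surjective hw
          rw [evalWord_word, sum_apply, Finset.sum_eq_single z]
          · simp [coordMap_word]
          · intro y _ hy
            obtain ⟨k, hk⟩ := Function.ne_iff.1 hy
            rw [smul_apply, coordMap_word,
              Finset.prod_eq_zero (Finset.mem_univ k), smul_zero]
            simp [Ne.symm hk]
          · simp
        obtain ⟨F, hF⟩ := key i f
        obtain ⟨G, hG⟩ := key j g
        have h := hX.integration_by_parts s t h1 h2 h3 i j hij F G
        rw [sum_pair_shuffleTerm b] at h
        have hp : ∀ (n : ℕ) (F : V [×n]→L[ℝ] ℝ) (f : List ι → ℝ),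
            (∀ w : List ι, w.length = n → evalWord b F w = f w) →
            pair F (X s t n) = gradedPairing n (coords b (X s t)) f := by
          intro n F f hF
          refine (pair_eq_gradedPairing b (ContinuousLinearMap.id ℝ ℝ) F _).trans ?_
          exact gradedPairing_congr (fun w hw => (coords_of_length b hw).symm) hF
        have hc : ∀ (n : ℕ) (F : V [×n]→L[ℝ] ℝ) (f : List ι → ℝ),
            (∀ w : List ι, w.length = n → evalWord b F w = f w) →
            component n (evalWord b F) = component n f := by
          intro n F f hF
          funext w
          simp only [component]
          split_ifs with hw
          · exact hF w hw
          · rfl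
        rw [hp i F f hF, hp j G g hG, hc i F f hF, hc j G g hG] at h
        rw [h]
        exact gradedPairing_congr (fun w hw => (coords_of_length b hw).symm) fun _ _ => rfl }

/-- A family of tensors is a rough path if its coordinates are. -/
theorem IsWordRough.isRoughPath (hp : 1 ≤ p) (hω : IsControl T ω)
    (hX : IsWordRough p T ω (fun s t => coords b (X s t))) : IsRoughPath p T ω X where
  continuousOn := fun n hn => by
    have h : (fun q : ℝ × ℝ => X q.1 q.2 n) = fun q => ∑ y : Fin n → ι,
        coords b (X q.1 q.2) (word y) • PiTensorProduct.tprod ℝ fun k => b (y k) := by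
      funext q
      conv_lhs => rw [eq_sum_tensorCoord b (X q.1 q.2 n)]
      exact Finset.sum_congr rfl fun y _ => by rw [coords_of_length b (length_word y)]
    rw [h]
    refine continuousOn_finsetSum _ fun y _ => ContinuousOn.fun_smul ?_ continuousOn_const
    exact hX.mult.continuousOn hp hω hX.order (by simpa using hn)
  degree_zero := fun s t h1 h2 h3 => tensor_ext b fun w hw => by
    obtain rfl := List.length_eq_zero_iff.1 hw
    rw [tensorCoord_tunit]
    exact hX.mult.nil s t h1 h2 h3
  regularity := fun n _ hn => by
    obtain ⟨C, hC⟩ := exists_norm_le_tensorCoord b n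
    refine isOrder_of_norm_le (fun s t _ _ _ => hC (X s t n)) fun y => ?_
    have h := hX.order (word y) (by simpa using hn)
    rw [length_word] at h
    refine h.congr fun s t _ _ _ => ?_
    rw [coords_of_length b (length_word y)]
  multiplicative := fun s u t h1 h2 h3 h4 n hn => tensor_ext b fun w hw => by
    have h := hX.mult.chen s u t h1 h2 h3 h4 w (hw.trans_le hn)
    rwa [← coords_mul, coords_of_length b hw, coords_of_length b hw] at h
  integration_by_parts := fun s t h1 h2 h3 i j hij f g => by
    have h := (hX.character s t h1 h2 h3).mul i j hij (evalWord b f) (evalWord b g)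
    have hp : ∀ (n : ℕ) (F : V [×n]→L[ℝ] ℝ), pair F (X s t n) =
        gradedPairing n (coords b (X s t)) (evalWord b F) := by
      intro n F
      refine (pair_eq_gradedPairing b (ContinuousLinearMap.id ℝ ℝ) F _).trans ?_
      exact gradedPairing_congr (fun w hw => (coords_of_length b hw).symm) fun _ _ => rfl
    rw [sum_pair_shuffleTerm b, hp, hp, h]
    exact gradedPairing_congr (fun w hw => coords_of_length b hw) fun _ _ => rfl

theorem IsWordRough.congr {x x' : ℝ → ℝ → List ι → ℝ} (hx : IsWordRough p T ω x)
    (h : ∀ s t, 0 ≤ s → s ≤ t → t ≤ T → ∀ w, w.length ≤ ⌊p⌋₊ → x s t w = x' s t w) :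
    IsWordRough p T ω x' where
  mult :=
    { nil := fun s t h1 h2 h3 => by
        rw [← h s t h1 h2 h3 [] (Nat.zero_le _), hx.mult.nil s t h1 h2 h3]
      chen := fun s u t h1 h2 h3 h4 w hw => by
        rw [← h s t h1 (h2.trans h3) h4 w hw, ← hx.mult.chen s u t h1 h2 h3 h4 w hw]
        exact (conv_congr (fun v hv => h s u h1 h2 (h3.trans h4) v (hv.trans hw))
          fun v hv => h u t (h1.trans h2) h3 h4 v (hv.trans hw)).symm }
  order := fun w hw => (hx.order w hw).congr fun s t h1 h2 h3 => h s t h1 h2 h3 w hw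
  character := fun s t h1 h2 h3 =>
    { nil := by rw [← h s t h1 h2 h3 [] (Nat.zero_le _), hx.mult.nil s t h1 h2 h3]
      mul := fun i j hij f g => by
        have hg : ∀ n, n ≤ ⌊p⌋₊ → ∀ f, gradedPairing n (x' s t) f = gradedPairing n (x s t) f :=
          fun n hn f => gradedPairing_congr
            (fun w hw => (h s t h1 h2 h3 w (hw.trans_le hn)).symm) fun _ _ => rfl
        rw [hg i (by omega), hg j (by omega), hg _ hij]
        exact (hx.character s t h1 h2 h3).mul i j hij f g }

end Bridge

end GeomRough

namespace WordSeries

theorem word_append {ι : Type*} {m n : ℕ} (y : Fin m → ι) (z : Fin n → ι) :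
    word (Fin.append y z) = word z ++ word y := by
  rw [word, List.ofFn_fin_append, List.reverse_append]
  rfl

theorem truncate_of_lt {ι R : Type*} [CommRing R] {m : ℕ} (f : List ι → R) {w : List ι}
    (h : w.length < m) : truncate m f w = f w := if_pos h

theorem truncate_of_le {ι R : Type*} [CommRing R] {m : ℕ} (f : List ι → R) {w : List ι}
    (h : m ≤ w.length) : truncate m f w = 0 := if_neg (by omega)

/-- The translate of a function supported in the words of length less than `N`. -/
theorem leftTranslate_truncate {ι R : Type*} [CommRing R] [Fintype ι] {N n : ℕ}
    (x f : List ι → R) {w : List ι} (hw : w.length = n) :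
    leftTranslate N x (truncate N f) w =
      ∑ k ∈ Finset.range (N - n), gradedPairing k x (fun u => f (w ++ u)) := by
  rw [leftTranslate, pairing]
  have h : ∀ k ∈ Finset.range (N - n), gradedPairing k x (fun u => f (w ++ u)) =
      gradedPairing k x (fun u => truncate N f (w ++ u)) := by
    intro k hk
    have := Finset.mem_range.1 hk
    refine gradedPairing_congr (fun _ _ => rfl) fun u hu => ?_
    rw [truncate_of_lt _ (by rw [List.length_append]; omega)]
  rw [Finset.sum_congr rfl h]
  refine (Finset.sum_subset (fun k hk => ?_) fun k _ hk =>
    gradedPairing_eq_zero fun u hu => ?_).symm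
  · have := Finset.mem_range.1 hk
    exact Finset.mem_range.2 (by omega)
  · rw [Finset.mem_range] at hk
    exact truncate_of_le f (by rw [List.length_append]; omega)

end WordSeries

namespace GeomRough

open WordSeries Filter Topology Set
open scoped TensorProduct

variable {p T : ℝ} {ω : ℝ → ℝ → ℝ}

/-! ### Controlled paths and their coordinates -/

section Words

variable {ι : Type*} [Fintype ι] {x : ℝ → ℝ → List ι → ℝ} {J J' : ℝ → List ι → ℝ} {M : ℕ}

theorem IsWordControlled.congr (hJ : IsWordControlled p T ω M x J)
    (h : ∀ t, 0 ≤ t → t ≤ T → J t = J' t) : IsWordControlled p T ω M x J' where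
  bounded := fun w => by
    obtain ⟨C, hC⟩ := hJ.bounded w
    exact ⟨C, fun t h1 h2 => h t h1 h2 ▸ hC t h1 h2⟩
  expansion := fun w => (hJ.expansion w).congr fun s t h1 h2 h3 => by
    rw [h s h1 (h2.trans h3), h t (h1.trans h2) h3]

/-- Words of length at least `⌊p⌋` do not matter for controlled paths. -/
theorem IsWordControlled.truncate (hp : 1 ≤ p) (hω : IsControl T ω) (hx : IsWordRough p T ω x)
    (hJ : IsWordControlled p T ω ⌊p⌋₊ x J) :
    IsWordControlled p T ω ⌊p⌋₊ x (fun t => WordSeries.truncate ⌊p⌋₊ (J t)) := by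
  have hb : ∀ w, ∃ C, ∀ t, 0 ≤ t → t ≤ T → |WordSeries.truncate ⌊p⌋₊ (J t) w| ≤ C := by
    intro w
    obtain ⟨C, hC⟩ := hJ.bounded w
    refine ⟨C, fun t h1 h2 => ?_⟩
    rw [WordSeries.truncate]
    split_ifs
    · exact hC t h1 h2
    · rw [abs_zero]
      exact (abs_nonneg _).trans (hC t h1 h2)
  refine ⟨hb, fun w => ?_⟩
  rcases lt_or_ge w.length ⌊p⌋₊ with hw | hw
  · have h1 := (mem_pairFiltration hp hω).2 (hJ.expansion w)
    have h2 : pairing ⌊p⌋₊ (fun v (q : Pairs T) => x q.1.1 q.1.2 v)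
        (fun u q => J q.1.1 (w ++ u) - WordSeries.truncate ⌊p⌋₊ (J q.1.1) (w ++ u)) ∈
          (pairFiltration hp hω).F (⌊p⌋₊ - w.length) := by
      refine pairing_mem fun u hu => ?_
      rcases lt_or_ge (w ++ u).length ⌊p⌋₊ with h | h
      · convert AddSubgroup.zero_mem _ using 1
        funext q
        simp only [truncate_of_lt _ h, sub_self, mul_zero, Pi.mul_apply, Pi.zero_apply]
      · rw [List.length_append] at h
        refine (pairFiltration hp hω).anti (by omega) ((pairFiltration hp hω).mul (n := 0)
          (hx.decays hp hω u hu) ?_)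
        have h3 := AddSubgroup.sub_mem _ (hasOrder_left hp hω hJ.bounded (w ++ u))
          (hasOrder_left hp hω hb (w ++ u))
        rwa [Nat.zero_sub] at h3
    refine (mem_pairFiltration hp hω).1 ?_
    convert AddSubgroup.add_mem _ h1 h2 using 1
    funext q
    simp only [Pi.add_apply, pairing_pi]
    have e : WordSeries.truncate ⌊p⌋₊ (J q.1.2) w = J q.1.2 w := if_pos hw
    rw [e, leftTranslate, leftTranslate]
    have := pairing_sub_right ⌊p⌋₊ (x q.1.1 q.1.2) (fun u => J q.1.1 (w ++ u))
      (fun u => WordSeries.truncate ⌊p⌋₊ (J q.1.1) (w ++ u))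
    change _ = _ + pairing ⌊p⌋₊ (x q.1.1 q.1.2) ((fun u => J q.1.1 (w ++ u)) -
      (fun u => WordSeries.truncate ⌊p⌋₊ (J q.1.1) (w ++ u)))
    rw [this]
    ring
  · refine ⟨0, fun s t _ _ _ => ?_⟩
    beta_reduce
    rw [leftTranslate_truncate _ _ rfl, Nat.sub_eq_zero_of_le hw, truncate_of_le _ hw]
    simp

end Words

section Bridge

variable {ι V U : Type*} [NormedAddCommGroup V] [NormedSpace ℝ V]
  [NormedAddCommGroup U] [NormedSpace ℝ U] (b : Module.Basis ι ℝ V)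

/-- The values of a functional on the coefficients of a formal multilinear series. -/
noncomputable def seriesCoords (ℓ : U →L[ℝ] ℝ) (F : FormalMultilinearSeries ℝ V U)
    (w : List ι) : ℝ := ℓ (evalWord b (F w.length) w)

theorem seriesCoords_of_length (ℓ : U →L[ℝ] ℝ) (F : FormalMultilinearSeries ℝ V U) {w : List ι}
    {n : ℕ} (hw : w.length = n) : seriesCoords b ℓ F w = ℓ (evalWord b (F n) w) := by
  subst hw
  rfl

theorem seriesCoords_word (ℓ : U →L[ℝ] ℝ) (F : FormalMultilinearSeries ℝ V U) {n : ℕ}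
    (y : Fin n → ι) : seriesCoords b ℓ F (word y) = ℓ (F n fun k => b (y k)) := by
  rw [seriesCoords_of_length b ℓ F (length_word y), evalWord_word]

variable [Fintype ι] [FiniteDimensional ℝ V]

theorem pair_tmul_tprod (ℓ : U →L[ℝ] ℝ) {k n : ℕ} (f : V [×(k + n)]→L[ℝ] U) (a : ⨂[ℝ]^k V)
    (y : Fin n → ι) : ℓ (pair f (tmul a (PiTensorProduct.tprod ℝ fun i => b (y i)))) =
      gradedPairing k (tensorCoord b a) (fun v => ℓ (evalWord b f (word y ++ v))) := by
  conv_lhs => rw [eq_sum_tensorCoord b a]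
  have h : ∀ z : Fin k → ι, (Fin.append (fun i => b (z i)) fun i => b (y i)) =
      fun i => b (Fin.append z y i) := by
    intro z
    funext i
    induction i using Fin.addCases <;> simp
  have h2 : tmul (∑ z : Fin k → ι, tensorCoord b a (word z) •
      PiTensorProduct.tprod ℝ fun i => b (z i)) (PiTensorProduct.tprod ℝ fun i => b (y i)) =
      ∑ z : Fin k → ι, tensorCoord b a (word z) •
        PiTensorProduct.tprod ℝ fun i => b (Fin.append z y i) := by
    simp only [← h, ← tmul_tprod]
    simp only [tmul, TensorPower.gMul_eq_coe_linearMap, map_sum, map_smul, LinearMap.sum_apply,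
      LinearMap.smul_apply]
  rw [h2]
  simp only [pair_sum, pair_smul, map_sum, map_smul, pair_tprod, smul_eq_mul,
    gradedPairing_eq_sum, ← word_append, evalWord_word]

variable {b} {X : ℝ → ℝ → Tensors V} {H : ℝ → FormalMultilinearSeries ℝ V U}

/-- The remainders in the definition of controlled paths, in coordinates. -/
theorem expansion_coords (ℓ : U →L[ℝ] ℝ) {n : ℕ} (hn : n < ⌊p⌋₊) (s t : ℝ) (y : Fin n → ι) :
    ℓ (pair (H t n) (PiTensorProduct.tprod ℝ fun i => b (y i)) -
      ∑ k ∈ Finset.range (⌊p⌋₊ - n), pair (H s (k + n))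
        (tmul (X s t k) (PiTensorProduct.tprod ℝ fun i => b (y i)))) =
    truncate ⌊p⌋₊ (seriesCoords b ℓ (H t)) (word y) -
      leftTranslate ⌊p⌋₊ (coords b (X s t)) (truncate ⌊p⌋₊ (seriesCoords b ℓ (H s))) (word y) := by
  rw [leftTranslate_truncate _ _ (length_word y), truncate_of_lt _ (by simpa using hn), map_sub,
    pair_tprod, seriesCoords_word, map_sum]
  congr 1
  refine Finset.sum_congr rfl fun k _ => ?_
  rw [pair_tmul_tprod]
  exact gradedPairing_congr (fun w hw => (coords_of_length b hw).symm) fun w hw =>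
    (seriesCoords_of_length b ℓ _ (by rw [List.length_append, length_word, hw, add_comm])).symm

/-- The coordinates of a controlled path form controlled families. -/
theorem IsControlled.isWordControlled (hX : IsRoughPath p T ω X) (hH : IsControlled p T ω X H)
    (ℓ : U →L[ℝ] ℝ) : IsWordControlled p T ω ⌊p⌋₊ (fun s t => coords b (X s t))
      (fun t => truncate ⌊p⌋₊ (seriesCoords b ℓ (H t))) := by
  have hx := hX.isWordRough (b := b)
  refine ⟨fun w => ?_, fun w => ?_⟩
  · rcases lt_or_ge w.length ⌊p⌋₊ with hw | hw
    · have h1 : ContinuousOn (fun t => ℓ (evalWord b (H t w.length) w)) (Icc 0 T) :=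
        (ℓ.continuous.comp (ContinuousMultilinearMap.apply ℝ (fun _ : Fin w.length => V) U
          (fun k => entry b w k)).continuous).comp_continuousOn (hH.regular _ hw).1
      obtain ⟨C, hC⟩ := isCompact_Icc.exists_bound_of_continuousOn h1
      refine ⟨C, fun t h1 h2 => ?_⟩
      rw [truncate_of_lt _ hw]
      exact hC t ⟨h1, h2⟩
    · exact ⟨0, fun t _ _ => by rw [truncate_of_le _ hw, abs_zero]⟩
  · obtain ⟨n, hn⟩ : ∃ n, w.length = n := ⟨_, rfl⟩
    obtain ⟨y, rfl⟩ := word_surjective hn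
    rw [length_word]
    rcases lt_or_ge n ⌊p⌋₊ with hw | hw
    · rcases Nat.lt_or_ge (n + 1) ⌊p⌋₊ with hw' | hw'
      · obtain ⟨C, hC⟩ := hH.expansion n hw' (PiTensorProduct.tprod ℝ fun i => b (y i))
        refine ⟨‖ℓ‖ * C, fun s t h1 h2 h3 => ?_⟩
        beta_reduce
        rw [← expansion_coords ℓ hw, mul_assoc]
        exact (ℓ.le_opNorm _).trans
          (mul_le_mul_of_nonneg_left (hC s t h1 h2 h3) (norm_nonneg _))
      · obtain ⟨C, hC⟩ := (hH.regular n hw).2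
        have e : ⌊p⌋₊ - n = 1 := by omega
        set L : (V [×n]→L[ℝ] U) →L[ℝ] ℝ := ℓ.comp
          (ContinuousMultilinearMap.apply ℝ (fun _ : Fin n => V) U (fun k => b (y k))) with hL
        refine ⟨‖L‖ * C, fun s t h1 h2 h3 => ?_⟩
        beta_reduce
        rw [leftTranslate_truncate _ _ (length_word y), e, Finset.sum_range_one,
          gradedPairing_zero, hx.mult.nil s t h1 h2 h3, one_mul, List.append_nil,
          truncate_of_lt _ (by simpa using hw), seriesCoords_word, seriesCoords_word, mul_assoc]
        have := (L.le_opNorm _).trans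
          (mul_le_mul_of_nonneg_left (hC s t h1 h2 h3) (norm_nonneg _))
        simpa [hL] using this
    · refine ⟨0, fun s t _ _ _ => ?_⟩
      beta_reduce
      rw [leftTranslate_truncate _ _ (length_word y), Nat.sub_eq_zero_of_le hw,
        truncate_of_le _ (by simpa using hw)]
      simp

/-- Finitely many functionals that separate the points of a finite-dimensional space control the
norm. -/
theorem exists_norm_le_of_separating {E α : Type*} [NormedAddCommGroup E] [NormedSpace ℝ E]
    [FiniteDimensional ℝ E] [Fintype α] {ℓ : α → E →ₗ[ℝ] ℝ} (hℓ : ∀ u, (∀ a, ℓ a u = 0) → u = 0) :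
    ∃ C, ∀ u, ‖u‖ ≤ C * ∑ a, |ℓ a u| := by
  obtain ⟨K, _, hK⟩ := LinearMap.exists_antilipschitzWith (LinearMap.pi ℓ)
    (LinearMap.ker_eq_bot'.2 fun u hu => hℓ u fun a => congrFun hu a)
  refine ⟨K, fun u => ?_⟩
  have h := hK.le_mul_dist u 0
  rw [dist_zero_right, map_zero, dist_zero_right] at h
  refine h.trans (mul_le_mul_of_nonneg_left ?_ K.2)
  refine (pi_norm_le_iff_of_nonneg (Finset.sum_nonneg fun _ _ => abs_nonneg _)).2 fun a => ?_
  exact Finset.single_le_sum (f := fun a => |ℓ a u|) (fun _ _ => abs_nonneg _) (Finset.mem_univ a)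

/-- A path is controlled if its coordinates are. -/
theorem isControlled_of_coords [FiniteDimensional ℝ U] (hp : 1 ≤ p) (hω : IsControl T ω)
    (hX : IsRoughPath p T ω X) {α : Type*} [Fintype α] {ℓ : α → U →L[ℝ] ℝ}
    (hℓ : ∀ u, (∀ a, ℓ a u = 0) → u = 0)
    (hH : ∀ a, IsWordControlled p T ω ⌊p⌋₊ (fun s t => coords b (X s t))
      (fun t => truncate ⌊p⌋₊ (seriesCoords b (ℓ a) (H t)))) : IsControlled p T ω X H := by
  have hx := hX.isWordRough (b := b)
  refine ⟨fun n hn => ?_, fun n hn A => ?_⟩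
  · have : FiniteDimensional ℝ (V [×n]→L[ℝ] U) :=
      Module.Finite.of_injective
        (ContinuousMultilinearMap.toMultilinearMapLinear :
          (V [×n]→L[ℝ] U) →ₗ[ℝ] MultilinearMap ℝ (fun _ : Fin n => V) U)
        ContinuousMultilinearMap.toMultilinearMap_injective
    obtain ⟨C, hC⟩ := exists_norm_le_of_separating (E := V [×n]→L[ℝ] U) (α := α × (Fin n → ι))
      (ℓ := fun q => ((ℓ q.1).comp (ContinuousMultilinearMap.apply ℝ (fun _ : Fin n => V) U
        (fun k => b (q.2 k)))).toLinearMap) (fun f hf => by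
          refine ContinuousMultilinearMap.toMultilinearMap_injective
            (Module.Basis.ext_multilinear (fun _ => b) fun y => hℓ _ fun a => hf (a, y)))
    have h1 : IsOrder p T ω 1 (fun s t => H t n - H s n) := by
      refine isOrder_of_norm_le (fun s t _ _ _ => hC _) fun q => ?_
      have h2 := (hH q.1).isOrder_one hp hω hx (w := word q.2) (by simpa using hn)
      refine h2.congr fun s t _ _ _ => ?_
      rw [truncate_of_lt _ (by simpa using hn), truncate_of_lt _ (by simpa using hn),
        seriesCoords_word, seriesCoords_word]
      simp
    exact ⟨continuousOn_of_isOrder_one hp hω h1, h1⟩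
  · obtain ⟨C, hC⟩ := exists_norm_le_of_separating (ℓ := fun a => (ℓ a).toLinearMap) hℓ
    have lin : ∀ s t, pair (H t n) A -
        ∑ k ∈ Finset.range (⌊p⌋₊ - n), pair (H s (k + n)) (tmul (X s t k) A) =
        ∑ y : Fin n → ι, tensorCoord b A (word y) •
          (pair (H t n) (PiTensorProduct.tprod ℝ fun i => b (y i)) -
            ∑ k ∈ Finset.range (⌊p⌋₊ - n), pair (H s (k + n))
              (tmul (X s t k) (PiTensorProduct.tprod ℝ fun i => b (y i)))) := by
      intro s t
      conv_lhs => rw [eq_sum_tensorCoord b A]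
      have h : ∀ (k : ℕ) (x : ⨂[ℝ]^k V), tmul x (∑ y : Fin n → ι, tensorCoord b A (word y) •
          PiTensorProduct.tprod ℝ fun i => b (y i)) = ∑ y : Fin n → ι, tensorCoord b A (word y) •
            tmul x (PiTensorProduct.tprod ℝ fun i => b (y i)) := by
        intro k x
        simp only [tmul, TensorPower.gMul_eq_coe_linearMap, map_sum, map_smul]
      simp only [h, pair_sum, pair_smul, smul_sub, Finset.sum_sub_distrib, Finset.smul_sum]
      rw [Finset.sum_comm]
    refine isOrder_of_norm_le (α := α × (Fin n → ι)) (g := fun q s t =>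
      tensorCoord b A (word q.2) * (truncate ⌊p⌋₊ (seriesCoords b (ℓ q.1) (H t)) (word q.2) -
      leftTranslate ⌊p⌋₊ (coords b (X s t)) (truncate ⌊p⌋₊ (seriesCoords b (ℓ q.1) (H s)))
        (word q.2))) (C := |C|) (fun s t _ _ _ => (hC _).trans ?_) fun q => ?_
    · refine mul_le_mul (le_abs_self C) ?_ (Finset.sum_nonneg fun _ _ => abs_nonneg _)
        (abs_nonneg C)
      rw [Fintype.sum_prod_type]
      refine Finset.sum_le_sum fun a _ => ?_
      rw [lin, map_sum]
      refine (Finset.abs_sum_le_sum_abs _ _).trans_eq (Finset.sum_congr rfl fun y _ => ?_)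
      rw [map_smul, smul_eq_mul]
      congr 2
      exact expansion_coords (ℓ a) (by omega) s t y
    · obtain ⟨D, hD⟩ := (hH q.1).expansion (word q.2)
      rw [length_word] at hD
      refine ⟨|tensorCoord b A (word q.2)| * D, fun s t h1 h2 h3 => ?_⟩
      rw [norm_mul, mul_assoc]
      exact mul_le_mul_of_nonneg_left (hD s t h1 h2 h3) (abs_nonneg _)

end Bridge

end GeomRough

namespace WordSeries

/-! ### Ordered finite partitions and block sums -/

section Blocks

variable {ι R : Type*} [CommRing R]

/-- The derivative of a function on words by a *first* letter. -/
def derFirst (i : ι) (f : List ι → R) : List ι → R := fun w => f (w ++ [i])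

theorem derFirst_shuffle (i : ι) (f g : List ι → R) :
    derFirst i (shuffle f g) = shuffle (derFirst i f) g + shuffle f (derFirst i g) := by
  funext w
  induction w generalizing f g with
  | nil => simp [derFirst, shuffle_cons, der]
  | cons j w ih =>
    have h : derFirst i (shuffle f g) (j :: w) =
        derFirst i (shuffle (der j f) g) w + derFirst i (shuffle f (der j g)) w := rfl
    have e : ∀ f : List ι → R, derFirst i (der j f) = der j (derFirst i f) := fun _ => rfl
    rw [h, ih, ih, Pi.add_apply, Pi.add_apply, Pi.add_apply, shuffle_cons, shuffle_cons, e, e]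
    ring

theorem derFirst_halfShuffle (i : ι) (f g : List ι → R) :
    derFirst i (halfShuffle f g) =
      halfShuffle (derFirst i f) g + halfShuffle f (derFirst i g) + (f [] * g [i]) • unit := by
  funext w
  cases w with
  | nil => simp [derFirst, der]
  | cons j w =>
    have h : derFirst i (halfShuffle f g) (j :: w) = derFirst i (shuffle f (der j g)) w := rfl
    have e : derFirst i (der j g) = der j (derFirst i g) := rfl
    rw [h, derFirst_shuffle, e]
    simp

/-- The sum over the ordered shuffles of a word into `m` blocks of the products of the values of
`g 0, …, g (m - 1)` on the blocks. -/
def blockSumRange (m : ℕ) (g : ℕ → List ι → R) : List ι → R :=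
  blockSum ((List.range m).map g).reverse

theorem blockSumRange_zero (g : ℕ → List ι → R) : blockSumRange 0 g = unit := rfl

theorem blockSumRange_succ (m : ℕ) (g : ℕ → List ι → R) :
    blockSumRange (m + 1) g = halfShuffle (blockSumRange m g) (g m) := by
  simp [blockSumRange, List.range_succ]

theorem blockSumRange_congr {m : ℕ} {g g' : ℕ → List ι → R} (h : ∀ l < m, g l = g' l) :
    blockSumRange m g = blockSumRange m g' := by
  rw [blockSumRange, blockSumRange, List.map_congr_left fun l hl => h l (List.mem_range.1 hl)]

theorem halfShuffle_add_left (f f' g : List ι → R) :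
    halfShuffle (f + f') g = halfShuffle f g + halfShuffle f' g := by
  funext w
  cases w with
  | nil => simp
  | cons i w => simp [shuffle_add_left]

/-- Either the first letter of a word is a block of its own, the first one, or it belongs to a
block of the rest of the word. -/
theorem derFirst_blockSumRange (m : ℕ) (g : ℕ → List ι → R) (i : ι) :
    derFirst i (blockSumRange (m + 1) g) = g 0 [i] • blockSumRange m (fun l => g (l + 1)) +
      ∑ k ∈ Finset.range (m + 1),
        blockSumRange (m + 1) (Function.update g k (derFirst i (g k))) := by
  have hu : derFirst i (unit : List ι → R) = 0 := by
    funext w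
    cases w <;> rfl
  have hz : ∀ g : List ι → R, halfShuffle 0 g = 0 := by
    intro g
    have := halfShuffle_add_left 0 0 g
    simpa using this
  have hs : ∀ (c : R) (f g : List ι → R), halfShuffle (c • f) g = c • halfShuffle f g := by
    intro c f g
    funext w
    cases w with
    | nil => simp
    | cons i w => simp [shuffle_smul_left]
  induction m with
  | zero =>
    rw [blockSumRange_succ, blockSumRange_zero, derFirst_halfShuffle, hu, hz]
    simp [blockSumRange_succ, blockSumRange_zero, add_comm]
  | succ m ih =>
    have h0 : blockSumRange (m + 1) g [] = 0 := by rw [blockSumRange_succ, halfShuffle_nil]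
    have hsum : ∀ (S : Finset ℕ) (F : ℕ → List ι → R) (f : List ι → R),
        halfShuffle (∑ k ∈ S, F k) f = ∑ k ∈ S, halfShuffle (F k) f := by
      intro S F f
      classical
      induction S using Finset.induction_on with
      | empty => simp [hz]
      | insert a S ha ih =>
          rw [Finset.sum_insert ha, Finset.sum_insert ha, halfShuffle_add_left, ih]
    rw [blockSumRange_succ (m + 1), derFirst_halfShuffle, ih, h0, halfShuffle_add_left, hs, hsum,
      Finset.sum_range_succ _ (m + 1), blockSumRange_succ (m + 1)]
    have h1 : ∀ k ∈ Finset.range (m + 1), blockSumRange (m + 1 + 1)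
        (Function.update g k (derFirst i (g k))) =
        halfShuffle (blockSumRange (m + 1) (Function.update g k (derFirst i (g k))))
          (g (m + 1)) := by
      intro k hk
      rw [blockSumRange_succ (m + 1), Function.update_of_ne (by simp at hk; omega)]
    rw [Finset.sum_congr rfl h1, Function.update_self,
      blockSumRange_congr (g := Function.update g (m + 1) _) (g' := g) fun l hl =>
        Function.update_of_ne (by omega) _ _, blockSumRange_succ m fun l => g (l + 1)]
    simp [add_assoc]

theorem word_comp_cast {m n : ℕ} (h : m = n) (y : Fin n → ι) :
    word (fun k : Fin m => y (k.cast h)) = word y := by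
  subst h
  rfl

open OrderedFinpartition in
/-- Ordered finite partitions are ordered shuffles: extending a partition of `n` points on the left,
by a new block or within a block, corresponds to the choice of the block that holds the first
letter. -/
theorem sum_orderedFinpartition (g : ℕ → List ι → R) (m : ℕ) {n : ℕ} (y : Fin n → ι) :
    ∑ c : OrderedFinpartition n, (if c.length = m then
      ∏ l : Fin c.length, g l (word fun k => y (c.emb l k)) else 0) =
    blockSumRange m g (word y) := by
  induction n generalizing m g with
  | zero =>
    have hc : ∀ c : OrderedFinpartition 0, c.length = 0 := fun c => Nat.le_zero.1 c.length_le
    have : IsEmpty (Fin (default : OrderedFinpartition 0).length) := by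
      rw [hc]
      infer_instance
    rw [Fintype.sum_unique, Fintype.prod_empty]
    cases m with
    | zero => simp [blockSumRange, word]
    | succ m => simp [blockSumRange_succ, word]
  | succ n ih =>
    obtain ⟨i, y, rfl⟩ : ∃ i z, y = Fin.cons (α := fun _ => ι) i z :=
      ⟨y 0, Fin.tail y, (Fin.cons_self_tail y).symm⟩
    rw [← (extendEquiv n).sum_comp, Fintype.sum_sigma]
    have hl : ∀ c : OrderedFinpartition n, ∏ l : Fin c.extendLeft.length, g l
        (word fun k => Fin.cons (α := fun _ => ι) i y (c.extendLeft.emb l k)) =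
        g 0 [i] * ∏ l : Fin c.length, g (l + 1) (word fun k => y (c.emb l k)) := by
      intro c
      refine (Fin.prod_univ_succ (n := c.length) _).trans ?_
      rfl
    have hm : ∀ (c : OrderedFinpartition n) (j : Fin c.length),
        ∏ l : Fin (c.extendMiddle j).length, g l
          (word fun k => Fin.cons (α := fun _ => ι) i y ((c.extendMiddle j).emb l k)) =
        ∏ l : Fin c.length, Function.update g j (derFirst i (g j)) l
          (word fun k => y (c.emb l k)) := by
      intro c j
      refine Finset.prod_congr rfl fun (l : Fin c.length) _ => ?_
      rcases eq_or_ne l j with rfl | hlj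
      · rw [Function.update_self, derFirst, ← word_cons]
        congr 1
        have h : (c.extendMiddle l).partSize l = c.partSize l + 1 := by simp [extendMiddle]
        rw [← word_comp_cast h]
        congr 1
        funext k
        simp only [extendMiddle, ↓reduceDIte]
        have key : ∀ k' : Fin (c.partSize l + 1), Fin.cons (α := fun _ => ι) i y
            (Fin.cases (motive := fun _ => Fin (n + 1)) 0 (Fin.succ ∘ c.emb l) k') =
            Fin.cons (α := fun _ => ι) i (fun k => y (c.emb l k)) k' := by
          intro k'
          induction k' using Fin.cases <;> simp
        exact key _
      · rw [Function.update_of_ne (fun h => hlj (Fin.ext h))]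
        congr 1
        have h : (c.extendMiddle j).partSize l = c.partSize l := by simp [extendMiddle, hlj]
        rw [← word_comp_cast h]
        congr 1
        funext k
        simp only [extendMiddle, hlj, ↓reduceDIte]
        rfl
    have key : ∀ c : OrderedFinpartition n, (∑ o : Option (Fin c.length),
        if (c.extend o).length = m then ∏ l : Fin (c.extend o).length, g l
          (word fun k => Fin.cons (α := fun _ => ι) i y ((c.extend o).emb l k)) else 0) =
        (if c.length + 1 = m then
          g 0 [i] * ∏ l : Fin c.length, g (l + 1) (word fun k => y (c.emb l k)) else 0) +
        ∑ j : Fin c.length, if c.length = m then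
          ∏ l : Fin c.length, Function.update g j (derFirst i (g j)) l
            (word fun k => y (c.emb l k)) else 0 := by
      intro c
      rw [Fintype.sum_option]
      exact congrArg₂ (· + ·) (if_congr Iff.rfl (hl c) rfl)
        (Finset.sum_congr rfl fun j _ => if_congr Iff.rfl (hm c j) rfl)
    refine (Finset.sum_congr rfl fun c _ => key c).trans ?_
    rw [Finset.sum_add_distrib]
    cases m with
    | zero =>
      rw [Finset.sum_eq_zero, Finset.sum_eq_zero, blockSumRange_zero, word_cons]
      · cases word y <;> simp
      · intro c _
        refine Finset.sum_eq_zero fun j _ => if_neg ?_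
        exact fun h => (Nat.not_lt_zero _ (h ▸ j.2 : (j : ℕ) < 0)).elim
      · exact fun c _ => if_neg (Nat.succ_ne_zero _)
    | succ m =>
      have hd : blockSumRange (m + 1) g (word (Fin.cons (α := fun _ => ι) i y)) =
          derFirst i (blockSumRange (m + 1) g) (word y) := by
        rw [word_cons, derFirst]
      rw [hd, derFirst_blockSumRange]
      simp only [Pi.add_apply, Pi.smul_apply, Finset.sum_apply, smul_eq_mul, ← ih]
      congr 1
      · rw [Finset.mul_sum]
        refine Finset.sum_congr rfl fun c _ => ?_
        simp
      · rw [Finset.sum_comm]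
        refine Finset.sum_congr rfl fun c _ => ?_
        rcases eq_or_ne c.length (m + 1) with h | h
        · simp only [if_pos h]
          rw [← h]
          exact Fin.sum_univ_eq_sum_range (fun k => ∏ l : Fin c.length,
            Function.update g k (derFirst i (g k)) l (word fun k => y (c.emb l k))) _
        · simp [h]

end Blocks

end WordSeries

namespace WordSeries

theorem map_word {ι κ : Type*} (h : κ → ι) {m : ℕ} (z : Fin m → κ) :
    (word z).map h = word fun l => h (z l) := by
  rw [word, List.map_reverse, List.map_ofFn]
  rfl

/-- Ordered finite partitions with `m` blocks are ordered shuffles into `m` blocks. -/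
theorem sum_orderedFinpartition_length {ι R : Type*} [CommRing R] {m n : ℕ}
    (g : Fin m → List ι → R) (y : Fin n → ι) :
    ∑ c : {c : OrderedFinpartition n // c.length = m}, ∏ l : Fin c.1.length, g (l.cast c.2)
      (word fun k => y (c.1.emb l k)) = blockSum (word g) (word y) := by
  set g' : ℕ → List ι → R := fun l => if h : l < m then g ⟨l, h⟩ else 0 with hg
  have h1 : blockSum (word g) = blockSumRange m g' := by
    rw [blockSumRange, word]
    congr 2
    refine List.ext_getElem (by simp) fun k h1 h2 => ?_
    have hk : k < m := by simpa using h1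
    simp [hg, hk]
  rw [h1, ← sum_orderedFinpartition, ← Finset.sum_filter]
  refine Eq.symm ((Finset.sum_subtype (F := inferInstance)
    (Finset.univ.filter fun c : OrderedFinpartition n => c.length = m) (p := fun c => c.length = m)
    (by simp) fun c => ∏ l : Fin c.length, g' l (word fun k => y (c.emb l k))).trans (Eq.symm ?_))
  refine Finset.sum_congr rfl fun c _ => Finset.prod_congr rfl fun l _ => ?_
  have hl : (l : ℕ) < m := l.2.trans_eq c.2
  simp only [hg, dif_pos hl]
  rfl

end WordSeries

namespace GeomRough

open WordSeries Filter Topology Set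
open scoped TensorProduct

variable {p T : ℝ} {ω : ℝ → ℝ → ℝ}

/-! ### The operations on controlled paths in coordinates -/

section Operations

variable {ι κ V W U : Type*} [NormedAddCommGroup V] [NormedSpace ℝ V]
  [NormedAddCommGroup W] [NormedSpace ℝ W] [NormedAddCommGroup U] [NormedSpace ℝ U]

/-- The coordinate functionals of a basis, as continuous linear maps. -/
noncomputable def coordL [FiniteDimensional ℝ W] (d : Module.Basis κ ℝ W) (j : κ) : W →L[ℝ] ℝ :=
  (d.coord j).toContinuousLinearMap

/-- The functional `A ↦ ℓ (A v)`. -/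
noncomputable def evalL (v : V) (ℓ : W →L[ℝ] ℝ) : (V →L[ℝ] W) →L[ℝ] ℝ :=
  ℓ.comp (ContinuousLinearMap.apply ℝ W v)

variable (b : Module.Basis ι ℝ V) (d : Module.Basis κ ℝ W)

theorem seriesCoords_unshift_cons (ℓ : W →L[ℝ] ℝ) (F : FormalMultilinearSeries ℝ V (V →L[ℝ] W))
    (z : W) (i : ι) (w : List ι) :
    seriesCoords b ℓ (F.unshift z) (i :: w) = seriesCoords b (evalL (b i) ℓ) F w := by
  obtain ⟨n, hn⟩ : ∃ n, w.length = n := ⟨_, rfl⟩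
  obtain ⟨y, rfl⟩ := word_surjective hn
  rw [← word_snoc, seriesCoords_word, seriesCoords_word]
  have h : (F.unshift z (n + 1) fun k => b (Fin.snoc (α := fun _ => ι) y i k)) =
      F n (Fin.init fun k => b (Fin.snoc (α := fun _ => ι) y i k))
        (b (Fin.snoc (α := fun _ => ι) y i (Fin.last n))) := rfl
  rw [h, Fin.snoc_last]
  have h2 : (Fin.init fun k => b (Fin.snoc (α := fun _ => ι) y i k)) = fun k => b (y k) := by
    funext k
    simp [Fin.init]
  rw [h2]
  rfl

/-- In coordinates, the product of controlled paths is a matrix product for the shuffle product. -/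
theorem seriesCoords_leibniz [Fintype κ] [FiniteDimensional ℝ W] {Z : Type*}
    [NormedAddCommGroup Z] [NormedSpace ℝ Z]
    (K : ℝ → FormalMultilinearSeries ℝ V (W →L[ℝ] U))
    (H : ℝ → FormalMultilinearSeries ℝ V (Z →L[ℝ] W)) (z : Z) (ℓ : U →L[ℝ] ℝ) (t : ℝ) :
    seriesCoords b (evalL z ℓ) (leibniz K H t) =
      ∑ j, WordSeries.shuffle (seriesCoords b (evalL (d j) ℓ) (K t))
        (seriesCoords b (evalL z (coordL d j)) (H t)) := by
  funext w
  obtain ⟨n, hn⟩ : ∃ n, w.length = n := ⟨_, rfl⟩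
  obtain ⟨y, rfl⟩ := word_surjective hn
  have h : ∀ a : Finset (Fin n), evalL z ℓ (shuffleTerm (s := a) rfl rfl
      (ContinuousLinearMap.compL ℝ Z W U) (K t a.card) (H t aᶜ.card) fun k => b (y k)) =
      ∑ j, seriesCoords b (evalL (d j) ℓ) (K t) (subword y a) *
        seriesCoords b (evalL z (coordL d j)) (H t) (subword y aᶜ) := by
    intro a
    rw [shuffleTerm_apply]
    simp only [← word_orderEmbOfFin y (rfl : a.card = a.card),
      ← word_orderEmbOfFin y (rfl : aᶜ.card = aᶜ.card), seriesCoords_word]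
    set A := K t a.card fun i => b (y (a.orderEmbOfFin rfl i))
    set B := H t aᶜ.card fun i => b (y (aᶜ.orderEmbOfFin rfl i))
    change ℓ (A (B z)) = ∑ j, ℓ (A (d j)) * d.coord j (B z)
    conv_lhs => rw [← d.sum_repr (B z)]
    rw [map_sum, map_sum]
    refine Finset.sum_congr rfl fun j _ => ?_
    rw [map_smul, map_smul, smul_eq_mul, mul_comm]
    rfl
  rw [seriesCoords_word, leibniz, Finset.sum_apply]
  simp only [← sum_subword]
  rw [Finset.sum_comm, _root_.sum_apply, map_sum]
  exact Finset.sum_congr rfl fun a _ => h a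

/-- Change of the controlling rough path is composition, in coordinates. -/
theorem seriesCoords_taylorComp [Fintype κ] [FiniteDimensional ℝ W] (ℓ : U →L[ℝ] ℝ)
    (K : FormalMultilinearSeries ℝ W U) (F : FormalMultilinearSeries ℝ V W) :
    seriesCoords b ℓ (K.taylorComp F) =
      compose (seriesCoords d ℓ K) (fun j => seriesCoords b (coordL d j) F) := by
  funext w
  obtain ⟨n, hn⟩ : ∃ n, w.length = n := ⟨_, rfl⟩
  obtain ⟨y, rfl⟩ := word_surjective hn
  set G := seriesCoords d ℓ K
  set h : κ → List ι → ℝ := fun j => seriesCoords b (coordL d j) F with hh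
  set S : OrderedFinpartition n → ℝ := fun c => ∑ z : Fin c.length → κ, G (word z) *
    ∏ l : Fin c.length, h (z l) (word fun k => y (c.emb l k)) with hS
  have h1 : ∀ c : OrderedFinpartition n,
      ℓ (K c.length (c.applyOrderedFinpartition (fun m => F (c.partSize m)) fun k => b (y k))) =
        S c := by
    intro c
    have e : (c.applyOrderedFinpartition (fun m => F (c.partSize m)) fun k => b (y k)) =
        fun l => ∑ j, h j (word fun k => y (c.emb l k)) • d j := by
      funext l
      refine (d.sum_repr _).symm.trans (Finset.sum_congr rfl fun j _ => ?_)
      rw [hh]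
      beta_reduce
      rw [seriesCoords_word]
      rfl
    rw [e, ContinuousMultilinearMap.map_sum, map_sum]
    refine Finset.sum_congr rfl fun z _ => ?_
    rw [ContinuousMultilinearMap.map_smul_univ, map_smul, smul_eq_mul, mul_comm,
      ← seriesCoords_word]
  have h2 : seriesCoords b ℓ (K.taylorComp F) (word y) = ∑ c, S c := by
    rw [seriesCoords_word, FormalMultilinearSeries.taylorComp, _root_.sum_apply, map_sum]
    exact Finset.sum_congr rfl fun c _ => h1 c
  rw [h2, compose, length_word, pairing, ← Finset.sum_fiberwise_of_maps_to
    (s := Finset.univ) (t := Finset.range (n + 1)) (g := fun c : OrderedFinpartition n => c.length)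
    (fun c _ => Finset.mem_range.2 (Nat.lt_succ_of_le c.length_le))]
  refine Finset.sum_congr rfl fun m _ => ?_
  rw [gradedPairing_eq_sum]
  simp only [map_word, ← sum_orderedFinpartition_length, Finset.mul_sum]
  rw [Finset.sum_comm]
  refine (Finset.sum_subtype
    (Finset.univ.filter fun c : OrderedFinpartition n => c.length = m) (p := fun c => c.length = m)
    (by simp) S).trans (Finset.sum_congr rfl fun c _ => ?_)
  obtain ⟨c, rfl⟩ := c
  rfl

/-- The germ of the rough integral, in coordinates. -/
theorem apply_germ [Fintype ι] [FiniteDimensional ℝ V] (ℓ : W →L[ℝ] ℝ) (X : ℝ → ℝ → Tensors V)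
    (H : ℝ → FormalMultilinearSeries ℝ V (V →L[ℝ] W)) (s t : ℝ) :
    ℓ (germ p X H s t) = pairing ⌊p⌋₊ (coords b (X s t))
      (primitive 0 fun i => truncate ⌊p⌋₊ (seriesCoords b (evalL (b i) ℓ) (H s))) := by
  rw [germ, map_sum, pairing, Finset.sum_range_succ', gradedPairing_zero, primitive, mul_zero,
    add_zero]
  refine Finset.sum_congr rfl fun n hn => ?_
  rw [pair_eq_gradedPairing b]
  refine gradedPairing_congr (fun w hw => (coords_of_length b hw).symm) fun w hw => ?_
  cases w with
  | nil => simp at hw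
  | cons i w =>
    rw [List.length_cons, Nat.add_right_cancel_iff] at hw
    rw [primitive, truncate_of_lt _ (by simpa [hw] using hn),
      ← seriesCoords_unshift_cons b ℓ (H s) 0,
      seriesCoords_of_length b ℓ _ (n := n + 1) (by simp [hw])]
    rfl

/-- The almost rough path over a controlled path is a pushforward, in the degrees at least two. -/
theorem coords_almostLift [Fintype ι] [FiniteDimensional ℝ V] [FiniteDimensional ℝ W]
    (X : ℝ → ℝ → Tensors V) (H : ℝ → FormalMultilinearSeries ℝ V W)
    (s t : ℝ) {w : List κ} (hw : 2 ≤ w.length) :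
    coords d (almostLift p X H s t) w =
      pushforward ⌊p⌋₊ (fun j => seriesCoords b (coordL d j) (H s)) (coords b (X s t)) w := by
  obtain ⟨m, hm⟩ : ∃ m, w.length = m + 2 := ⟨w.length - 2, by omega⟩
  obtain ⟨z, rfl⟩ := word_surjective hm
  rw [coords_of_length d hm, almostLift, tensorCoord_sum, Finset.sum_apply, pushforward, pairing]
  refine Finset.sum_congr rfl fun n _ => ?_
  rw [tensorCoord_sum, Finset.sum_apply, gradedPairing_eq_sum]
  have h : ∀ c : {c : OrderedFinpartition n // c.length = m + 2}, tensorCoord d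
      (TensorPower.cast ℝ W c.2 (PiTensorProduct.lift (blockTensor c.1 (H s)) (X s t n))) (word z) =
      ∑ y : Fin n → ι, coords b (X s t) (word y) * ∏ l : Fin c.1.length,
        seriesCoords b (coordL d (z (l.cast c.2))) (H s) (word fun k => y (c.1.emb l k)) := by
    intro c
    rw [tensorCoord_cast]
    conv_lhs => rw [eq_sum_tensorCoord b (X s t n)]
    rw [map_sum, tensorCoord_sum, Finset.sum_apply]
    refine Finset.sum_congr rfl fun y _ => ?_
    rw [map_smul, tensorCoord_smul, Pi.smul_apply, smul_eq_mul, coords_of_length b (length_word y),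
      PiTensorProduct.lift.tprod, ← word_comp_cast c.2]
    congr 1
    refine (tensorCoord_tprod_word d _ _).trans (Finset.prod_congr rfl fun l _ => ?_)
    rw [seriesCoords_word]
    rfl
  rw [Finset.sum_congr rfl fun c _ => h c, Finset.sum_comm]
  refine Finset.sum_congr rfl fun y _ => ?_
  rw [← Finset.mul_sum, map_word, sum_orderedFinpartition_length
    (fun l => seriesCoords b (coordL d (z l)) (H s))]

theorem coords_partitionProd [FiniteDimensional ℝ W] (A : ℝ → ℝ → Tensors W) (τ : ℕ → ℝ) (k : ℕ) :
    coords d (partitionProd A τ k) = wordProd (fun s t => coords d (A s t)) τ k := by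
  induction k with
  | zero => exact coords_one d
  | succ k ih => rw [partitionProd, coords_mul, ih, wordProd]

end Operations

end GeomRough

namespace WordSeries

variable {ι κ R : Type*} [CommRing R]

/-- The values of a block sum at short words involve only the values of the functions at short
words. -/
theorem blockSum_map_congr {h h' : κ → List ι → R} {m : ℕ}
    (hh : ∀ j v, v.length ≤ m → h j v = h' j v) (w : List κ) {v : List ι} (hv : v.length ≤ m) :
    blockSum (w.map h) v = blockSum (w.map h') v := by
  induction w generalizing v with
  | nil => rfl
  | cons j w ih =>
    cases v with
    | nil => rfl
    | cons i v =>
      rw [List.length_cons] at hv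
      exact shuffle_congr (fun u hu => ih (by omega)) fun u hu => hh j _ (by
        rw [List.length_cons]
        omega)

theorem pushforward_congr [Fintype ι] {N : ℕ} {h h' : κ → List ι → R}
    (hh : ∀ j v, v.length ≤ N → h j v = h' j v) (x : List ι → R) (w : List κ) :
    pushforward N h x w = pushforward N h' x w :=
  pairing_congr (fun _ _ => rfl) fun _ hv => blockSum_map_congr hh w hv

theorem truncate_truncate {m n : ℕ} (h : m ≤ n) (f : List ι → R) :
    truncate m (truncate n f) = truncate m f := by
  funext w
  rcases lt_or_ge w.length m with hw | hw
  · rw [truncate_of_lt _ hw, truncate_of_lt _ hw, truncate_of_lt _ (by omega)]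
  · rw [truncate_of_le _ hw, truncate_of_le _ hw]

theorem truncate_congr {m : ℕ} {f g : List ι → R} (h : ∀ w, w.length < m → f w = g w) :
    truncate m f = truncate m g := by
  funext w
  rcases lt_or_ge w.length m with hw | hw
  · rw [truncate_of_lt _ hw, truncate_of_lt _ hw, h w hw]
  · rw [truncate_of_le _ hw, truncate_of_le _ hw]

end WordSeries

namespace GeomRough

open WordSeries Filter Topology Set
open scoped TensorProduct

variable {p T : ℝ} {ω : ℝ → ℝ → ℝ}

/-! ### Existence of the rough integral -/

theorem IsOrder.add {E : Type*} [SeminormedAddCommGroup E] {m : ℕ} {f g : ℝ → ℝ → E}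
    (hf : IsOrder p T ω m f) (hg : IsOrder p T ω m g) :
    IsOrder p T ω m (fun s t => f s t + g s t) := by
  obtain ⟨C, hC⟩ := hf
  obtain ⟨D, hD⟩ := hg
  refine ⟨C + D, fun s t h1 h2 h3 => (norm_add_le _ _).trans ?_⟩
  rw [add_mul]
  exact add_le_add (hC s t h1 h2 h3) (hD s t h1 h2 h3)

theorem IsOrder.neg {E : Type*} [SeminormedAddCommGroup E] {m : ℕ} {f : ℝ → ℝ → E}
    (hf : IsOrder p T ω m f) : IsOrder p T ω m (fun s t => -f s t) := by
  obtain ⟨C, hC⟩ := hf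
  exact ⟨C, fun s t h1 h2 h3 => (norm_neg _).trans_le (hC s t h1 h2 h3)⟩

theorem IsOrder.sub {E : Type*} [SeminormedAddCommGroup E] {m : ℕ} {f g : ℝ → ℝ → E}
    (hf : IsOrder p T ω m f) (hg : IsOrder p T ω m g) :
    IsOrder p T ω m (fun s t => f s t - g s t) :=
  (hf.add hg.neg).congr fun _ _ _ _ _ => (sub_eq_add_neg _ _).symm

theorem IsOrder.clm {E F : Type*} [NormedAddCommGroup E] [NormedSpace ℝ E] [NormedAddCommGroup F]
    [NormedSpace ℝ F] {m : ℕ} {f : ℝ → ℝ → E} (hf : IsOrder p T ω m f) (L : E →L[ℝ] F) :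
    IsOrder p T ω m (fun s t => L (f s t)) := by
  obtain ⟨C, hC⟩ := hf
  refine ⟨‖L‖ * C, fun s t h1 h2 h3 => (L.le_opNorm _).trans ?_⟩
  rw [mul_assoc]
  exact mul_le_mul_of_nonneg_left (hC s t h1 h2 h3) (norm_nonneg _)

/-- The germ of a rough integral is of order one. -/
theorem isOrder_pairing_primitive {ι : Type*} [Fintype ι] (hp : 1 ≤ p) (hω : IsControl T ω)
    {x : ℝ → ℝ → List ι → ℝ} (hx : IsWordRough p T ω x) {H : ι → ℝ → List ι → ℝ}
    (hH : ∀ i w, ∃ C, ∀ t, 0 ≤ t → t ≤ T → |H i t w| ≤ C) :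
    IsOrder p T ω 1 (fun s t => pairing ⌊p⌋₊ (x s t) (primitive 0 fun i => H i s)) := by
  have h : pairing ⌊p⌋₊ (fun w (q : Pairs T) => x q.1.1 q.1.2 w)
      (fun w q => primitive 0 (fun i => H i q.1.1) w) ∈ (pairFiltration hp hω).F 1 := by
    refine pairing_mem fun w hw => ?_
    cases w with
    | nil =>
      convert AddSubgroup.zero_mem _ using 1
      funext q
      simp [primitive]
    | cons i w =>
      have h0 := hasOrder_left hp hω (hH i) w
      rw [Nat.zero_sub] at h0
      exact (pairFiltration hp hω).anti (by simp)
        ((pairFiltration hp hω).mul (hx.decays hp hω (i :: w) hw) h0)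
  refine (mem_pairFiltration hp hω).1 ?_
  convert h using 1
  funext q
  rw [pairing_pi]

section Integral

variable {ι κ V W : Type*} [NormedAddCommGroup V] [NormedSpace ℝ V]
  [NormedAddCommGroup W] [NormedSpace ℝ W]
  (b : Module.Basis ι ℝ V) (d : Module.Basis κ ℝ W)
  {X : ℝ → ℝ → Tensors V} {H : ℝ → FormalMultilinearSeries ℝ V (V →L[ℝ] W)}

theorem truncate_unshift (ℓ : W →L[ℝ] ℝ) (m : ℕ) (F : FormalMultilinearSeries ℝ V (V →L[ℝ] W))
    (z : W) : truncate (m + 1) (seriesCoords b ℓ (F.unshift z)) =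
      primitive (ℓ z) fun i => truncate m (seriesCoords b (evalL (b i) ℓ) F) := by
  funext w
  cases w with
  | nil => rfl
  | cons i w =>
    refine (congrFun (der_truncate m (seriesCoords b ℓ (F.unshift z)) i) w).trans ?_
    have : der i (seriesCoords b ℓ (F.unshift z)) = seriesCoords b (evalL (b i) ℓ) F :=
      funext fun w => seriesCoords_unshift_cons b ℓ F z i w
    rw [this]
    rfl

variable [FiniteDimensional ℝ W]

theorem eq_zero_of_coordL {u : W} (h : ∀ j, coordL d j u = 0) : u = 0 :=
  d.ext_elem fun j => (h j).trans (by simp)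

theorem exists_norm_le_coordL [Fintype κ] : ∃ C, ∀ u : W, ‖u‖ ≤ C * ∑ j, |coordL d j u| :=
  exists_norm_le_of_separating (ℓ := fun j => (coordL d j).toLinearMap)
    fun _ hu => eq_zero_of_coordL d hu

/-- The `j`-th coordinate of a path of series, as a function on words. It is cut off at the words of
length more than `⌊p⌋`; this keeps one level more than a controlled path has, the top level of the
path above a rough integral. -/
noncomputable def pathCoords (p : ℝ) (F : ℝ → FormalMultilinearSeries ℝ V W) (j : κ) (t : ℝ) :
    List ι → ℝ :=
  truncate (⌊p⌋₊ + 1) (seriesCoords b (coordL d j) (F t))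

variable [Fintype ι] [FiniteDimensional ℝ V]

/-- The rough integral of a controlled path exists. -/
theorem isRoughIntegral_roughIntegral (hp : 1 ≤ p) (hω : IsControl T ω) (hT : 0 ≤ T)
    (hX : IsRoughPath p T ω X) (hH : IsControlled p T ω X H) :
    IsRoughIntegral p T ω X H (roughIntegral p T ω X H) := by
  refine Classical.epsilon_spec (p := IsRoughIntegral p T ω X H) ?_
  set b := Module.finBasis ℝ V
  set d := Module.finBasis ℝ W
  have hx := hX.isWordRough (b := b)
  choose I hI using fun j => exists_integral hp hω hT hx
    (fun i => hH.isWordControlled (b := b) hX (evalL (b i) (coordL d j)))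
  obtain ⟨C, hC⟩ := exists_norm_le_coordL d
  have hcoord : ∀ (j) (c : _ → ℝ), coordL d j (∑ k, c k • d k) = c j := by
    intro j c
    change d.coord j _ = _
    rw [d.coord_apply, d.repr_sum_self]
  set I' : ℝ → W := fun t => ∑ j, (I j t - I j 0) • d j with hI'
  have happ : IsOrder p T ω (⌊p⌋₊ + 1) (fun s t => I' t - I' s - germ p X H s t) := by
    refine isOrder_of_norm_le (fun s t _ _ _ => hC _) fun j => (hI j).congr fun s t _ _ _ => ?_
    rw [map_sub, map_sub, hI', hcoord, hcoord, apply_germ b, sub_sub_sub_cancel_right]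
  have hgerm : IsOrder p T ω 1 (fun s t => germ p X H s t) := by
    refine isOrder_of_norm_le (fun s t _ _ _ => hC _) fun j => ?_
    refine (isOrder_pairing_primitive hp hω hx fun i =>
      (hH.isWordControlled (b := b) hX (evalL (b i) (coordL d j))).bounded).congr
        fun s t _ _ _ => ?_
    rw [apply_germ b]
  have hreg : IsOrder p T ω 1 (fun s t => I' t - I' s) := by
    have h1 : IsOrder p T ω 1 (fun s t => I' t - I' s - germ p X H s t) := by
      refine isOrder_of_norm_le (fun s t _ _ _ => hC _) fun j => ?_
      exact (mem_pairFiltration hp hω).1 ((pairFiltration hp hω).anti (by omega)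
        ((mem_pairFiltration hp hω).2 (happ.clm (coordL d j))))
    exact (h1.add hgerm).congr fun _ _ _ _ _ => sub_add_cancel _ _
  exact ⟨I', by simp [hI'], ⟨continuousOn_of_isOrder_one hp hω hreg, hreg⟩, happ⟩

variable {b d}

/-- The canonical path above a rough integral is controlled with remainders of one order more than
its integrand. -/
theorem isWordControlled_pathCoords (hp : 1 ≤ p) (hω : IsControl T ω) (hT : 0 ≤ T)
    (hX : IsRoughPath p T ω X) (hH : IsControlled p T ω X H) (j : κ) :
    IsWordControlled p T ω (⌊p⌋₊ + 1) (fun s t => coords b (X s t))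
      (pathCoords b d p (controlledIntegral p T ω X H) j) := by
  have hI := isRoughIntegral_roughIntegral hp hω hT hX hH
  set I := roughIntegral p T ω X H
  have h := IsWordControlled.integral (hX.isWordRough (b := b))
    (fun i => hH.isWordControlled (b := b) hX (evalL (b i) (coordL d j)))
    (I := fun t => coordL d j (I t)) ((coordL d j).continuous.comp_continuousOn hI.regular.1)
    ((hI.approx.clm (coordL d j)).congr fun s t _ _ _ => by
      rw [map_sub, map_sub, apply_germ b])
  exact h.congr fun t _ _ => (truncate_unshift b (coordL d j) ⌊p⌋₊ (H t) (I t)).symm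

theorem isControlled_of_pathCoords [Fintype κ] (hp : 1 ≤ p) (hω : IsControl T ω)
    (hX : IsRoughPath p T ω X)
    {F : ℝ → FormalMultilinearSeries ℝ V W} (hF : ∀ j, IsWordControlled p T ω (⌊p⌋₊ + 1)
      (fun s t => coords b (X s t)) (pathCoords b d p F j)) : IsControlled p T ω X F := by
  refine isControlled_of_coords (b := b) hp hω hX (fun u hu => eq_zero_of_coordL d hu) fun j => ?_
  refine (((hF j).mono hp hω (Nat.le_succ _)).truncate hp hω hX.isWordRough).congr fun t _ _ => ?_
  exact truncate_truncate (Nat.le_succ _) _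

end Integral

end GeomRough

namespace GeomRough

open WordSeries Filter Topology Set
open scoped TensorProduct

variable {p T : ℝ} {ω : ℝ → ℝ → ℝ}

/-! ### Lifts of controlled paths -/

section Lift

variable {ι κ V W : Type*} [NormedAddCommGroup V] [NormedSpace ℝ V]
  [NormedAddCommGroup W] [NormedSpace ℝ W] [FiniteDimensional ℝ W]
  {b : Module.Basis ι ℝ V} {d : Module.Basis κ ℝ W}
  {X : ℝ → ℝ → Tensors V} {F : ℝ → FormalMultilinearSeries ℝ V W}

/-- The limit of products along partitions is unique. -/
theorem IsLift.coords_eq {Y Y' : ℝ → ℝ → Tensors W} (hY : IsLift p T X F Y)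
    (hY' : IsLift p T X F Y') {s t : ℝ} (hs : 0 ≤ s) (hst : s ≤ t) (ht : t ≤ T) {w : List κ}
    (hw : w.length ≤ ⌊p⌋₊) : coords d (Y s t) w = coords d (Y' s t) w := by
  have hsmall : ∀ ε > 0, ‖Y s t w.length - Y' s t w.length‖ < ε := by
    intro ε hε
    obtain ⟨δ, hδ, h⟩ := hY s t hs hst ht _ hw (ε / 2) (by linarith)
    obtain ⟨δ', hδ', h'⟩ := hY' s t hs hst ht _ hw (ε / 2) (by linarith)
    set η := min δ δ' / 2 with hη
    have hη0 : 0 < η := by positivity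
    have hηδ : η < δ := (half_lt_self (lt_min hδ hδ')).trans_le (min_le_left _ _)
    have hηδ' : η < δ' := (half_lt_self (lt_min hδ hδ')).trans_le (min_le_right _ _)
    obtain ⟨k, hk⟩ := exists_nat_ge ((t - s) / η)
    -- the partition of `[s, t]` into intervals of length `η`, the last one being shorter
    set τ : ℕ → ℝ := fun i => min (s + i * η) t with hτ
    have hmono : Monotone τ := fun i j hij => by
      have : (i : ℝ) ≤ j := by exact_mod_cast hij
      exact min_le_min_right _ (by nlinarith)
    have h0 : τ 0 = s := by simp [hτ, hst]
    have hkt : τ k = t := by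
      rw [div_le_iff₀ hη0] at hk
      exact min_eq_right (by linarith)
    have hstep : ∀ i, τ (i + 1) - τ i ≤ η := by
      intro i
      simp only [hτ, Nat.cast_add, Nat.cast_one]
      rcases le_total (s + i * η) t with h | h
      · rw [min_eq_left h]
        linarith [min_le_left (s + (i + 1 : ℝ) * η) t]
      · rw [min_eq_right h]
        linarith [min_le_right (s + (i + 1 : ℝ) * η) t]
    have e1 := h k τ hmono h0 hkt fun i _ => (hstep i).trans_lt hηδ
    have e2 := h' k τ hmono h0 hkt fun i _ => (hstep i).trans_lt hηδ'
    rw [← norm_neg, neg_sub] at e1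
    calc ‖Y s t w.length - Y' s t w.length‖
        = ‖(Y s t w.length - partitionProd (almostLift p X F) τ k w.length) +
            (partitionProd (almostLift p X F) τ k w.length - Y' s t w.length)‖ := by
          rw [sub_add_sub_cancel]
      _ ≤ _ := norm_add_le _ _
      _ < ε := by linarith
  have h0 : ‖Y s t w.length - Y' s t w.length‖ = 0 :=
    le_antisymm (le_of_forall_pos_le_add fun ε hε => by simpa using (hsmall ε hε).le)
      (norm_nonneg _)
  have h1 := abs_tensorCoord_le d (Y s t w.length - Y' s t w.length) w
  rw [h0, mul_zero, tensorCoord_sub, Pi.sub_apply] at h1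
  exact sub_eq_zero.1 (abs_nonpos_iff.1 h1)

variable [Fintype ι] [FiniteDimensional ℝ V]

/-- The almost rough path over a controlled path differs by terms of order `⌊p⌋ + 1` from a
pushforward. In degree one this is the local expansion of the path. -/
theorem isOrder_almostLift_sub (hX : IsRoughPath p T ω X)
    (hF : ∀ j, IsWordControlled p T ω (⌊p⌋₊ + 1) (fun s t => coords b (X s t))
      (pathCoords b d p F j)) {w : List κ} :
    IsOrder p T ω (⌊p⌋₊ + 1) (fun s t => coords d (almostLift p X F s t) w -
      pushforward ⌊p⌋₊ (fun j => pathCoords b d p F j s) (coords b (X s t)) w) := by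
  have hx := hX.isWordRough (b := b)
  match w with
  | [] =>
    refine ⟨0, fun s t h1 h2 h3 => ?_⟩
    beta_reduce
    rw [pushforward_nil, hx.mult.nil s t h1 h2 h3, coords_of_length d List.length_nil]
    have : tensorCoord d (almostLift p X F s t 0) [] = 1 := tensorCoord_tunit d
    simp [this]
  | [j] =>
    have h := (hF j).expansion []
    refine h.congr fun s t h1 h2 h3 => ?_
    set f := pathCoords b d p F j s
    have e1 : coords d (almostLift p X F s t) [j] =
        pathCoords b d p F j t [] - f [] := by
      have : coords d (almostLift p X F s t) [j] = tensorCoord d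
          (PiTensorProduct.tprod ℝ fun _ : Fin 1 => F t 0 0 - F s 0 0)
          (word fun _ : Fin 1 => j) := by
        rfl
      rw [this, tensorCoord_tprod_word, Fin.prod_univ_one, map_sub]
      have h0 : ∀ r, d.coord j (F r 0 0) = pathCoords b d p F j r [] := by
        intro r
        rw [pathCoords, truncate_of_lt _ (Nat.succ_pos _), seriesCoords]
        exact congrArg (fun v => d.coord j (F r 0 v)) (Subsingleton.elim _ _)
      rw [h0 t, h0 s]
    have e2 : f = f [] • WordSeries.unit + halfShuffle WordSeries.unit f := by
      funext w
      cases w with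
      | nil => simp
      | cons i w => simp
    rw [leftTranslate_nil, e1]
    conv_lhs => rw [e2]
    rw [pairing_add_right, pairing_smul_right, pairing_unit_right, hx.mult.nil s t h1 h2 h3,
      pushforward]
    simp
    ring
  | i :: j :: w =>
    refine ⟨0, fun s t h1 h2 h3 => ?_⟩
    beta_reduce
    rw [coords_almostLift b d X F s t (by simp), pushforward_congr (fun j v hv =>
      (truncate_of_lt (m := ⌊p⌋₊ + 1) (seriesCoords b (coordL d j) (F s))
        (Nat.lt_succ_of_le hv)).symm)]
    simp [pathCoords]

/-- The lift of a controlled path exists and is a rough path. -/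
theorem roughLift_spec [Fintype κ] (hp : 1 ≤ p) (hω : IsControl T ω) (hT : 0 ≤ T)
    (hX : IsRoughPath p T ω X)
    (hF : ∀ j, IsWordControlled p T ω (⌊p⌋₊ + 1) (fun s t => coords b (X s t))
      (pathCoords b d p F j)) :
    IsLift p T X F (roughLift p T X F) ∧ IsRoughPath p T ω (roughLift p T X F) ∧
    ∀ w : List κ, w.length ≤ ⌊p⌋₊ → IsOrder p T ω (⌊p⌋₊ + 1)
      (fun s t => coords d (roughLift p T X F s t) w -
        pushforward ⌊p⌋₊ (fun j => pathCoords b d p F j s) (coords b (X s t)) w) := by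
  have hx := hX.isWordRough (b := b)
  obtain ⟨y, hy, hyx⟩ := exists_lift hp hω hT hx hF
  have hlift : IsLift p T X F (fun s t => ofCoords d (y s t)) := by
    intro s t hs hst ht n hn ε hε
    obtain ⟨C, hC⟩ := exists_norm_le_tensorCoord d n
    set M : ℝ := |C| * Fintype.card (Fin n → κ) + 1 with hM
    have hM0 : 0 < M := by positivity
    obtain ⟨δ, hδ, h⟩ := exists_mesh_wordProd hp hω hT
      (A := fun s t => coords d (almostLift p X F s t)) hy.mult
      (fun w hw => (mem_pairFiltration hp hω).1 ((pairFiltration hp hω).anti (Nat.zero_le _)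
        ((mem_pairFiltration hp hω).2 (hy.order w hw))))
      (fun s t h1 h2 h3 => tensorCoord_tunit d)
      (fun w hw => ((isOrder_almostLift_sub hX hF (w := w)).sub (hyx w hw)).congr
        fun s t _ _ _ => sub_sub_sub_cancel_right _ _ _) (div_pos hε hM0)
    refine ⟨δ, hδ, fun k τ hτ h0 hk hstep => (hC _).trans_lt ?_⟩
    have h1 := h k τ hτ (h0 ▸ hs) (hk ▸ ht) hstep
    rw [h0, hk] at h1
    have h2 : ∀ z : Fin n → κ, |tensorCoord d (partitionProd (almostLift p X F) τ k n -
        ofCoords d (y s t) n) (word z)| ≤ ε / M := by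
      intro z
      rw [tensorCoord_sub, Pi.sub_apply, ← coords_of_length d (length_word z),
        ← coords_of_length d (length_word z), coords_partitionProd, coords_ofCoords]
      exact (h1 _ (by simpa using hn)).le
    have hcard : 0 ≤ (Fintype.card (Fin n → κ) : ℝ) := Nat.cast_nonneg _
    calc C * ∑ z : Fin n → κ, |tensorCoord d (partitionProd (almostLift p X F) τ k n -
          ofCoords d (y s t) n) (word z)|
        ≤ |C| * (Fintype.card (Fin n → κ) * (ε / M)) := by
          refine mul_le_mul (le_abs_self C) ?_ (Finset.sum_nonneg fun _ _ => abs_nonneg _)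
            (abs_nonneg C)
          exact (Finset.sum_le_sum fun z _ => h2 z).trans_eq (by simp)
      _ = |C| * Fintype.card (Fin n → κ) / M * ε := by ring
      _ < 1 * ε := mul_lt_mul_of_pos_right ((div_lt_one hM0).2 (lt_add_one _)) hε
      _ = ε := one_mul ε
  have hspec : IsLift p T X F (roughLift p T X F) := Classical.epsilon_spec ⟨_, hlift⟩
  have heq : ∀ s t, 0 ≤ s → s ≤ t → t ≤ T → ∀ w : List κ, w.length ≤ ⌊p⌋₊ →
      y s t w = coords d (roughLift p T X F s t) w := by
    intro s t h1 h2 h3 w hw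
    rw [← hlift.coords_eq hspec h1 h2 h3 hw, coords_ofCoords]
  refine ⟨hspec, (hy.congr heq).isRoughPath hp hω, fun w hw => (hyx w hw).congr
    fun s t h1 h2 h3 => ?_⟩
  rw [heq s t h1 h2 h3 w hw]

end Lift

end GeomRough

namespace GeomRough

open WordSeries Filter Topology Set
open scoped TensorProduct

variable {p T : ℝ} {ω : ℝ → ℝ → ℝ}

/-! ### Operations on controlled paths and associativity -/

section Operations

variable {ι κ V W U : Type*} [NormedAddCommGroup V] [NormedSpace ℝ V]
  [NormedAddCommGroup W] [NormedSpace ℝ W] [NormedAddCommGroup U] [NormedSpace ℝ U]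
  [FiniteDimensional ℝ W] [Fintype κ]
  (b : Module.Basis ι ℝ V) (d : Module.Basis κ ℝ W)

/-- The change of control, in coordinates: the levels below `m` are determined by the levels below
`m` of the two paths. -/
theorem truncate_changeControl (ℓ : U →L[ℝ] ℝ) (K : ℝ → FormalMultilinearSeries ℝ W U)
    (F : ℝ → FormalMultilinearSeries ℝ V W) (t : ℝ) {m : ℕ} (hm : m ≤ ⌊p⌋₊ + 1) :
    truncate m (seriesCoords b ℓ (changeControl K F t)) =
      truncate m (compose (truncate m (seriesCoords d ℓ (K t)))
        (fun j => pathCoords b d p F j t)) := by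
  refine truncate_congr fun w hw => ?_
  rw [changeControl, seriesCoords_taylorComp b d]
  exact compose_congr (fun v hv => (truncate_of_lt _ hv).symm)
    (fun j i v hv => (truncate_of_lt _ (by rw [List.length_cons]; omega)).symm) hw

/-- The product of controlled paths, in coordinates: the levels below `m` are determined by the
levels below `m` of the two factors. -/
theorem truncate_leibniz {Z : Type*} [NormedAddCommGroup Z] [NormedSpace ℝ Z]
    (K : ℝ → FormalMultilinearSeries ℝ V (W →L[ℝ] U))
    (H : ℝ → FormalMultilinearSeries ℝ V (Z →L[ℝ] W)) (z : Z) (ℓ : U →L[ℝ] ℝ) (t : ℝ) (m : ℕ) :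
    truncate m (seriesCoords b (evalL z ℓ) (leibniz K H t)) =
      truncate m (∑ j, WordSeries.shuffle (truncate m (seriesCoords b (evalL (d j) ℓ) (K t)))
        (truncate m (seriesCoords b (evalL z (coordL d j)) (H t)))) := by
  refine truncate_congr fun w hw => ?_
  rw [seriesCoords_leibniz b d, Finset.sum_apply, Finset.sum_apply]
  exact Finset.sum_congr rfl fun j _ => shuffle_congr
    (fun v hv => (truncate_of_lt _ (hv.trans_lt hw)).symm)
    fun v hv => (truncate_of_lt _ (hv.trans_lt hw)).symm

variable [Fintype ι] [FiniteDimensional ℝ V] [FiniteDimensional ℝ U] {b d}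
  {X : ℝ → ℝ → Tensors V} {Y : ℝ → ℝ → Tensors W}

/-- A path controlled by `Y` is, after a change of controlling rough path, controlled by `X`, if
`Y` is, up to terms of order `⌊p⌋ + 1`, the pushforward of `X` by `F`. -/
theorem isControlled_changeControl (hp : 1 ≤ p) (hω : IsControl T ω) (hX : IsRoughPath p T ω X)
    (hY : IsRoughPath p T ω Y) {F : ℝ → FormalMultilinearSeries ℝ V W}
    (hF : ∀ j, IsWordControlled p T ω (⌊p⌋₊ + 1) (fun s t => coords b (X s t))
      (pathCoords b d p F j))
    (hYX : ∀ w : List κ, w.length ≤ ⌊p⌋₊ → IsOrder p T ω (⌊p⌋₊ + 1)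
      (fun s t => coords d (Y s t) w -
        pushforward ⌊p⌋₊ (fun j => pathCoords b d p F j s) (coords b (X s t)) w))
    {K : ℝ → FormalMultilinearSeries ℝ W U} (hK : IsControlled p T ω Y K) :
    IsControlled p T ω X (changeControl K F) := by
  have hx := hX.isWordRough (b := b)
  refine isControlled_of_coords (b := b) hp hω hX
    (fun u hu => eq_zero_of_coordL (Module.finBasis ℝ U) hu) fun l => ?_
  refine ((IsWordControlled.compose hp hω hx hF hYX (Nat.le_succ _)
    (hK.isWordControlled (b := d) hY (coordL (Module.finBasis ℝ U) l))).truncate hp hω hx).congr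
      fun t _ _ => ?_
  exact (truncate_changeControl b d _ K F t (Nat.le_succ _)).symm

/-- The product of controlled paths is controlled. -/
theorem isControlled_leibniz {Z : Type*} [NormedAddCommGroup Z] [NormedSpace ℝ Z]
    [FiniteDimensional ℝ Z] (hp : 1 ≤ p) (hω : IsControl T ω) (hX : IsRoughPath p T ω X)
    {K : ℝ → FormalMultilinearSeries ℝ V (W →L[ℝ] U)}
    {H : ℝ → FormalMultilinearSeries ℝ V (Z →L[ℝ] W)} (hK : IsControlled p T ω X K)
    (hH : IsControlled p T ω X H) : IsControlled p T ω X (leibniz K H) := by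
  set b := Module.finBasis ℝ V
  set c := Module.finBasis ℝ Z
  set d := Module.finBasis ℝ W
  set e := Module.finBasis ℝ U
  have hx := hX.isWordRough (b := b)
  have hsep : ∀ A : Z →L[ℝ] U, (∀ a : _ × _, evalL (c a.1) (coordL e a.2) A = 0) → A = 0 := by
    intro A hA
    refine ContinuousLinearMap.coe_injective (c.ext fun i => ?_)
    exact eq_zero_of_coordL e fun l => hA (i, l)
  refine isControlled_of_coords (b := b) hp hω hX hsep fun a => ?_
  refine ((IsWordControlled.sum hp hω Finset.univ fun j _ => IsWordControlled.shuffle hp hω hx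
    (Nat.le_succ _) (hK.isWordControlled (b := b) hX (evalL (d j) (coordL e a.2)))
    (hH.isWordControlled (b := b) hX (evalL (c a.1) (coordL d j)))).truncate hp hω hx).congr
      fun t _ _ => ?_
  rw [truncate_leibniz b d, Finset.sum_apply]

end Operations

section Associativity

variable {ι κ ν V W U : Type*} [NormedAddCommGroup V] [NormedSpace ℝ V]
  [NormedAddCommGroup W] [NormedSpace ℝ W] [NormedAddCommGroup U] [NormedSpace ℝ U]
  [FiniteDimensional ℝ W] [FiniteDimensional ℝ U] [Fintype κ]
  {b : Module.Basis ι ℝ V} {d : Module.Basis κ ℝ W} {e : Module.Basis ν ℝ U}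
  {X : ℝ → ℝ → Tensors V} {Y : ℝ → ℝ → Tensors W}
  {H : ℝ → FormalMultilinearSeries ℝ V (V →L[ℝ] W)}
  {K : ℝ → FormalMultilinearSeries ℝ W (W →L[ℝ] U)}

/-- Associativity in coordinates, in the positive levels: both sides have the same derivative,
by the chain rule `der_compose`. -/
theorem compose_pathCoords_cons (l : ν) (t : ℝ) (i : ι) {w : List ι} (hw : w.length < ⌊p⌋₊) :
    compose (pathCoords d e p (controlledIntegral p T ω Y K) l t)
        (fun j => pathCoords b d p (controlledIntegral p T ω X H) j t) (i :: w) =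
      pathCoords b e p (controlledIntegral p T ω X
        (leibniz (changeControl K (controlledIntegral p T ω X H)) H)) l t (i :: w) := by
  have h3 : der i (pathCoords b e p (controlledIntegral p T ω X
      (leibniz (changeControl K (controlledIntegral p T ω X H)) H)) l t) = _ :=
    congrArg (der i) (truncate_unshift b (coordL e l) ⌊p⌋₊ _ _)
  have h2 : ∀ j, der j (pathCoords d e p (controlledIntegral p T ω Y K) l t) = _ := fun j =>
    congrArg (der j) (truncate_unshift d (coordL e l) ⌊p⌋₊ _ _)
  have h1 : ∀ j, der i (pathCoords b d p (controlledIntegral p T ω X H) j t) = _ := fun j =>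
    congrArg (der i) (truncate_unshift b (coordL d j) ⌊p⌋₊ _ _)
  refine Eq.trans ?_ (congrFun h3 w).symm
  change _ = truncate ⌊p⌋₊ (seriesCoords b (evalL (b i) (coordL e l)) _) w
  rw [truncate_leibniz b d, truncate_of_lt _ hw, compose_cons, Finset.sum_apply]
  refine Finset.sum_congr rfl fun j _ => ?_
  rw [truncate_changeControl (p := p) b d _ _ _ _ (Nat.le_succ _), h2, h1]
  exact shuffle_congr (fun v hv => (truncate_of_lt _ (hv.trans_lt hw)).symm) fun _ _ => rfl

variable [Fintype ι] [FiniteDimensional ℝ V]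

/-- Associativity in coordinates. The two traces agree at time `0`, and the increments of their
difference are of order `⌊p⌋ + 1`. -/
theorem compose_pathCoords (hp : 1 ≤ p) (hω : IsControl T ω) (hT : 0 ≤ T)
    (hX : IsRoughPath p T ω X) (hH : IsControlled p T ω X H) (hY : IsRoughPath p T ω Y)
    (hYX : ∀ w : List κ, w.length ≤ ⌊p⌋₊ → IsOrder p T ω (⌊p⌋₊ + 1)
      (fun s t => coords d (Y s t) w - pushforward ⌊p⌋₊
        (fun j => pathCoords b d p (controlledIntegral p T ω X H) j s) (coords b (X s t)) w))
    (hK : IsControlled p T ω Y K) (l : ν) {t : ℝ} (h0t : 0 ≤ t) (htT : t ≤ T) {w : List ι}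
    (hw : w.length ≤ ⌊p⌋₊) :
    compose (pathCoords d e p (controlledIntegral p T ω Y K) l t)
        (fun j => pathCoords b d p (controlledIntegral p T ω X H) j t) w =
      pathCoords b e p (controlledIntegral p T ω X
        (leibniz (changeControl K (controlledIntegral p T ω X H)) H)) l t w := by
  cases w with
  | cons i w => exact compose_pathCoords_cons l t i (by simpa using hw)
  | nil =>
  set F := controlledIntegral p T ω X H
  have hF := isWordControlled_pathCoords (b := b) (d := d) hp hω hT hX hH
  have hΛ : IsControlled p T ω X (leibniz (changeControl K F) H) :=
    isControlled_leibniz hp hω hX (isControlled_changeControl hp hω hX hY hF hYX hK) hH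
  have h2 := isWordControlled_pathCoords (b := d) (d := e) hp hω hT hY hK l
  have h3 := isWordControlled_pathCoords (b := b) (d := e) hp hω hT hX hΛ l
  -- at time `s` the two sides differ by a multiple of the unit, as their derivatives agree
  have hcons := fun s i w => compose_pathCoords_cons (p := p) (T := T) (ω := ω) (b := b) (d := d)
    (e := e) (X := X) (Y := Y) (H := H) (K := K) l s i (w := w)
  have e2 : pathCoords d e p (controlledIntegral p T ω Y K) l 0 [] = 0 := by
    rw [pathCoords, controlledIntegral, truncate_unshift,
      (isRoughIntegral_roughIntegral hp hω hT hY hK).zero]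
    exact map_zero _
  have e3 : pathCoords b e p (controlledIntegral p T ω X (leibniz (changeControl K F) H)) l 0 [] =
      0 := by
    rw [pathCoords, controlledIntegral, truncate_unshift,
      (isRoughIntegral_roughIntegral hp hω hT hX hΛ).zero]
    exact map_zero _
  set J := fun j => pathCoords b d p F j
  set J2 := pathCoords d e p (controlledIntegral p T ω Y K) l
  set J3 := pathCoords b e p (controlledIntegral p T ω X (leibniz (changeControl K F) H)) l
  have hx := hX.isWordRough (b := b)
  have key : IsOrder p T ω (⌊p⌋₊ + 1)
      (fun s t => (J2 t [] - J3 t []) - (J2 s [] - J3 s [])) := by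
    refine (((h2.expansion []).add (isOrder_pairing_sub_compose hp hω (J := J) hYX
      h2.bounded)).sub (h3.expansion [])).congr fun s t h1 h2 h3 => ?_
    have hc : pairing ⌊p⌋₊ (coords b (X s t)) (compose (J2 s) fun j => J j s) =
        pairing ⌊p⌋₊ (coords b (X s t)) (J3 s + (J2 s [] - J3 s []) • WordSeries.unit) := by
      refine pairing_congr (fun _ _ => rfl) fun w hw => ?_
      cases w with
      | nil => simp
      | cons i w => simpa using hcons s i w (by simpa using hw)
    rw [leftTranslate_nil, leftTranslate_nil, hc, pairing_add_right, pairing_smul_right,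
      pairing_unit_right, hx.mult.nil s t h1 h2 h3]
    ring
  obtain ⟨C, hC⟩ := key
  have := eq_zero_of_additive hω (one_lt_order_div hp)
    (d := fun s t => (J2 t [] - J3 t []) - (J2 s [] - J3 s [])) (fun s u t _ _ _ _ => by ring)
    hC le_rfl h0t htT
  rw [e2, e3] at this
  rw [compose_nil]
  linarith

/-- Associativity for the controlled paths. -/
theorem eqControlled_changeControl_integral (hp : 1 ≤ p) (hω : IsControl T ω)
    (hT : 0 ≤ T) (hX : IsRoughPath p T ω X) (hH : IsControlled p T ω X H)
    (hY : IsRoughPath p T ω Y)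
    (hYX : ∀ w : List κ, w.length ≤ ⌊p⌋₊ → IsOrder p T ω (⌊p⌋₊ + 1)
      (fun s t => coords d (Y s t) w - pushforward ⌊p⌋₊
        (fun j => pathCoords b d p (controlledIntegral p T ω X H) j s) (coords b (X s t)) w))
    (hK : IsControlled p T ω Y K) :
    EqControlled p T
      (changeControl (controlledIntegral p T ω Y K) (controlledIntegral p T ω X H))
      (controlledIntegral p T ω X
        (leibniz (changeControl K (controlledIntegral p T ω X H)) H)) := by
  set e := Module.finBasis ℝ U
  intro t h0t htT n hn
  refine ContinuousMultilinearMap.toMultilinearMap_injective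
    (Module.Basis.ext_multilinear (fun _ => b) fun y => sub_eq_zero.1 ?_)
  refine eq_zero_of_coordL e fun l => ?_
  have h := compose_pathCoords (b := b) (d := d) (e := e) hp hω hT hX hH hY hYX hK l h0t htT
    (w := word y) (by simpa using hn.le)
  have hlt : (word y).length < ⌊p⌋₊ + 1 := by simpa using hn.trans (Nat.lt_succ_self _)
  have h' := congrFun (truncate_changeControl (p := p) b d (coordL e l)
    (controlledIntegral p T ω Y K) (controlledIntegral p T ω X H) t le_rfl) (word y)
  rw [truncate_of_lt _ hlt, truncate_of_lt _ hlt] at h'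
  have h3 := h'.trans h
  rw [pathCoords, truncate_of_lt _ hlt, seriesCoords_word, seriesCoords_word] at h3
  rw [map_sub]
  exact sub_eq_zero.2 h3

/-- Associativity for the rough paths: two rough paths that agree up to terms of order `⌊p⌋ + 1`
with the same pushforward are equal. -/
theorem eqRough_integralLift (hp : 1 ≤ p) (hω : IsControl T ω)
    (hT : 0 ≤ T) (hX : IsRoughPath p T ω X) (hH : IsControlled p T ω X H)
    (hY : IsRoughPath p T ω Y)
    (hYX : ∀ w : List κ, w.length ≤ ⌊p⌋₊ → IsOrder p T ω (⌊p⌋₊ + 1)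
      (fun s t => coords d (Y s t) w - pushforward ⌊p⌋₊
        (fun j => pathCoords b d p (controlledIntegral p T ω X H) j s) (coords b (X s t)) w))
    (hK : IsControlled p T ω Y K) :
    EqRough p T (integralLift p T ω Y K) (integralLift p T ω X
        (leibniz (changeControl K (controlledIntegral p T ω X H)) H)) := by
  set e := Module.finBasis ℝ U
  have hF := isWordControlled_pathCoords (b := b) (d := d) hp hω hT hX hH
  have hΛ : IsControlled p T ω X (leibniz (changeControl K (controlledIntegral p T ω X H)) H) :=
    isControlled_leibniz hp hω hX (isControlled_changeControl hp hω hX hY hF hYX hK) hH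
  have h2 := isWordControlled_pathCoords (b := d) (d := e) hp hω hT hY hK
  have h3 := isWordControlled_pathCoords (b := b) (d := e) hp hω hT hX hΛ
  obtain ⟨-, hr2, ho2⟩ := roughLift_spec hp hω hT hY h2
  obtain ⟨-, hr3, ho3⟩ := roughLift_spec hp hω hT hX h3
  intro s t hs hst ht n hn
  refine tensor_ext e fun w hw => ?_
  rw [← coords_of_length e hw, ← coords_of_length e hw]
  refine (hr2.isWordRough (b := e)).mult.eq_of_isOrder hp hω (hr3.isWordRough (b := e)).mult
    (fun v hv => ?_) (hw.trans_le hn) hs hst ht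
  refine (((ho2 v hv).add (isOrder_pushforward_sub_pushforward hp hω hYX
    (fun l => (h2 l).bounded) v)).sub (ho3 v hv)).congr fun s t h1 h2 h3 => ?_
  rw [pushforward_congr fun l w hw => compose_pathCoords hp hω hT hX hH hY hYX hK l h1
    (h2.trans h3) hw]
  ring

end Associativity

end GeomRough

theorem mainTheorem2
    {V W U : Type*}
    [NormedAddCommGroup V] [NormedSpace ℝ V] [FiniteDimensional ℝ V]
    [NormedAddCommGroup W] [NormedSpace ℝ W] [FiniteDimensional ℝ W]
    [NormedAddCommGroup U] [NormedSpace ℝ U] [FiniteDimensional ℝ U]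
    (p T : ℝ) (hp : 1 ≤ p) (hT : 0 < T) (ω : ℝ → ℝ → ℝ) (hω : IsControl T ω)
    (X : ℝ → ℝ → Tensors V) (hX : IsRoughPath p T ω X)
    (H : ℝ → FormalMultilinearSeries ℝ V (V →L[ℝ] W)) (hH : IsControlled p T ω X H)
    -- the canonical controlled path and the canonical rough path above `I = ∫ H dX`
    (Ibar : ℝ → FormalMultilinearSeries ℝ V W) (hIbar : Ibar = controlledIntegral p T ω X H)
    (II : ℝ → ℝ → Tensors W) (hII : II = integralLift p T ω X H) :
    -- `I` exists, and `Ibar` and `II` are well defined controlled and rough paths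
    IsRoughIntegral p T ω X H (roughIntegral p T ω X H) ∧
    IsControlled p T ω X Ibar ∧
    IsLift p T X Ibar II ∧ IsRoughPath p T ω II ∧
    ∀ K : ℝ → FormalMultilinearSeries ℝ W (W →L[ℝ] U), IsControlled p T ω II K →
      -- both sides of the two identities are well defined
      IsRoughIntegral p T ω II K (roughIntegral p T ω II K) ∧
      IsControlled p T ω II (controlledIntegral p T ω II K) ∧
      IsControlled p T ω X (changeControl (controlledIntegral p T ω II K) Ibar) ∧
      IsControlled p T ω X (leibniz (changeControl K Ibar) H) ∧
      IsRoughIntegral p T ω X (leibniz (changeControl K Ibar) H)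
        (roughIntegral p T ω X (leibniz (changeControl K Ibar) H)) ∧
      IsControlled p T ω X (controlledIntegral p T ω X (leibniz (changeControl K Ibar) H)) ∧
      IsLift p T II (controlledIntegral p T ω II K) (integralLift p T ω II K) ∧
      IsRoughPath p T ω (integralLift p T ω II K) ∧
      IsLift p T X (controlledIntegral p T ω X (leibniz (changeControl K Ibar) H))
        (integralLift p T ω X (leibniz (changeControl K Ibar) H)) ∧
      IsRoughPath p T ω (integralLift p T ω X (leibniz (changeControl K Ibar) H)) ∧
      -- the identity of controlled paths
      EqControlled p T (changeControl (controlledIntegral p T ω II K) Ibar)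
        (controlledIntegral p T ω X (leibniz (changeControl K Ibar) H)) ∧
      -- the identity of rough paths
      EqRough p T (integralLift p T ω II K)
        (integralLift p T ω X (leibniz (changeControl K Ibar) H)) := by
  subst hIbar
  subst hII
  have hT' := hT.le
  set b := Module.finBasis ℝ V
  set d := Module.finBasis ℝ W
  set e := Module.finBasis ℝ U
  have hF := isWordControlled_pathCoords (b := b) (d := d) hp hω hT' hX hH
  obtain ⟨hlift, hII, hYX⟩ := roughLift_spec hp hω hT' hX hF
  refine ⟨isRoughIntegral_roughIntegral hp hω hT' hX hH, isControlled_of_pathCoords hp hω hX hF,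
    hlift, hII, fun K hK => ?_⟩
  have h2 := isWordControlled_pathCoords (b := d) (d := e) hp hω hT' hII hK
  have hKc := isControlled_of_pathCoords hp hω hII h2
  have hΛ : IsControlled p T ω X (leibniz (changeControl K (controlledIntegral p T ω X H)) H) :=
    isControlled_leibniz hp hω hX (isControlled_changeControl hp hω hX hII hF hYX hK) hH
  have h3 := isWordControlled_pathCoords (b := b) (d := e) hp hω hT' hX hΛ
  obtain ⟨hlift2, hrough2, -⟩ := roughLift_spec hp hω hT' hII h2
  obtain ⟨hlift3, hrough3, -⟩ := roughLift_spec hp hω hT' hX h3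
  exact ⟨isRoughIntegral_roughIntegral hp hω hT' hII hK, hKc,
    isControlled_changeControl hp hω hX hII hF hYX hKc, hΛ,
    isRoughIntegral_roughIntegral hp hω hT' hX hΛ, isControlled_of_pathCoords hp hω hX h3,
    hlift2, hrough2, hlift3, hrough3,
    eqControlled_changeControl_integral hp hω hT' hX hH hII hYX hK,
    eqRough_integralLift hp hω hT' hX hH hII hYX hK⟩
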